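/- Let $n\ge 1$, let $\mathbb B^n=\{z\in\mathbb C^n:|z|<1\}$ be the unit ball, $S=\partial\mathbb B^n$, and let $dm$ and $d\sigma$ be the normalized Lebesgue measures on $\mathbb B^n$ and $S$. For $0<p\le\infty$ and a real number $\alpha\ge-1/p$ (with $1/\infty=0$), let $B_\alpha^p=B_\alpha^p(\mathbb B^n)$ be the space of all holomorphic functions $f$ on $\mathbb B^n$ such that - $\int_{\mathbb B^n}(1-|z|^2)^{\alpha p}|f(z)|^p\,dm(z)<\infty$, if $p<\infty$ and $\alpha>-1/p$; - $\sup_{0<r<1}\int_{S}|f(r\zeta)|^p\,d\sigma(\zeta)<\infty$, if $p<\infty$ and $\alpha=-1/p$ (so that $B^p_{-1/p}$ is the Hardy space $H^p$); - $\sup_{z\in\mathbb B^n}(1-|z|^2)^\alpha|f(z)|<\infty$, if $p=\infty$. **Lemma 2.1.** Let $0<p,p'\le\infty$, $\alpha\ge-1/p$ and $\alpha'\ge-1/p'$. (a) If $p\le p'$, then $B_\alpha^p\subset B_{\alpha'}^{p'}$ if and only if $\alpha+\frac{n+1}{p}\le\alpha'+\frac{n+1}{p'}$. (b) If $p\ge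 p'$, then $\alpha+\frac1p<\alpha'+\frac1{p'}$ implies $B_\alpha^p\subset B_{\alpha'}^{p'}$, and $B_\alpha^p\subset B_{\alpha'}^{p'}$ implies $\alpha+\frac1p\le\alpha'+\frac1{p'}$. -/

import Mathlib

open scoped ENNReal
open MeasureTheory

noncomputable section

/-- Complex Euclidean space of dimension `n`, with its Hermitian norm. -/
abbrev Cn (n : ℕ) : Type := EuclideanSpace ℂ (Fin n)

/-- The open unit ball of complex Euclidean space. -/
abbrev unitBall (n : ℕ) : Set (Cn n) := Metric.ball (0 : Cn n) 1

/-- Normalized Lebesgue measure on the unit ball. -/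
def ballMeasure (n : ℕ) : Measure (Cn n) :=
  (volume (unitBall n))⁻¹ • volume.restrict (unitBall n)

/-- Normalized Lebesgue (surface) measure on the unit sphere. -/
def sphereMeasure (n : ℕ) : Measure (Metric.sphere (0 : Cn n) 1) :=
  ((volume : Measure (Cn n)).toSphere Set.univ)⁻¹ • (volume : Measure (Cn n)).toSphere

/-- The exponent reciprocal `1 / p` as a real number, with `1 / ∞ = 0`. -/
def recip (p : ℝ≥0∞) : ℝ := (p⁻¹).toReal

/-- The (quasi-)norm of the weighted Bergman space with parameters `p` and `α`, with value `∞`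
when `f` is not in the space:
* for `p = ∞` it is the supremum over the ball of `(1 - |z|²) ^ α * |f z|`;
* for `p < ∞` and `α = -1/p` it is the Hardy norm, the supremum over the radii `0 < r < 1` of the
  `L^p` norm of `f` on the sphere of radius `r`;
* for all other values it is the `L^p` norm of `(1 - |z|²) ^ α * f z` over the ball.
Only the values of `f` in the open ball matter. -/
def bergmanNorm (n : ℕ) (p : ℝ≥0∞) (α : ℝ) (f : Cn n → ℂ) : ℝ≥0∞ :=
  open scoped Classical in
  if p = ∞ then
    ⨆ z ∈ unitBall n, ENNReal.ofReal ((1 - ‖z‖ ^ 2) ^ α * ‖f z‖)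
  else if α = -recip p then
    ⨆ r ∈ Set.Ioo (0 : ℝ) 1,
      eLpNorm (fun ζ : Metric.sphere (0 : Cn n) 1 => f ((r : ℂ) • (ζ : Cn n))) p (sphereMeasure n)
  else
    eLpNorm (fun z : Cn n => (((1 - ‖z‖ ^ 2) ^ α : ℝ) : ℂ) * f z) p (ballMeasure n)

/-- The weighted Bergman space with parameters `p` and `α`: the functions that are holomorphic in
the unit ball and have finite norm. For `α = -1/p` this is the Hardy space `H^p`, and for `p = ∞`
the space of holomorphic functions of polynomial growth of order `α`. -/
def bergmanSpace (n : ℕ) (p : ℝ≥0∞) (α : ℝ) : Set (Cn n → ℂ) :=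
  {f | DifferentiableOn ℂ f (unitBall n) ∧ bergmanNorm n p α f < ∞}

end

/-! ### Submean inequalities on circles for powers of moduli. -/

noncomputable section

/-! Every space is compared with the pointwise growth of its members, using `bergmanMass` and
`hardyMass` for the unnormalized integrals.

Growth. Around `z` there is a nonisotropic set of volume about `(1 - |z|²) ^ (n + 1)`, circled about
`z`, on which `1 - |w|²` is comparable to `1 - |z|²`. Averaging the submean function `|f| ^ p` over
it gives `|f z| ≤ C (1 - |z|²) ^ (-(α + (n + 1) / p))` (`growth_of_mem`).

Sufficiency in (a). Between Bergman spaces, write `|f| ^ p' = |f| ^ (p' - p) |f| ^ p` and bound the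
first factor by the growth. From a Hardy space this loses a logarithm at the endpoint, and the
Hardy–Littlewood embedding `bergmanMass_lt_top_of_hardy` replaces it. Its proof uses that the
spherical means of a convex increasing function of `|f| ^ a` increase with the radius; neither
boundary values nor maximal functions enter.

Necessity in (a). If the inequality failed, some `(1 - z₁) ^ (-s)` would belong to the small space
while growing too fast on the first axis for the large one. Membership comes from Hardy spaces,
where it is a computation with nonisotropic caps, or directly from growth if `p = ∞`.

Sufficiency in (b). Split the ball by the size of `f`; for `p = ∞` integrate the growth bound.

Necessity in (b). For `γ` strictly between the two sides a lacunary series `∑ a_j P_j` has growth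
`γ`, hence lies in the small space, but has infinite weighted `L¹` mass for every weight exponent `c
< γ - 1` (`exists_growth_bergmanMass_eq_top`). A function of growth `γ` in the large space would
have finite mass for one such `c`. The `P_j` are homogeneous polynomials of degree `2 ^ j` that are
nearly flat on the sphere; random signs and Khinchine's inequality produce them
(`exists_homogeneous_flat`). -/

open Metric Set Filter in
theorem AnalyticOnNhd.log_norm_le_circleAverage {h : ℂ → ℂ} {c : ℂ} {R : ℝ} (hR : 0 < R)
    (hh : AnalyticOnNhd ℂ h (closedBall c R)) (hc : h c ≠ 0) :
    Real.log ‖h c‖ ≤ Real.circleAverage (fun z => Real.log ‖h z‖) c R := by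
  have hh' : AnalyticOnNhd ℂ h (closedBall c |R|) := by rwa [abs_of_pos hR]
  -- Jensen's formula: the average exceeds `log ‖h c‖` by a sum over the zeros `u` of multiplicity
  -- times `log (R / ‖c - u‖)`.
  rw [AnalyticOnNhd.circleAverage_log_norm hR.ne' hh' hc]
  refine le_add_of_nonneg_left (finsum_nonneg fun u => ?_)
  by_cases hu : u ∈ closedBall c |R|
  · refine mul_nonneg (by exact_mod_cast (MeromorphicOn.AnalyticOnNhd.divisor_nonneg hh') u) ?_
    rcases eq_or_ne c u with rfl | hne
    -- For `u = c` the logarithm is `log (R * 0⁻¹) = log 0 = 0`.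
    · simp
    · refine Real.log_nonneg ?_
      have h1 : 0 < ‖c - u‖ := norm_pos_iff.2 (sub_ne_zero.2 hne)
      rw [← div_eq_mul_inv, one_le_div h1]
      rw [mem_closedBall, dist_comm, dist_eq_norm, abs_of_pos hR] at hu
      exact hu
  · rw [Function.locallyFinsuppWithin.apply_eq_zero_of_notMem _ hu]
    simp

/-- A positive power of the modulus of a holomorphic function is submean. -/
theorem AnalyticOnNhd.norm_rpow_le_circleAverage {h : ℂ → ℂ} {c : ℂ} {R a : ℝ} (hR : 0 < R)
    (ha : 0 < a) (hh : AnalyticOnNhd ℂ h (Metric.closedBall c R)) :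
    ‖h c‖ ^ a ≤ Real.circleAverage (fun z => ‖h z‖ ^ a) c R := by
  have habs : |R| = R := abs_of_pos hR
  by_cases hc : h c = 0
  · rw [hc, norm_zero, Real.zero_rpow ha.ne']
    exact Real.circleAverage_nonneg_of_nonneg fun x _ => by positivity
  set m := ‖h c‖ with hm
  have hmpos : 0 < m := norm_pos_iff.2 hc
  have hne : ∀ᶠ z in Filter.codiscreteWithin (Metric.sphere c |R|), h z ≠ 0 := by
    refine Filter.codiscreteWithin_mono (U := Metric.closedBall c R)
      (by rw [habs]; exact Metric.sphere_subset_closedBall) ?_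
    rcases hh.eqOn_zero_or_eventually_ne_zero_of_preconnected
      (convex_closedBall c R).isPreconnected with h0 | h0
    · exact absurd (h0 (Metric.mem_closedBall_self hR.le)) hc
    · exact h0
  have hlogint : CircleIntegrable (fun z => Real.log ‖h z‖) c R := by
    apply MeromorphicOn.circleIntegrable_log_norm
    rw [habs]
    exact fun z hz => (hh z (Metric.sphere_subset_closedBall hz)).meromorphicAt
  -- Tangent line of `exp` at `a * log m`, evaluated at `a * log ‖h z‖`: it lies below `‖h z‖ ^ a`
  -- and is affine in the submean function `log ‖h‖`.
  set T : ℂ → ℝ := fun z => m ^ a * (1 - a * Real.log m) + (m ^ a * a) * Real.log ‖h z‖ with hT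
  have hlogint' : CircleIntegrable (fun z => (m ^ a * a) • Real.log ‖h z‖) c R :=
    hlogint.const_mul _
  have hTint : CircleIntegrable T c R := (circleIntegrable_const _ c R).add hlogint'
  -- Since `Real.log 0 = 0`, `T` may be positive at a zero of `h`. Resetting it there changes only a
  -- discrete set, so the average is unaffected.
  set T' : ℂ → ℝ := fun z => if h z = 0 then 0 else T z with hT'
  have hTT' : T =ᶠ[Filter.codiscreteWithin (Metric.sphere c |R|)] T' := by
    filter_upwards [hne] with z hz
    simp [hT', hz]
  have hcont : ContinuousOn (fun z => ‖h z‖ ^ a) (Metric.closedBall c R) :=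
    hh.continuousOn.norm.rpow_const fun _ _ => Or.inr ha.le
  calc m ^ a = m ^ a * (1 - a * Real.log m) + (m ^ a * a) * Real.log m := by ring
    _ ≤ m ^ a * (1 - a * Real.log m)
        + (m ^ a * a) * Real.circleAverage (fun z => Real.log ‖h z‖) c R := by
      gcongr
      exact hh.log_norm_le_circleAverage hR hc
    _ = Real.circleAverage T c R := by
      have := Real.circleAverage_fun_add
        (circleIntegrable_const (m ^ a * (1 - a * Real.log m)) c R) hlogint'
      rw [Real.circleAverage_const, Real.circleAverage_fun_smul] at this
      exact this.symm
    _ = Real.circleAverage T' c R := Real.circleAverage_congr_codiscreteWithin hTT' hR.ne'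
    _ ≤ _ := by
      refine Real.circleAverage_mono (hTint.congr_codiscreteWithin hTT') ?_ ?_
      · exact (hcont.mono Metric.sphere_subset_closedBall).circleIntegrable hR.le
      · intro z _
        by_cases hz : h z = 0
        · simp only [hT', hz, if_true]; positivity
        · simp only [hT', hz, if_false, hT]
          have hzpos : 0 < ‖h z‖ := norm_pos_iff.2 hz
          have h1 : ‖h z‖ ^ a = m ^ a * Real.exp (a * (Real.log ‖h z‖ - Real.log m)) := by
            rw [Real.rpow_def_of_pos hzpos, Real.rpow_def_of_pos hmpos, ← Real.exp_add]
            ring_nf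
          rw [h1]
          have h2 := Real.add_one_le_exp (a * (Real.log ‖h z‖ - Real.log m))
          have h3 : 0 ≤ m ^ a := by positivity
          nlinarith

/-- The convex function that is quadratic on `[0, L]` and is continued linearly. -/
def huber (L x : ℝ) : ℝ := if x ≤ L then x ^ 2 else 2 * L * x - L ^ 2

theorem huber_of_le {L x : ℝ} (h : x ≤ L) : huber L x = x ^ 2 := if_pos h

theorem huber_le_sq (L x : ℝ) : huber L x ≤ x ^ 2 := by
  unfold huber; split_ifs <;> nlinarith [sq_nonneg (x - L)]

theorem huber_le_linear {L x : ℝ} (hx : 0 ≤ x) : huber L x ≤ 2 * L * x := by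
  unfold huber; split_ifs <;> nlinarith [sq_nonneg L]

theorem huber_nonneg {L x : ℝ} (hL : 0 ≤ L) : 0 ≤ huber L x := by
  unfold huber; split_ifs <;> nlinarith [sq_nonneg x]

theorem huber_eq_tangent (L x : ℝ) : huber L x = 2 * min x L * x - min x L ^ 2 := by
  unfold huber; split_ifs with h
  · rw [min_eq_left h]; ring
  · rw [min_eq_right (by linarith)]

/-- `huber L` is the upper envelope of the tangents to `x ^ 2` at points `y ≤ L`; together with
`huber_eq_tangent` this is all the convexity that is used. -/
theorem tangent_le_huber {L y : ℝ} (hy : y ≤ L) (x : ℝ) : 2 * y * x - y ^ 2 ≤ huber L x := by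
  unfold huber; split_ifs <;> nlinarith [sq_nonneg (x - y)]

theorem continuous_huber (L : ℝ) : Continuous (huber L) := by
  have : huber L = fun x => 2 * min x L * x - min x L ^ 2 := funext fun x => huber_eq_tangent L x
  rw [this]; fun_prop

theorem AnalyticOnNhd.huber_norm_rpow_le_circleAverage {h : ℂ → ℂ} {c : ℂ} {R a : ℝ} (hR : 0 < R)
    (ha : 0 < a) (hh : AnalyticOnNhd ℂ h (Metric.closedBall c R)) {L : ℝ} (hL : 0 ≤ L) :
    huber L (‖h c‖ ^ a) ≤ Real.circleAverage (fun z => huber L (‖h z‖ ^ a)) c R := by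
  have hcont : ContinuousOn (fun z => ‖h z‖ ^ a) (Metric.closedBall c R) :=
    hh.continuousOn.norm.rpow_const fun _ _ => Or.inr ha.le
  have hint : CircleIntegrable (fun z => ‖h z‖ ^ a) c R :=
    (hcont.mono Metric.sphere_subset_closedBall).circleIntegrable hR.le
  -- Point of tangency for the value at the centre. The slope `2 * y` is nonnegative, so the submean
  -- inequality for `‖h‖ ^ a` survives multiplication by it.
  set y := min (‖h c‖ ^ a) L with hy
  have hy0 : 0 ≤ y := le_min (by positivity) hL
  have hint2 : CircleIntegrable (fun z => (2 * y) • ‖h z‖ ^ a) c R := hint.const_mul _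
  calc huber L (‖h c‖ ^ a) = 2 * y * ‖h c‖ ^ a - y ^ 2 := huber_eq_tangent _ _
    _ ≤ 2 * y * Real.circleAverage (fun z => ‖h z‖ ^ a) c R - y ^ 2 := by
      gcongr
      exact hh.norm_rpow_le_circleAverage hR ha
    _ = Real.circleAverage (fun z => (2 * y) • ‖h z‖ ^ a - y ^ 2) c R := by
      rw [Real.circleAverage_fun_sub hint2 (circleIntegrable_const _ c R),
        Real.circleAverage_const, Real.circleAverage_fun_smul]
      rfl
    _ ≤ _ := by
      refine Real.circleAverage_mono (hint2.sub (circleIntegrable_const _ c R)) ?_ ?_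
      · exact (((continuous_huber L).comp_continuousOn hcont).mono
          Metric.sphere_subset_closedBall).circleIntegrable hR.le
      · intro z _
        exact tangent_le_huber (min_le_right _ _) _

open Set in
/-- A continuous radial function with the local submean property is radially increasing. -/
theorem radial_mono_of_submean {N : ℂ → ℝ} {ρ : ℝ}
    (hcont : ContinuousOn N (Metric.closedBall 0 ρ))
    (hrad : ∀ z, N z = N (‖z‖ : ℂ))
    (hsub : ∀ c : ℂ, ∀ ε, 0 < ε → ‖c‖ + ε ≤ ρ → N c ≤ Real.circleAverage N c ε)
    {r : ℝ} (hr0 : 0 ≤ r) (hr : r ≤ ρ) : N r ≤ N ρ := by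
  have hρ : 0 ≤ ρ := hr0.trans hr
  have hcomp : ContinuousOn (fun t : ℝ => N (t : ℂ)) (Icc 0 ρ) :=
    hcont.comp Complex.continuous_ofReal.continuousOn fun t ht => by
      simpa [abs_of_nonneg ht.1] using ht.2
  obtain ⟨s0, hs0, hmax⟩ := isCompact_Icc.exists_isMaxOn (nonempty_Icc.2 hρ) hcomp
  set M := N (s0 : ℂ) with hM
  have hle : ∀ z : ℂ, ‖z‖ ≤ ρ → N z ≤ M := fun z hz => by
    rw [hrad z]; exact hmax ⟨norm_nonneg z, hz⟩
  have hclosed : IsCompact (Icc 0 ρ ∩ (fun t : ℝ => N (t : ℂ)) ⁻¹' {M}) :=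
    isCompact_Icc.of_isClosed_subset
      (hcomp.preimage_isClosed_of_isClosed isClosed_Icc isClosed_singleton) inter_subset_left
  -- Maximum principle at the largest maximizer `s`. If `s < ρ`, a small circle about `s` passes
  -- through `s + ε`, where `N < M`, so its average is below `M = N s`.
  obtain ⟨s, ⟨hs, hsM⟩, hsmax⟩ := hclosed.exists_isGreatest ⟨s0, hs0, rfl⟩
  rcases hs.2.eq_or_lt with rfl | hlt
  · rw [show N (s : ℂ) = M from hsM]; exact hmax ⟨hr0, hr⟩
  exfalso
  set ε := (ρ - s) / 2 with hε
  have hεpos : 0 < ε := by rw [hε]; linarith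
  have hsε : s + ε ≤ ρ := by rw [hε]; linarith
  have hball : ∀ θ, ‖circleMap (s : ℂ) ε θ‖ ≤ ρ := fun θ => by
    have : ‖circleMap (s : ℂ) ε θ‖ ≤ ‖(s : ℂ)‖ + |ε| := by
      unfold circleMap
      refine (norm_add_le _ _).trans ?_
      simp
    rw [abs_of_pos hεpos, Complex.norm_real, Real.norm_of_nonneg hs.1] at this
    linarith
  have hsub' := hsub s ε hεpos (by rw [Complex.norm_real, Real.norm_of_nonneg hs.1]; exact hsε)
  have hstrict : ∫ θ in (0)..(2 * Real.pi), N (circleMap s ε θ)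
      < ∫ θ in (0)..(2 * Real.pi), M := by
    refine intervalIntegral.integral_lt_integral_of_continuousOn_of_le_of_exists_lt
      Real.two_pi_pos ?_ continuousOn_const (fun θ _ => hle _ (hball θ))
      ⟨0, ⟨le_rfl, Real.two_pi_pos.le⟩, ?_⟩
    · exact hcont.comp (continuous_circleMap _ _).continuousOn fun θ _ => by
        simpa using hball θ
    · have h0 : circleMap (s : ℂ) ε 0 = ((s + ε : ℝ) : ℂ) := by simp [circleMap]
      rw [h0]
      refine lt_of_le_of_ne (hmax ⟨by linarith [hs.1], hsε⟩) fun heq => ?_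
      have : s + ε ≤ s := hsmax ⟨⟨by linarith [hs.1], hsε⟩, heq⟩
      linarith
  have : Real.circleAverage N s ε < M := by
    have := mul_lt_mul_of_pos_left hstrict (inv_pos.2 Real.two_pi_pos)
    rw [Real.circleAverage, smul_eq_mul]
    refine this.trans_eq ?_
    rw [intervalIntegral.integral_const, smul_eq_mul]
    field_simp
    ring
  have h3 : N (s : ℂ) = M := hsM
  linarith

end

/-! ### Rotation invariance, polar coordinates and monotone spherical means. -/

noncomputable section

open Metric Set

theorem finrank_real_Cn (n : ℕ) : Module.finrank ℝ (Cn n) = 2 * n := by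
  simp [finrank_real_of_complex]

/-- Multiplication by a unimodular scalar, as a real linear isometry. -/
def unimodularIsometry (n : ℕ) (u : sphere (0 : ℂ) 1) : Cn n ≃ₗᵢ[ℝ] Cn n where
  toFun z := (u : ℂ) • z
  invFun z := ((u⁻¹ : sphere (0 : ℂ) 1) : ℂ) • z
  map_add' := smul_add _
  map_smul' c z := smul_comm _ _ _
  left_inv z := by
    change ((u⁻¹ : sphere (0 : ℂ) 1) : ℂ) • (u : ℂ) • z = z
    rw [smul_smul, ← Metric.unitSphere.coe_mul, inv_mul_cancel]; simp
  right_inv z := by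
    change (u : ℂ) • ((u⁻¹ : sphere (0 : ℂ) 1) : ℂ) • z = z
    rw [smul_smul, ← Metric.unitSphere.coe_mul, mul_inv_cancel]; simp
  norm_map' z := by
    change ‖(u : ℂ) • z‖ = ‖z‖
    rw [norm_smul, mem_sphere_zero_iff_norm.1 u.2, one_mul]

theorem measurePreserving_unimodular_smul (n : ℕ) (u : sphere (0 : ℂ) 1) :
    MeasurePreserving (fun z : Cn n => (u : ℂ) • z) volume volume :=
  (unimodularIsometry n u).measurePreserving

open scoped Pointwise in
theorem measurePreserving_smul_sphere (n : ℕ) (u : sphere (0 : ℂ) 1) :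
    MeasurePreserving (fun ζ : sphere (0 : Cn n) 1 => u • ζ)
      (sphereMeasure n) (sphereMeasure n) := by
  have hm : Measurable (fun ζ : sphere (0 : Cn n) 1 => u • ζ) :=
    (continuous_const_smul u).measurable
  have key : MeasurePreserving (fun ζ : sphere (0 : Cn n) 1 => u • ζ)
      ((volume : Measure (Cn n)).toSphere) ((volume : Measure (Cn n)).toSphere) := by
    refine ⟨hm, Measure.ext fun s hs => ?_⟩
    -- The surface measure of a set is a multiple of the volume of the cone over it, and the
    -- unimodular isometry carries cones to cones.
    rw [Measure.map_apply hm hs, Measure.toSphere_apply' _ (hm hs), Measure.toSphere_apply' _ hs]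
    congr 1
    rw [← (unimodularIsometry n u).measurePreserving.measure_preimage_emb
      (unimodularIsometry n u).toHomeomorph.measurableEmbedding
      (Ioo (0 : ℝ) 1 • (Subtype.val '' s))]
    congr 1
    ext z
    rw [mem_preimage, Set.mem_smul, Set.mem_smul]
    constructor
    · rintro ⟨r, hr, _, ⟨ζ, hζ, rfl⟩, rfl⟩
      exact ⟨r, hr, _, ⟨u • ζ, hζ, rfl⟩, ((unimodularIsometry n u).map_smul r _).symm⟩
    · rintro ⟨r, hr, _, ⟨ζ, hζ, rfl⟩, h⟩
      refine ⟨r, hr, _, ⟨u⁻¹ • ζ, ?_, rfl⟩, ?_⟩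
      · rw [mem_preimage, smul_inv_smul]; exact hζ
      · apply (unimodularIsometry n u).injective
        rw [← h, (unimodularIsometry n u).map_smul]
        congr 1
        exact congrArg Subtype.val (smul_inv_smul u ζ)
  exact ⟨hm, by rw [sphereMeasure, Measure.map_smul, key.map_eq]⟩

variable {n : ℕ}

theorem norm_smul_sphere (c : ℂ) (ζ : sphere (0 : Cn n) 1) : ‖c • (ζ : Cn n)‖ = ‖c‖ := by
  rw [norm_smul, mem_sphere_zero_iff_norm.1 ζ.2, mul_one]

theorem differentiableOn_line {f : Cn n → ℂ} (hf : DifferentiableOn ℂ f (unitBall n))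
    (z v : Cn n) : DifferentiableOn ℂ (fun w : ℂ => f (z + w • v))
      ((fun w : ℂ => z + w • v) ⁻¹' unitBall n) :=
  hf.comp (by fun_prop) (fun _ h => h)

theorem analyticOnNhd_line {f : Cn n → ℂ} (hf : DifferentiableOn ℂ f (unitBall n))
    (z v : Cn n) : AnalyticOnNhd ℂ (fun w : ℂ => f (z + w • v))
      ((fun w : ℂ => z + w • v) ⁻¹' unitBall n) :=
  (differentiableOn_line hf z v).analyticOnNhd (isOpen_ball.preimage (by fun_prop))

variable [NeZero n]

theorem toSphere_univ_ne_zero : (volume : Measure (Cn n)).toSphere univ ≠ 0 := by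
  rw [Measure.measure_univ_ne_zero]
  exact Measure.toSphere_ne_zero _

instance : IsProbabilityMeasure (sphereMeasure n) where
  measure_univ := by
    rw [sphereMeasure, Measure.smul_apply, smul_eq_mul,
      ENNReal.inv_mul_cancel toSphere_univ_ne_zero (measure_ne_top _ _)]

theorem toSphere_eq_smul_sphereMeasure : (volume : Measure (Cn n)).toSphere
    = (volume : Measure (Cn n)).toSphere univ • sphereMeasure n := by
  rw [sphereMeasure, smul_smul,
    ENNReal.mul_inv_cancel toSphere_univ_ne_zero (measure_ne_top _ _), one_smul]

/-- Integration in polar coordinates. -/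
theorem lintegral_polar {F : Cn n → ℝ≥0∞} (hF : Measurable F) :
    ∫⁻ z, F z = (volume : Measure (Cn n)).toSphere univ *
      ∫⁻ r in Ioi (0 : ℝ), ENNReal.ofReal (r ^ (2 * n - 1)) *
        ∫⁻ ζ : sphere (0 : Cn n) 1, F ((r : ℂ) • (ζ : Cn n)) ∂sphereMeasure n := by
  have hmeas : Measurable (fun x : sphere (0 : Cn n) 1 × ℝ => F ((x.2 : ℂ) • (x.1 : Cn n))) :=
    hF.comp (by fun_prop)
  have hmp := (volume : Measure (Cn n)).measurePreserving_homeomorphUnitSphereProd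
  have h1 : ∫⁻ z, F z = ∫⁻ x : ({(0 : Cn n)}ᶜ : Set (Cn n)), F (x : Cn n) ∂((volume : Measure (Cn n)).comap Subtype.val) := by
    rw [lintegral_subtype_comap (measurableSet_singleton _).compl, restrict_compl_singleton]
  rw [h1]
  have h2 : ∀ x : ({(0 : Cn n)}ᶜ : Set (Cn n)), F (x : Cn n) =
      (fun y : sphere (0 : Cn n) 1 × Ioi (0 : ℝ) => F (((y.2 : ℝ) : ℂ) • (y.1 : Cn n)))
        (homeomorphUnitSphereProd (Cn n) x) := fun x => by
    have hx : ‖(x : Cn n)‖ ≠ 0 := norm_ne_zero_iff.2 x.2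
    simp only [homeomorphUnitSphereProd_apply_snd_coe, homeomorphUnitSphereProd_apply_fst_coe]
    congr 1
    rw [Complex.coe_smul, smul_smul, mul_inv_cancel₀ hx, one_smul]
  simp_rw [h2]
  have hmeas' : Measurable (fun y : sphere (0 : Cn n) 1 × Ioi (0 : ℝ) =>
      F (((y.2 : ℝ) : ℂ) • (y.1 : Cn n))) :=
    hmeas.comp (measurable_fst.prodMk (measurable_subtype_coe.comp measurable_snd))
  rw [hmp.lintegral_comp hmeas', lintegral_prod_symm _ hmeas'.aemeasurable]
  rw [Measure.volumeIoiPow, lintegral_withDensity_eq_lintegral_mul _ (by fun_prop)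
    hmeas'.lintegral_prod_left', finrank_real_Cn]
  simp only [Pi.mul_apply]
  rw [lintegral_subtype_comap measurableSet_Ioi (fun r : ℝ => ENNReal.ofReal (r ^ (2 * n - 1)) *
    ∫⁻ ζ : sphere (0 : Cn n) 1, F ((r : ℂ) • (ζ : Cn n)) ∂(volume : Measure (Cn n)).toSphere)]
  rw [← lintegral_const_mul]
  · refine lintegral_congr fun r => ?_
    rw [toSphere_eq_smul_sphereMeasure, lintegral_smul_measure]
    simp only [smul_eq_mul, Measure.smul_apply, measure_univ, mul_one]
    ring
  · exact (by fun_prop : Measurable fun r : ℝ => ENNReal.ofReal (r ^ (2 * n - 1))).mul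
      hmeas.lintegral_prod_left'

/-- Polar coordinates on a set described by a condition on the norm. -/
theorem setLIntegral_polar {F : Cn n → ℝ≥0∞} {T : Set ℝ} (hT : MeasurableSet T)
    (hF : Measurable ((norm ⁻¹' T).indicator F)) :
    ∫⁻ z in norm ⁻¹' T, F z = (volume : Measure (Cn n)).toSphere univ *
      ∫⁻ r in Ioi (0 : ℝ) ∩ T, ENNReal.ofReal (r ^ (2 * n - 1)) *
        ∫⁻ ζ : sphere (0 : Cn n) 1, F ((r : ℂ) • (ζ : Cn n)) ∂sphereMeasure n := by
  rw [← lintegral_indicator (measurable_norm hT), lintegral_polar hF,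
    inter_comm, ← Measure.restrict_restrict hT, ← lintegral_indicator hT]
  congr 1
  refine setLIntegral_congr_fun measurableSet_Ioi fun r (hr : 0 < r) => ?_
  have hnorm : ∀ ζ : sphere (0 : Cn n) 1, ‖(r : ℂ) • (ζ : Cn n)‖ = r := fun ζ => by
    rw [norm_smul, mem_sphere_zero_iff_norm.1 ζ.2, mul_one, Complex.norm_real,
      Real.norm_of_nonneg hr.le]
  by_cases hrT : r ∈ T
  · rw [indicator_of_mem hrT]
    congr 1
    refine lintegral_congr fun ζ => ?_
    rw [indicator_of_mem]
    rw [mem_preimage, hnorm]; exact hrT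
  · rw [indicator_of_notMem hrT]
    convert mul_zero _
    rw [lintegral_eq_zero_iff' ]
    · refine Filter.Eventually.of_forall fun ζ => ?_
      rw [Pi.zero_apply]
      refine indicator_of_notMem ?_ _
      rw [mem_preimage, hnorm]; exact hrT
    · exact (hF.comp (by fun_prop)).aemeasurable

/-- The spherical means of `huber L (‖f‖ ^ a)` increase with the radius. -/
theorem sphere_huber_mono {f : Cn n → ℂ} (hf : DifferentiableOn ℂ f (unitBall n)) {a L : ℝ}
    (ha : 0 < a) (hL : 0 ≤ L) {r ρ : ℝ} (hr : 0 ≤ r) (hrρ : r ≤ ρ) (hρ : ρ < 1) :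
    ∫ ζ : sphere (0 : Cn n) 1, huber L (‖f ((r : ℂ) • (ζ : Cn n))‖ ^ a) ∂sphereMeasure n ≤
    ∫ ζ : sphere (0 : Cn n) 1, huber L (‖f ((ρ : ℂ) • (ζ : Cn n))‖ ^ a) ∂sphereMeasure n := by
  set U : Cn n → ℝ := fun z => huber L (‖f z‖ ^ a) with hU
  have hUc : ContinuousOn U (unitBall n) :=
    (continuous_huber L).comp_continuousOn (hf.continuousOn.norm.rpow_const fun _ _ => Or.inr ha.le)
  -- The mean of `U (c • ζ)` is regarded as a function of complex `c`: rotation invariance makes it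
  -- radial, and the one-variable slices `w ↦ f (w • ζ)` make it submean.
  refine radial_mono_of_submean
    (N := fun c => ∫ ζ : sphere (0 : Cn n) 1, U (c • (ζ : Cn n)) ∂sphereMeasure n)
    ?_ ?_ ?_ hr hrρ
  · rw [continuousOn_iff_continuous_domRestrict]
    have := continuous_parametric_integral_of_continuous (μ := sphereMeasure n)
      (f := fun (c : closedBall (0 : ℂ) ρ) (ζ : sphere (0 : Cn n) 1) => U ((c : ℂ) • (ζ : Cn n)))
      (hUc.comp_continuous (by fun_prop) fun x => by
        rw [mem_ball_zero_iff, norm_smul_sphere]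
        exact (mem_closedBall_zero_iff.1 x.1.2).trans_lt hρ) isCompact_univ
    simp only [Measure.restrict_univ] at this
    exact this
  · intro z
    by_cases hz : z = 0
    · simp [hz]
    have hz' : (‖z‖ : ℂ) ≠ 0 := by simpa using hz
    set u : sphere (0 : ℂ) 1 := ⟨z / ‖z‖, by simp [hz]⟩ with hu
    have := (measurePreserving_smul_sphere n u).integral_comp
      (Homeomorph.smul u).measurableEmbedding
      (fun ζ : sphere (0 : Cn n) 1 => U ((‖z‖ : ℂ) • (ζ : Cn n)))
    rw [← this]
    refine integral_congr_ae (Filter.Eventually.of_forall fun ζ => ?_)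
    change U _ = U ((‖z‖ : ℂ) • ((u : ℂ) • (ζ : Cn n)))
    rw [smul_smul, hu, mul_div_cancel₀ _ hz']
  · intro c ε hε hcε
    have hmem : ∀ (θ : ℝ) (ζ : sphere (0 : Cn n) 1), circleMap c ε θ • (ζ : Cn n) ∈ unitBall n :=
      fun θ ζ => by
        rw [mem_ball_zero_iff, norm_smul_sphere]
        have : ‖circleMap c ε θ‖ ≤ ‖c‖ + |ε| := by
          unfold circleMap
          refine (norm_add_le _ _).trans ?_
          simp
        rw [abs_of_pos hε] at this
        linarith
    have hcont : Continuous fun x : ℝ × sphere (0 : Cn n) 1 =>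
        U (circleMap c ε x.1 • (x.2 : Cn n)) :=
      hUc.comp_continuous (by fun_prop) fun x => hmem _ _
    have hint : Integrable (fun x : ℝ × sphere (0 : Cn n) 1 =>
        U (circleMap c ε x.1 • (x.2 : Cn n)))
        ((volume.restrict (Ioc 0 (2 * Real.pi))).prod (sphereMeasure n)) := by
      have := hcont.continuousOn.integrableOn_compact
        (μ := (volume : Measure ℝ).prod (sphereMeasure n))
        (isCompact_Icc.prod isCompact_univ : IsCompact (Icc 0 (2 * Real.pi) ×ˢ univ))
      rw [IntegrableOn, ← Measure.prod_restrict, Measure.restrict_univ] at this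
      exact this.mono_measure (Measure.prod_mono (Measure.restrict_mono Ioc_subset_Icc_self le_rfl) le_rfl)
    have hswap : Real.circleAverage
        (fun c => ∫ ζ : sphere (0 : Cn n) 1, U (c • (ζ : Cn n)) ∂sphereMeasure n) c ε
        = ∫ ζ : sphere (0 : Cn n) 1,
          Real.circleAverage (fun w => U (w • (ζ : Cn n))) c ε ∂sphereMeasure n := by
      simp only [Real.circleAverage, intervalIntegral.integral_of_le Real.two_pi_pos.le]
      rw [integral_smul, integral_integral_swap hint]
    rw [hswap]
    refine integral_mono_of_nonneg ?_ ?_ ?_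
    · exact Filter.Eventually.of_forall fun ζ => huber_nonneg hL
    · simp only [Real.circleAverage, intervalIntegral.integral_of_le Real.two_pi_pos.le]
      exact hint.integral_prod_right.const_mul _
    · refine Filter.Eventually.of_forall fun ζ => ?_
      have hA := analyticOnNhd_line hf 0 (ζ : Cn n)
      simp only [zero_add] at hA
      refine (hA.mono fun w hw => ?_).huber_norm_rpow_le_circleAverage hε ha hL
      rw [mem_preimage, mem_ball_zero_iff, norm_smul_sphere]
      rw [mem_closedBall, dist_eq_norm] at hw
      have := norm_le_norm_add_norm_sub' w c
      linarith

end

/-! ### Nonisotropic neighbourhoods and their volumes. -/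

noncomputable section

open Metric Set

variable {n : ℕ}

/-- The linear map that is diagonal in the orthonormal basis `b` with entries `d`. -/
def diagonalMap (b : OrthonormalBasis (Fin n) ℂ (Cn n)) (d : Fin n → ℂ) : Cn n →ₗ[ℂ] Cn n :=
  Matrix.toLin b.toBasis b.toBasis (Matrix.diagonal d)

theorem repr_diagonalMap (b : OrthonormalBasis (Fin n) ℂ (Cn n)) (d : Fin n → ℂ) (v : Cn n)
    (i : Fin n) : b.repr (diagonalMap b d v) i = d i * b.repr v i := by
  have := congrFun (LinearMap.toMatrix_mulVec_repr b.toBasis b.toBasis (diagonalMap b d) v) i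
  simp only [diagonalMap, LinearMap.toMatrix_toLin, Matrix.mulVec_diagonal,
    OrthonormalBasis.coe_toBasis_repr_apply] at this
  exact this.symm

/-- The real determinant of a complex linear map is the squared modulus of its complex determinant.
-/
theorem volume_image_diagonalMap (b : OrthonormalBasis (Fin n) ℂ (Cn n)) (d : Fin n → ℂ)
    (s : Set (Cn n)) :
    volume (diagonalMap b d '' s) = ENNReal.ofReal (∏ i, ‖d i‖ ^ 2) * volume s := by
  have h := Measure.addHaar_image_linearMap (volume : Measure (Cn n))
    ((diagonalMap b d).restrictScalars ℝ) s
  have hdet : |LinearMap.det ((diagonalMap b d).restrictScalars ℝ)| = ∏ i, ‖d i‖ ^ 2 := by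
    rw [LinearMap.det_restrictScalars, diagonalMap, LinearMap.det_toLin, Matrix.det_diagonal,
      Algebra.norm_complex_apply, map_prod, Finset.abs_prod]
    refine Finset.prod_congr rfl fun i _ => ?_
    rw [Complex.normSq_eq_norm_sq, abs_of_nonneg (by positivity)]
  rw [hdet] at h
  exact h

/-- Entries of the anisotropic dilation: `δ` in the direction `i₀`, `√δ` in all others. -/
def anisotropic (i₀ : Fin n) (δ : ℝ) (i : Fin n) : ℂ := if i = i₀ then (δ : ℂ) else (√δ : ℂ)

theorem prod_anisotropic (i₀ : Fin n) {δ : ℝ} (hδ : 0 ≤ δ) :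
    ∏ i, ‖anisotropic i₀ δ i‖ ^ 2 = δ ^ (n + 1) := by
  have h : ∀ i, ‖anisotropic i₀ δ i‖ ^ 2 = δ * (if i = i₀ then δ else 1) := fun i => by
    unfold anisotropic
    split_ifs
    · rw [Complex.norm_real, Real.norm_of_nonneg hδ, sq]
    · rw [Complex.norm_real, Real.norm_of_nonneg (Real.sqrt_nonneg _), Real.sq_sqrt hδ, mul_one]
  simp_rw [h]
  rw [Finset.prod_mul_distrib, Finset.prod_ite_eq' Finset.univ i₀]
  simp [pow_succ]

/-- For `z ≠ 0`, take a basis containing `z / ‖z‖`. A bound on one coordinate then controls the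
inner product with `z`. -/
theorem exists_basis_inner_le [NeZero n] {z : Cn n} (hz : ‖z‖ ≤ 1) :
    ∃ (b : OrthonormalBasis (Fin n) ℂ (Cn n)) (i₀ : Fin n),
      ∀ v, ‖inner ℂ z v‖ ≤ ‖b.repr v i₀‖ := by
  by_cases h0 : z = 0
  · exact ⟨EuclideanSpace.basisFun (Fin n) ℂ, 0, fun v => by simp [h0]⟩
  have hz0 : ‖z‖ ≠ 0 := norm_ne_zero_iff.2 h0
  set ζ : Cn n := ((‖z‖ : ℂ)⁻¹) • z with hζ
  have hζ1 : ‖ζ‖ = 1 := by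
    rw [hζ, norm_smul, norm_inv, Complex.norm_real, norm_norm, inv_mul_cancel₀ hz0]
  obtain ⟨b, hb⟩ := Orthonormal.exists_orthonormalBasis_extension_of_card_eq (𝕜 := ℂ) (E := Cn n)
    (ι := Fin n) (by simp) (v := fun _ => ζ) (s := {0}) (by
      constructor
      · intro i; exact hζ1
      · intro i j hij
        exact absurd (Subsingleton.elim i j) hij)
  refine ⟨b, 0, fun v => ?_⟩
  rw [b.repr_apply_apply, hb 0 rfl]
  have hzζ : z = (‖z‖ : ℂ) • ζ := by
    rw [hζ, smul_smul, mul_inv_cancel₀ (by exact_mod_cast hz0), one_smul]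
  calc ‖inner ℂ z v‖ = ‖z‖ * ‖inner ℂ ζ v‖ := by
        conv_lhs => rw [hzζ]
        rw [inner_smul_left, norm_mul, Complex.conj_ofReal, Complex.norm_real, norm_norm]
    _ ≤ 1 * ‖inner ℂ ζ v‖ := by gcongr
    _ = _ := one_mul _

theorem norm_sq_eq_sum_repr (b : OrthonormalBasis (Fin n) ℂ (Cn n)) (v : Cn n) :
    ‖v‖ ^ 2 = ∑ i, ‖b.repr v i‖ ^ 2 := by
  rw [← b.repr.norm_map v, EuclideanSpace.norm_sq_eq]

/-- The nonisotropic neighbourhood of `0` adapted to the point `z` of the ball. -/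
def circledNhd (z : Cn n) : Set (Cn n) :=
  {v | ‖inner ℂ z v‖ < (1 - ‖z‖ ^ 2) / 8 ∧ ‖v‖ ^ 2 < (1 - ‖z‖ ^ 2) / 4}

theorem isOpen_circledNhd (z : Cn n) : IsOpen (circledNhd z) :=
  (isOpen_lt (f := fun v : Cn n => ‖inner ℂ z v‖) (by fun_prop) continuous_const).inter
    (isOpen_lt (f := fun v : Cn n => ‖v‖ ^ 2) (by fun_prop) continuous_const)

theorem smul_mem_circledNhd {z v : Cn n} (hv : v ∈ circledNhd z) {c : ℂ} (hc : ‖c‖ ≤ 1) :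
    c • v ∈ circledNhd z := by
  refine ⟨lt_of_le_of_lt ?_ hv.1, lt_of_le_of_lt ?_ hv.2⟩
  · rw [inner_smul_right, norm_mul]
    exact mul_le_of_le_one_left (norm_nonneg _) hc
  · gcongr
    rw [norm_smul]
    exact mul_le_of_le_one_left (norm_nonneg _) hc

/-- The difference is `2 Re ⟨z, v⟩ + ‖v‖ ^ 2`, and the two thresholds of `circledNhd` add up to `2 /
8 + 1 / 4 = 1 / 2`. -/
theorem abs_norm_sq_sub_lt {z v : Cn n} (hv : v ∈ circledNhd z) :
    |‖z + v‖ ^ 2 - ‖z‖ ^ 2| < (1 - ‖z‖ ^ 2) / 2 := by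
  have h1 : ‖z + v‖ ^ 2 - ‖z‖ ^ 2 = 2 * RCLike.re (inner ℂ z v) + ‖v‖ ^ 2 := by
    rw [norm_add_sq (𝕜 := ℂ)]; ring
  have h2 := RCLike.abs_re_le_norm (inner ℂ z v)
  have := hv.1
  have := hv.2
  rw [h1, abs_lt]
  rw [abs_le] at h2
  constructor <;> nlinarith [sq_nonneg ‖v‖]

/-- The neighbourhood contains the image of a fixed ball under the dilation by `D = 1 - ‖z‖ ^ 2`
along `z` and by `√D` across it, whose Jacobian is `D ^ (n + 1)`. -/
theorem volume_circledNhd_ge [NeZero n] {z : Cn n} (hz : ‖z‖ < 1) :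
    ENNReal.ofReal ((1 - ‖z‖ ^ 2) ^ (n + 1)) * volume (ball (0 : Cn n) (1 / 8))
      ≤ volume (circledNhd z) := by
  obtain ⟨b, i₀, hb⟩ := exists_basis_inner_le hz.le
  set D := 1 - ‖z‖ ^ 2 with hD
  have hz0 := norm_nonneg z
  have hD0 : 0 < D := by rw [hD]; nlinarith
  have hD1 : D ≤ 1 := by rw [hD]; nlinarith
  rw [← prod_anisotropic i₀ hD0.le, ← volume_image_diagonalMap b]
  refine measure_mono ?_
  rintro _ ⟨v, hv, rfl⟩
  rw [mem_ball_zero_iff] at hv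
  have hv0 := norm_nonneg v
  have hsq := norm_sq_eq_sum_repr b v
  constructor
  · refine (hb _).trans_lt ?_
    rw [repr_diagonalMap, anisotropic, if_pos rfl, norm_mul, Complex.norm_real,
      Real.norm_of_nonneg hD0.le]
    have : ‖b.repr v i₀‖ ≤ ‖v‖ := by
      rw [← b.repr.norm_map v]; exact PiLp.norm_apply_le _ _
    nlinarith
  · rw [norm_sq_eq_sum_repr b]
    have : ∑ i, ‖b.repr (diagonalMap b (anisotropic i₀ D) v) i‖ ^ 2
        ≤ D * ∑ i, ‖b.repr v i‖ ^ 2 := by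
      rw [Finset.mul_sum]
      refine Finset.sum_le_sum fun i _ => ?_
      rw [repr_diagonalMap, norm_mul, mul_pow]
      gcongr
      unfold anisotropic
      split_ifs
      · rw [Complex.norm_real, Real.norm_of_nonneg hD0.le]; nlinarith
      · rw [Complex.norm_real, Real.norm_of_nonneg (Real.sqrt_nonneg _), Real.sq_sqrt hD0.le]
    rw [← hsq] at this
    have hv2 : ‖v‖ ^ 2 < 1 / 4 := by nlinarith
    rw [← hD]
    nlinarith

theorem volume_cap_le (i₀ : Fin n) {δ : ℝ} (hδ : 0 < δ) :
    volume {z : Cn n | ‖z‖ < 1 ∧ ‖1 - z i₀‖ < 2 * δ}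
      ≤ ENNReal.ofReal (δ ^ (n + 1)) * volume (ball (0 : Cn n) 3) := by
  set b := EuclideanSpace.basisFun (Fin n) ℂ with hb
  set e : Cn n := EuclideanSpace.single i₀ 1 with he
  rw [← prod_anisotropic i₀ hδ.le, ← volume_image_diagonalMap b,
    ← measure_preimage_add volume e]
  refine measure_mono fun w hw => ?_
  obtain ⟨z, hz⟩ : ∃ z, z = e + w := ⟨_, rfl⟩
  have hw' : w = z - e := by rw [hz]; abel
  rw [mem_preimage, ← hz] at hw
  obtain ⟨hz1, hz2⟩ := hw
  have hs : 0 < √δ := Real.sqrt_pos.2 hδ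
  have hs2 : (√δ) ^ 2 = δ := Real.sq_sqrt hδ.le
  -- Undo the dilation. The distinguished coordinate contributes less than `4` to the squared norm,
  -- and so do the others, because `∑ ‖z i‖ ^ 2 < 1 - ‖z i₀‖ ^ 2` with `‖z i₀‖ > 1 - 2 * δ`; and `8
  -- < 3 ^ 2`.
  refine ⟨WithLp.toLp 2 (fun i => if i = i₀ then (z i - 1) / δ else z i / (√δ : ℂ)), ?_, ?_⟩
  · rw [mem_ball_zero_iff]
    refine lt_of_pow_lt_pow_left₀ 2 (by norm_num) ?_
    rw [EuclideanSpace.norm_sq_eq]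
    have hzsum : ∑ i, ‖z i‖ ^ 2 < 1 := by
      rw [← EuclideanSpace.norm_sq_eq]
      nlinarith [norm_nonneg z]
    rw [← Finset.add_sum_erase _ _ (Finset.mem_univ i₀)] at hzsum ⊢
    have h1 : ‖(1 : ℂ)‖ ≤ ‖1 - z i₀‖ + ‖z i₀‖ := by
      simpa using norm_add_le (1 - z i₀) (z i₀)
    rw [norm_one] at h1
    have h2 : ∑ i ∈ Finset.univ.erase i₀, ‖(if i = i₀ then (z i - 1) / (δ : ℂ)
        else z i / (√δ : ℂ))‖ ^ 2 = (∑ i ∈ Finset.univ.erase i₀, ‖z i‖ ^ 2) / δ := by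
      rw [Finset.sum_div]
      refine Finset.sum_congr rfl fun i hi => ?_
      rw [if_neg (Finset.ne_of_mem_erase hi), norm_div, Complex.norm_real,
        Real.norm_of_nonneg hs.le, div_pow, hs2]
    simp only [if_true]
    rw [h2, norm_div, Complex.norm_real, Real.norm_of_nonneg hδ.le, norm_sub_rev, div_pow]
    have h3 : ‖1 - z i₀‖ ^ 2 / δ ^ 2 < 4 := by
      rw [div_lt_iff₀ (by positivity)]
      nlinarith [norm_nonneg (1 - z i₀)]
    have h4 : (∑ i ∈ Finset.univ.erase i₀, ‖z i‖ ^ 2) / δ < 4 := by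
      rw [div_lt_iff₀ hδ]
      have hn0 := norm_nonneg (z i₀)
      rcases le_or_gt ‖z i₀‖ 1 with h | h
      · nlinarith
      · nlinarith [Finset.sum_nonneg (s := Finset.univ.erase i₀)
          (f := fun i => ‖z i‖ ^ 2) fun i _ => by positivity]
    linarith
  · apply b.repr.injective
    ext i
    rw [repr_diagonalMap, hw']
    simp only [hb, EuclideanSpace.basisFun_repr, anisotropic, he]
    by_cases hi : i = i₀
    · subst hi
      have : (δ : ℂ) ≠ 0 := by exact_mod_cast hδ.ne'
      simp; field_simp
    · have : (√δ : ℂ) ≠ 0 := by exact_mod_cast hs.ne'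
      simp [hi]; field_simp

end

/-! ### Membership as finiteness of integrals; pointwise growth estimates. -/

noncomputable section

open Metric Set

/-- The weighted integral `∫ (1 - |z|²) ^ c |f z| ^ q` over the unit ball. -/
def bergmanMass (n : ℕ) (q c : ℝ) (f : Cn n → ℂ) : ℝ≥0∞ :=
  ∫⁻ z in unitBall n, ENNReal.ofReal ((1 - ‖z‖ ^ 2) ^ c) * ‖f z‖ₑ ^ q

/-- The spherical mean of `|f| ^ q` over the sphere of radius `r`. -/
def hardyMass (n : ℕ) (q : ℝ) (f : Cn n → ℂ) (r : ℝ) : ℝ≥0∞ :=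
  ∫⁻ ζ : sphere (0 : Cn n) 1, ‖f ((r : ℂ) • (ζ : Cn n))‖ₑ ^ q ∂sphereMeasure n

variable {n : ℕ}

theorem recip_top : recip ∞ = 0 := by simp [recip]

theorem recip_ofReal {q : ℝ} (hq : 0 < q) : recip (ENNReal.ofReal q) = q⁻¹ := by
  rw [recip, ENNReal.toReal_inv, ENNReal.toReal_ofReal hq.le]

theorem one_sub_norm_sq_pos {z : Cn n} (hz : z ∈ unitBall n) : 0 < 1 - ‖z‖ ^ 2 := by
  have h1 := mem_ball_zero_iff.1 hz
  have h0 := norm_nonneg z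
  nlinarith

theorem mem_bergmanSpace_top {α : ℝ} {f : Cn n → ℂ} :
    f ∈ bergmanSpace n ∞ α ↔ DifferentiableOn ℂ f (unitBall n) ∧
      ∃ C : ℝ, ∀ z ∈ unitBall n, (1 - ‖z‖ ^ 2) ^ α * ‖f z‖ ≤ C := by
  refine and_congr_right fun _ => ?_
  rw [bergmanNorm, if_pos rfl]
  constructor
  · intro h
    refine ⟨(⨆ z ∈ unitBall n, ENNReal.ofReal ((1 - ‖z‖ ^ 2) ^ α * ‖f z‖)).toReal, fun z hz => ?_⟩
    rw [← ENNReal.ofReal_le_iff_le_toReal h.ne]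
    exact le_iSup₂ (f := fun z (_ : z ∈ unitBall n) =>
      ENNReal.ofReal ((1 - ‖z‖ ^ 2) ^ α * ‖f z‖)) z hz
  · rintro ⟨C, hC⟩
    refine lt_of_le_of_lt (iSup₂_le fun z hz => ENNReal.ofReal_le_ofReal (hC z hz)) ?_
    exact ENNReal.ofReal_lt_top

theorem mem_hardySpace {q α : ℝ} (hq : 0 < q) (hα : α = -q⁻¹) {f : Cn n → ℂ} :
    f ∈ bergmanSpace n (ENNReal.ofReal q) α ↔ DifferentiableOn ℂ f (unitBall n) ∧
      ∃ C : ℝ≥0∞, C < ∞ ∧ ∀ r ∈ Ioo (0 : ℝ) 1, hardyMass n q f r ≤ C := by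
  refine and_congr_right fun _ => ?_
  rw [bergmanNorm, if_neg ENNReal.ofReal_ne_top, recip_ofReal hq, if_pos hα]
  have h0 : ENNReal.ofReal q ≠ 0 := by simpa using hq
  have key : ∀ r : ℝ, eLpNorm (fun ζ : sphere (0 : Cn n) 1 => f ((r : ℂ) • (ζ : Cn n)))
      (ENNReal.ofReal q) (sphereMeasure n) = hardyMass n q f r ^ q⁻¹ := fun r => by
    rw [eLpNorm_eq_lintegral_rpow_enorm_toReal h0 ENNReal.ofReal_ne_top,
      ENNReal.toReal_ofReal hq.le, one_div]
    rfl
  simp_rw [key]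
  constructor
  · intro h
    refine ⟨_, ENNReal.rpow_lt_top_of_nonneg hq.le h.ne, fun r hr => ?_⟩
    have := le_iSup₂ (f := fun r (_ : r ∈ Ioo (0 : ℝ) 1) => hardyMass n q f r ^ q⁻¹) r hr
    have := ENNReal.rpow_le_rpow this hq.le
    rwa [← ENNReal.rpow_mul, inv_mul_cancel₀ hq.ne', ENNReal.rpow_one] at this
  · rintro ⟨C, hC, hle⟩
    refine lt_of_le_of_lt (iSup₂_le fun r hr =>
      ENNReal.rpow_le_rpow (hle r hr) (inv_nonneg.2 hq.le)) ?_
    exact ENNReal.rpow_lt_top_of_nonneg (inv_nonneg.2 hq.le) hC.ne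

theorem volume_unitBall_ne_zero : volume (unitBall n) ≠ 0 :=
  (isOpen_ball.measure_pos _ ⟨0, mem_ball_self one_pos⟩).ne'

theorem volume_unitBall_ne_top : volume (unitBall n) ≠ ∞ := measure_ball_lt_top.ne

theorem mem_bergmanSpace {q α : ℝ} (hq : 0 < q) (hα : α ≠ -q⁻¹) {f : Cn n → ℂ} :
    f ∈ bergmanSpace n (ENNReal.ofReal q) α ↔ DifferentiableOn ℂ f (unitBall n) ∧
      bergmanMass n q (α * q) f < ∞ := by
  refine and_congr_right fun _ => ?_
  rw [bergmanNorm, if_neg ENNReal.ofReal_ne_top, recip_ofReal hq, if_neg hα]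
  have h0 : ENNReal.ofReal q ≠ 0 := by simpa using hq
  rw [eLpNorm_lt_top_iff_lintegral_rpow_enorm_lt_top h0 ENNReal.ofReal_ne_top,
    ENNReal.toReal_ofReal hq.le, ballMeasure, lintegral_smul_measure, smul_eq_mul]
  have key : ∫⁻ z in unitBall n, ‖(((1 - ‖z‖ ^ 2) ^ α : ℝ) : ℂ) * f z‖ₑ ^ q
      = bergmanMass n q (α * q) f := by
    refine setLIntegral_congr_fun measurableSet_ball fun z hz => ?_
    have hD := one_sub_norm_sq_pos hz
    have hDα : 0 ≤ (1 - ‖z‖ ^ 2) ^ α := by positivity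
    rw [enorm_mul, ENNReal.mul_rpow_of_nonneg _ _ hq.le, Real.rpow_mul hD.le,
      ← ENNReal.ofReal_rpow_of_nonneg hDα hq.le]
    congr 2
    rw [← ofReal_norm, Complex.norm_real, Real.norm_of_nonneg hDα]
  rw [key]
  constructor
  · intro h
    by_contra hc
    rw [not_lt, top_le_iff] at hc
    rw [hc, ENNReal.mul_top (ENNReal.inv_ne_zero.2 volume_unitBall_ne_top)] at h
    exact lt_irrefl _ h
  · intro h
    exact ENNReal.mul_lt_top (ENNReal.inv_lt_top.2 (pos_iff_ne_zero.2 volume_unitBall_ne_zero)) h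

/-- Functions are arbitrary off the ball, so only their truncations can be measurable. -/
theorem measurable_indicator_of_continuousOn {G : Cn n → ℝ≥0∞} {s : Set (Cn n)}
    (hs : MeasurableSet s) (hG : ContinuousOn G s) : Measurable (s.indicator G) := by
  classical
  rw [← piecewise_eq_indicator]
  exact hG.measurable_piecewise continuousOn_const hs

theorem continuousOn_enorm_rpow {f : Cn n → ℂ} (hf : DifferentiableOn ℂ f (unitBall n)) (q : ℝ) :
    ContinuousOn (fun z => ‖f z‖ₑ ^ q) (unitBall n) :=
  (ENNReal.continuous_rpow_const (y := q)).comp_continuousOn (continuous_enorm.comp_continuousOn hf.continuousOn)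

/-- The set of points `w` with `1 - |w|²` comparable to `D`. -/
def shell (D : ℝ) : Set ℝ := {t | D / 2 < 1 - t ^ 2 ∧ 1 - t ^ 2 < 3 * D / 2}

theorem isOpen_shell (D : ℝ) : IsOpen (shell D) :=
  (isOpen_lt (f := fun _ : ℝ => D / 2) (g := fun t : ℝ => 1 - t ^ 2) (by fun_prop)
    (by fun_prop)).inter
    (isOpen_lt (f := fun t : ℝ => 1 - t ^ 2) (g := fun _ : ℝ => 3 * D / 2) (by fun_prop)
    (by fun_prop))

theorem norm_preimage_shell_subset {D : ℝ} (hD : 0 ≤ D) :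
    (norm ⁻¹' shell D : Set (Cn n)) ⊆ unitBall n := fun z hz => by
  rw [mem_ball_zero_iff]
  have := hz.1
  nlinarith [norm_nonneg z]

/-- Mean value estimate over a nonisotropic neighbourhood. -/
theorem enorm_rpow_mul_le_lintegral_shell [NeZero n] {f : Cn n → ℂ}
    (hf : DifferentiableOn ℂ f (unitBall n)) {q : ℝ} (hq : 0 < q) {z : Cn n}
    (hz : z ∈ unitBall n) :
    ‖f z‖ₑ ^ q * (ENNReal.ofReal ((1 - ‖z‖ ^ 2) ^ (n + 1)) * volume (ball (0 : Cn n) (1 / 8))) ≤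
      ∫⁻ w in norm ⁻¹' shell (1 - ‖z‖ ^ 2), ‖f w‖ₑ ^ q := by
  set D := 1 - ‖z‖ ^ 2 with hD
  have hD0 : 0 < D := one_sub_norm_sq_pos hz
  set K := circledNhd z with hK
  have hKm : MeasurableSet K := (isOpen_circledNhd z).measurableSet
  set G : Cn n → ℝ≥0∞ := (unitBall n).indicator (fun w => ‖f w‖ₑ ^ q) with hG
  have hGm : Measurable G :=
    measurable_indicator_of_continuousOn measurableSet_ball (continuousOn_enorm_rpow hf q)
  have hshell : ∀ v ∈ K, z + v ∈ (norm ⁻¹' shell D : Set (Cn n)) := fun v hv => by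
    have := abs_lt.1 (abs_norm_sq_sub_lt hv)
    rw [mem_preimage, shell, mem_ofPred_eq]
    constructor <;> linarith [this.1, this.2]
  have hball : ∀ v ∈ K, z + v ∈ unitBall n := fun v hv =>
    norm_preimage_shell_subset hD0.le (hshell v hv)
  set τ : ℝ≥0∞ := ENNReal.ofReal (2 * Real.pi) with hτ
  have hτ0 : τ ≠ 0 := by rw [hτ, ne_eq, ENNReal.ofReal_eq_zero]; linarith [Real.pi_pos]
  have hτt : τ ≠ ∞ := ENNReal.ofReal_ne_top
  -- Submean inequality on the disc `z + w • v`, `‖w‖ ≤ 1`, which stays in the ball because `K` is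
  -- circled.
  have hslice : ∀ v ∈ K, τ * ‖f z‖ₑ ^ q ≤
      ∫⁻ θ in Ioc 0 (2 * Real.pi), G (z + circleMap 0 1 θ • v) := fun v hv => by
    have hsub : closedBall (0 : ℂ) 1 ⊆ (fun w : ℂ => z + w • v) ⁻¹' unitBall n := fun w hw =>
      hball _ (smul_mem_circledNhd hv (mem_closedBall_zero_iff.1 hw))
    have h1 := ((analyticOnNhd_line hf z v).mono hsub).norm_rpow_le_circleAverage one_pos hq
    simp only [zero_smul, add_zero] at h1
    have hcm : ∀ θ : ℝ, circleMap 0 1 θ ∈ closedBall (0 : ℂ) 1 := fun θ => by simp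
    have hcont : Continuous fun θ : ℝ => ‖f (z + circleMap 0 1 θ • v)‖ ^ q := by
      have : Continuous fun θ : ℝ => f (z + circleMap 0 1 θ • v) :=
        hf.continuousOn.comp_continuous (by fun_prop) fun θ => hsub (hcm θ)
      exact this.norm.rpow_const fun _ => Or.inr hq.le
    rw [Real.circleAverage, intervalIntegral.integral_of_le Real.two_pi_pos.le, smul_eq_mul,
      ← div_eq_inv_mul, le_div_iff₀ Real.two_pi_pos] at h1
    have h2 := ENNReal.ofReal_le_ofReal h1
    rw [ofReal_integral_eq_lintegral_ofReal
      ((hcont.continuousOn.integrableOn_Icc).mono_set Ioc_subset_Icc_self)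
      (Filter.Eventually.of_forall fun θ => by positivity), ENNReal.ofReal_mul (by positivity),
      mul_comm] at h2
    rw [← ENNReal.ofReal_rpow_of_nonneg (norm_nonneg _) hq.le, ofReal_norm] at h2
    refine h2.trans_eq (lintegral_congr fun θ => ?_)
    rw [hG, indicator_of_mem (show z + circleMap 0 1 θ • v ∈ unitBall n from hsub (hcm θ)),
      ← ENNReal.ofReal_rpow_of_nonneg (norm_nonneg _) hq.le, ofReal_norm]
  have hjoint : Measurable (fun x : Cn n × ℝ => G (z + circleMap 0 1 x.2 • x.1)) :=
    hGm.comp (Continuous.measurable (by fun_prop))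
  have hrot : ∀ θ : ℝ, ∫⁻ v in K, G (z + circleMap 0 1 θ • v) ≤ ∫⁻ v in K, G (z + v) := fun θ => by
    set u : sphere (0 : ℂ) 1 := ⟨circleMap 0 1 θ, by simp⟩ with hu
    have hmp := (measurePreserving_unimodular_smul n u).setLIntegral_comp_preimage hKm
      (f := fun v => G (z + v)) (hGm.comp (by fun_prop))
    rw [← hmp]
    refine lintegral_mono_set fun v hv => ?_
    exact smul_mem_circledNhd hv (by simp [hu])
  -- Integrate the slice estimate over `K` and exchange the integrals. By `hrot` each rotation
  -- contributes at most the integral over `z + K`, which lies in the shell.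
  have hmain : τ * (‖f z‖ₑ ^ q * volume K) ≤ τ * ∫⁻ w in norm ⁻¹' shell D, ‖f w‖ₑ ^ q := by
    calc τ * (‖f z‖ₑ ^ q * volume K) = ∫⁻ _ in K, τ * ‖f z‖ₑ ^ q := by
          rw [setLIntegral_const, mul_assoc]
      _ ≤ ∫⁻ v in K, ∫⁻ θ in Ioc 0 (2 * Real.pi), G (z + circleMap 0 1 θ • v) :=
          setLIntegral_mono' hKm hslice
      _ = ∫⁻ θ in Ioc 0 (2 * Real.pi), ∫⁻ v in K, G (z + circleMap 0 1 θ • v) :=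
          lintegral_lintegral_swap hjoint.aemeasurable
      _ ≤ ∫⁻ _ in Ioc 0 (2 * Real.pi), ∫⁻ v in K, G (z + v) := lintegral_mono fun θ => hrot θ
      _ = τ * ∫⁻ v in K, G (z + v) := by
          rw [setLIntegral_const, Real.volume_Ioc, sub_zero, mul_comm]
      _ ≤ τ * ∫⁻ w in norm ⁻¹' shell D, ‖f w‖ₑ ^ q := by
          refine mul_le_mul' le_rfl ?_
          have hmp := (measurePreserving_add_left (volume : Measure (Cn n)) z).setLIntegral_comp_preimage
            (measurable_norm (isOpen_shell D).measurableSet) hGm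
          calc ∫⁻ v in K, G (z + v)
              ≤ ∫⁻ v in (fun v => z + v) ⁻¹' (norm ⁻¹' shell D), G (z + v) :=
                lintegral_mono_set hshell
            _ = _ := hmp
            _ ≤ _ := setLIntegral_mono' (measurable_norm (isOpen_shell D).measurableSet)
                fun w _ => indicator_le_self _ _ _
  rw [ENNReal.mul_le_mul_iff_right hτ0 hτt] at hmain
  refine le_trans ?_ hmain
  gcongr
  exact volume_circledNhd_ge (mem_ball_zero_iff.1 hz)

theorem two_rpow_neg_abs_mul_rpow_le {D x : ℝ} (hD : 0 < D) (h1 : D / 2 ≤ x) (h2 : x ≤ 2 * D)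
    (c : ℝ) : (2 : ℝ) ^ (-|c|) * D ^ c ≤ x ^ c := by
  have hx : 0 < x := by linarith
  rcases le_total 0 c with hc | hc
  · rw [abs_of_nonneg hc]
    calc (2 : ℝ) ^ (-c) * D ^ c = (D / 2) ^ c := by
          rw [Real.div_rpow hD.le (by norm_num), Real.rpow_neg (by norm_num)]; ring
      _ ≤ x ^ c := Real.rpow_le_rpow (by positivity) h1 hc
  · rw [abs_of_nonpos hc, neg_neg, ← Real.mul_rpow (by norm_num) hD.le]
    exact Real.rpow_le_rpow_of_nonpos hx h2 hc

/-- Conversion of a mean value estimate into a pointwise bound. -/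
theorem norm_le_of_enorm_rpow_mul_le {w : ℂ} {q D e : ℝ} (hq : 0 < q) (hD : 0 < D) {k C : ℝ≥0∞}
    (hk0 : k ≠ 0) (hkt : k ≠ ∞) (hC : C ≠ ∞) (h : ‖w‖ₑ ^ q * (ENNReal.ofReal (D ^ e) * k) ≤ C) :
    ‖w‖ ≤ (C / k).toReal ^ q⁻¹ * D ^ (-(e / q)) := by
  have hDe : 0 < D ^ e := by positivity
  have h1 : ‖w‖ₑ ^ q * ENNReal.ofReal (D ^ e) ≤ C / k := by
    rw [ENNReal.le_div_iff_mul_le (Or.inl hk0) (Or.inl hkt), mul_assoc]; exact h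
  have hCk : C / k ≠ ∞ := ENNReal.div_ne_top hC hk0
  have h2 := ENNReal.toReal_mono hCk h1
  rw [ENNReal.toReal_mul, ENNReal.toReal_ofReal hDe.le, ← ENNReal.toReal_rpow, toReal_enorm] at h2
  have h3 : ‖w‖ ^ q ≤ (C / k).toReal * D ^ (-e) := by
    rw [Real.rpow_neg hD.le, ← div_eq_mul_inv, le_div_iff₀ hDe]; exact h2
  have h4 := Real.rpow_le_rpow (by positivity) h3 (inv_nonneg.2 hq.le)
  rw [← Real.rpow_mul (norm_nonneg _), mul_inv_cancel₀ hq.ne', Real.rpow_one,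
    Real.mul_rpow ENNReal.toReal_nonneg (by positivity), ← Real.rpow_mul hD.le] at h4
  rwa [neg_div', div_eq_mul_inv]

/-- On the shell the weight is comparable to `D ^ c`, so it can be moved inside the mean value
estimate; it adds `c` to the volume exponent `n + 1`. -/
theorem growth_of_bergmanMass [NeZero n] {f : Cn n → ℂ} (hf : DifferentiableOn ℂ f (unitBall n))
    {q c : ℝ} (hq : 0 < q) (hm : bergmanMass n q c f < ∞) :
    ∃ C : ℝ, 0 ≤ C ∧ ∀ z ∈ unitBall n, ‖f z‖ ≤ C * (1 - ‖z‖ ^ 2) ^ (-((c + (n + 1)) / q)) := by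
  set k : ℝ≥0∞ := ENNReal.ofReal (2 ^ (-|c|)) * volume (ball (0 : Cn n) (1 / 8)) with hk
  have hk0 : k ≠ 0 := by
    refine mul_ne_zero ?_ (isOpen_ball.measure_pos _ ⟨0, mem_ball_self (by norm_num)⟩).ne'
    rw [ne_eq, ENNReal.ofReal_eq_zero, not_le]; positivity
  have hkt : k ≠ ∞ := ENNReal.mul_ne_top ENNReal.ofReal_ne_top measure_ball_lt_top.ne
  refine ⟨(bergmanMass n q c f / k).toReal ^ q⁻¹, by positivity, fun z hz => ?_⟩
  have hD := one_sub_norm_sq_pos hz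
  refine norm_le_of_enorm_rpow_mul_le hq hD hk0 hkt hm.ne ?_
  set D := 1 - ‖z‖ ^ 2 with hDdef
  have hsm : MeasurableSet (norm ⁻¹' shell D : Set (Cn n)) :=
    measurable_norm (isOpen_shell D).measurableSet
  calc ‖f z‖ₑ ^ q * (ENNReal.ofReal (D ^ (c + (n + 1))) * k)
      = ENNReal.ofReal (2 ^ (-|c|) * D ^ c) * (‖f z‖ₑ ^ q *
        (ENNReal.ofReal (D ^ (n + 1)) * volume (ball (0 : Cn n) (1 / 8)))) := by
        have : D ^ (c + ((n : ℝ) + 1)) = D ^ c * D ^ (n + 1) := by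
          rw [Real.rpow_add hD]; congr 1; exact_mod_cast Real.rpow_natCast D (n + 1)
        rw [this, ENNReal.ofReal_mul (by positivity), ENNReal.ofReal_mul (by positivity), hk]
        ring
    _ ≤ ENNReal.ofReal (2 ^ (-|c|) * D ^ c) * ∫⁻ w in norm ⁻¹' shell D, ‖f w‖ₑ ^ q := by
        gcongr
        exact enorm_rpow_mul_le_lintegral_shell hf hq hz
    _ = ∫⁻ w in norm ⁻¹' shell D, ENNReal.ofReal (2 ^ (-|c|) * D ^ c) * ‖f w‖ₑ ^ q :=
        (lintegral_const_mul' _ _ ENNReal.ofReal_ne_top).symm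
    _ ≤ ∫⁻ w in norm ⁻¹' shell D, ENNReal.ofReal ((1 - ‖w‖ ^ 2) ^ c) * ‖f w‖ₑ ^ q := by
        refine setLIntegral_mono' hsm fun w hw => ?_
        gcongr
        exact two_rpow_neg_abs_mul_rpow_le hD hw.1.le (by linarith [hw.2]) c
    _ ≤ bergmanMass n q c f := lintegral_mono_set (norm_preimage_shell_subset hD.le)

/-- The shell has radial width `O(D)`, so a bound on spherical means gains one power of `D` over the
volume estimate. The constant is explicit since `exists_homogeneous_flat` needs it uniform in the
degree. -/
theorem growth_of_hardyMass [NeZero n] {f : Cn n → ℂ} (hf : DifferentiableOn ℂ f (unitBall n))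
    {q : ℝ} (hq : 0 < q) {M : ℝ≥0∞} (hM : M < ∞)
    (hm : ∀ r ∈ Ioo (0 : ℝ) 1, hardyMass n q f r ≤ M) :
    ∀ z ∈ unitBall n, ‖f z‖ ≤ ((volume : Measure (Cn n)).toSphere univ * ENNReal.ofReal (3 / 2) * M
      / volume (ball (0 : Cn n) (1 / 8))).toReal ^ q⁻¹ * (1 - ‖z‖ ^ 2) ^ (-((n : ℝ) / q)) := by
  set k : ℝ≥0∞ := volume (ball (0 : Cn n) (1 / 8)) with hk
  set s := (volume : Measure (Cn n)).toSphere univ with hs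
  have hk0 : k ≠ 0 := (isOpen_ball.measure_pos _ ⟨0, mem_ball_self (by norm_num)⟩).ne'
  have hkt : k ≠ ∞ := measure_ball_lt_top.ne
  have hst : s ≠ ∞ := measure_ne_top _ _
  intro z hz
  have hD := one_sub_norm_sq_pos hz
  refine norm_le_of_enorm_rpow_mul_le hq hD hk0 hkt
    (ENNReal.mul_ne_top (ENNReal.mul_ne_top hst ENNReal.ofReal_ne_top) hM.ne) ?_
  set D := 1 - ‖z‖ ^ 2 with hDdef
  have hD0 : ENNReal.ofReal D ≠ 0 := by simpa using hD
  rw [← ENNReal.mul_le_mul_iff_right hD0 ENNReal.ofReal_ne_top]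
  calc ENNReal.ofReal D * (‖f z‖ₑ ^ q * (ENNReal.ofReal (D ^ (n : ℝ)) * k))
      = ‖f z‖ₑ ^ q * (ENNReal.ofReal (D ^ (n + 1)) * k) := by
        rw [pow_succ, ENNReal.ofReal_mul (by positivity), Real.rpow_natCast]
        ring
    _ ≤ ∫⁻ w in norm ⁻¹' shell D, ‖f w‖ₑ ^ q := enorm_rpow_mul_le_lintegral_shell hf hq hz
    _ = s * ∫⁻ r in Ioi (0 : ℝ) ∩ shell D, ENNReal.ofReal (r ^ (2 * n - 1)) * hardyMass n q f r := by
        refine setLIntegral_polar (isOpen_shell D).measurableSet ?_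
        exact measurable_indicator_of_continuousOn
          (measurable_norm (isOpen_shell D).measurableSet)
          ((continuousOn_enorm_rpow hf q).mono (norm_preimage_shell_subset hD.le))
    _ ≤ s * ∫⁻ r in Ioo (1 - 3 * D / 2) 1, M := by
        refine mul_le_mul' le_rfl ?_
        -- On the shell `1 - r ≤ 1 - r ^ 2 < 3 * D / 2`.
        have hsub : Ioi (0 : ℝ) ∩ shell D ⊆ Ioo (1 - 3 * D / 2) 1 := fun r hr => by
          have h0 : 0 < r := hr.1
          have h1 := hr.2.1
          have h2 := hr.2.2
          constructor <;> nlinarith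
        refine le_trans (setLIntegral_mono'
          (measurableSet_Ioi.inter (isOpen_shell D).measurableSet) fun r hr => ?_)
          (lintegral_mono_set hsub)
        have h0 : 0 < r := hr.1
        have h1 := (hsub hr).2
        calc ENNReal.ofReal (r ^ (2 * n - 1)) * hardyMass n q f r ≤ 1 * M := by
              gcongr
              · rw [ENNReal.ofReal_le_one]; exact pow_le_one₀ h0.le h1.le
              · exact hm r ⟨h0, h1⟩
          _ = M := one_mul _
    _ = ENNReal.ofReal D * (s * ENNReal.ofReal (3 / 2) * M) := by
        rw [setLIntegral_const, Real.volume_Ioo,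
          show 1 - (1 - 3 * D / 2) = D * (3 / 2) by ring, ENNReal.ofReal_mul hD.le]
        ring

end

/-! ### Finiteness of weighted masses under changes of exponent and weight. -/

noncomputable section

open Metric Set

theorem lintegral_Ioo_rpow {e t : ℝ} (he : -1 < e) (ht : 0 ≤ t) :
    ∫⁻ τ in Ioo 0 t, ENNReal.ofReal (τ ^ e) = ENNReal.ofReal (t ^ (e + 1) / (e + 1)) := by
  have hint := (intervalIntegral.intervalIntegrable_rpow' he (a := 0) (b := t))
  rw [intervalIntegrable_iff_integrableOn_Ioo_of_le ht] at hint
  rw [← ofReal_integral_eq_lintegral_ofReal hint]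
  · rw [← integral_Ioc_eq_integral_Ioo, ← intervalIntegral.integral_of_le ht,
      integral_rpow (Or.inl he), Real.zero_rpow (by linarith), sub_zero]
  · exact (ae_restrict_iff' measurableSet_Ioo).2
      (Filter.Eventually.of_forall fun x hx => Real.rpow_nonneg hx.1.le _)

theorem lintegral_Ioi_rpow {e t : ℝ} (he : e < -1) (ht : 0 < t) :
    ∫⁻ τ in Ioi t, ENNReal.ofReal (τ ^ e) = ENNReal.ofReal (-t ^ (e + 1) / (e + 1)) := by
  rw [← ofReal_integral_eq_lintegral_ofReal (integrableOn_Ioi_rpow_of_lt he ht),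
    integral_Ioi_rpow_of_lt he ht]
  exact (ae_restrict_iff' measurableSet_Ioi).2
      (Filter.Eventually.of_forall fun x hx => Real.rpow_nonneg (ht.trans hx).le _)

theorem lintegral_Ioo_one_sub (F : ℝ → ℝ≥0∞) :
    ∫⁻ r in Ioo (0 : ℝ) 1, F (1 - r) = ∫⁻ τ in Ioo (0 : ℝ) 1, F τ := by
  have h := (Measure.measurePreserving_sub_left (volume : Measure ℝ) 1).setLIntegral_comp_preimage_emb
    (MeasurableEquiv.subLeft (1 : ℝ)).measurableEmbedding F (Ioo 0 1)
  rw [← h]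
  congr 2
  ext x
  simp

theorem one_sub_sq_rpow_le {r : ℝ} (hr : r ∈ Ioo (0 : ℝ) 1) (c : ℝ) :
    (1 - r ^ 2) ^ c ≤ 2 ^ |c| * (1 - r) ^ c := by
  have h1 := hr.1
  have h2 := hr.2
  have h := two_rpow_neg_abs_mul_rpow_le (D := 1 - r ^ 2) (x := 1 - r) (by nlinarith)
    (by nlinarith) (by nlinarith) c
  rw [Real.rpow_neg (by norm_num), inv_mul_le_iff₀ (by positivity)] at h
  exact h

theorem lintegral_one_sub_sq_rpow_lt_top {c : ℝ} (hc : -1 < c) :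
    ∫⁻ r in Ioo (0 : ℝ) 1, ENNReal.ofReal ((1 - r ^ 2) ^ c) < ∞ := by
  calc ∫⁻ r in Ioo (0 : ℝ) 1, ENNReal.ofReal ((1 - r ^ 2) ^ c)
      ≤ ∫⁻ r in Ioo (0 : ℝ) 1, ENNReal.ofReal (2 ^ |c|) * ENNReal.ofReal ((1 - r) ^ c) := by
        refine setLIntegral_mono' measurableSet_Ioo fun r hr => ?_
        rw [← ENNReal.ofReal_mul (by positivity)]
        exact ENNReal.ofReal_le_ofReal (one_sub_sq_rpow_le hr c)
    _ = ENNReal.ofReal (2 ^ |c|) * ∫⁻ r in Ioo (0 : ℝ) 1, ENNReal.ofReal ((1 - r) ^ c) :=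
        lintegral_const_mul' _ _ ENNReal.ofReal_ne_top
    _ = ENNReal.ofReal (2 ^ |c|) * ∫⁻ τ in Ioo (0 : ℝ) 1, ENNReal.ofReal (τ ^ c) := by
        rw [lintegral_Ioo_one_sub (fun τ => ENNReal.ofReal (τ ^ c))]
    _ < ∞ := by
        rw [lintegral_Ioo_rpow hc zero_le_one]
        exact ENNReal.mul_lt_top ENNReal.ofReal_lt_top ENNReal.ofReal_lt_top

variable {n : ℕ}

theorem continuousOn_weight (c : ℝ) :
    ContinuousOn (fun z : Cn n => ENNReal.ofReal ((1 - ‖z‖ ^ 2) ^ c)) (unitBall n) :=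
  ENNReal.continuous_ofReal.comp_continuousOn
    (ContinuousOn.rpow_const (by fun_prop) fun _ hz => Or.inl (one_sub_norm_sq_pos hz).ne')

theorem measurable_indicator_bergman {f : Cn n → ℂ} (hf : DifferentiableOn ℂ f (unitBall n))
    (q c : ℝ) : Measurable ((unitBall n).indicator
      fun z => ENNReal.ofReal ((1 - ‖z‖ ^ 2) ^ c) * ‖f z‖ₑ ^ q) := by
  have h1 := measurable_indicator_of_continuousOn measurableSet_ball (continuousOn_weight (n := n) c)
  have h2 := measurable_indicator_of_continuousOn measurableSet_ball (continuousOn_enorm_rpow hf q)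
  rw [indicator_mul]
  exact h1.mul h2

theorem aemeasurable_weight (c : ℝ) :
    AEMeasurable (fun z : Cn n => ENNReal.ofReal ((1 - ‖z‖ ^ 2) ^ c))
      (volume.restrict (unitBall n)) :=
  (continuousOn_weight c).aemeasurable measurableSet_ball

theorem unitBall_eq_preimage : unitBall n = norm ⁻¹' Ico (0 : ℝ) 1 := by
  ext z; simp

theorem ofReal_mul_enorm_rpow {w x q : ℝ} (hw : 0 ≤ w) (hq : 0 ≤ q) (z : ℂ) (hx : ‖z‖ = x) :
    ENNReal.ofReal w * ‖z‖ₑ ^ q = ENNReal.ofReal (w * x ^ q) := by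
  rw [ENNReal.ofReal_mul hw, ← ENNReal.ofReal_rpow_of_nonneg (hx ▸ norm_nonneg _) hq, ← hx,
    ofReal_norm]

/-- Functions of given growth in a weighted space stay in the spaces with larger exponent. -/
theorem bergmanMass_lt_top_of_growth {f : Cn n → ℂ} {q q' c c' C g : ℝ} (hq : 0 < q) (hqq' : q ≤ q')
    (hC : 0 ≤ C) (hg : ∀ z ∈ unitBall n, ‖f z‖ ≤ C * (1 - ‖z‖ ^ 2) ^ (-g))
    (hm : bergmanMass n q c f < ∞) (hcc' : c + (q' - q) * g ≤ c') : bergmanMass n q' c' f < ∞ := by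
  have hpt : ∀ z ∈ unitBall n, ENNReal.ofReal ((1 - ‖z‖ ^ 2) ^ c') * ‖f z‖ₑ ^ q' ≤
      ENNReal.ofReal (C ^ (q' - q)) * (ENNReal.ofReal ((1 - ‖z‖ ^ 2) ^ c) * ‖f z‖ₑ ^ q) :=
    fun z hz => by
    have hD := one_sub_norm_sq_pos hz
    have hD1 : 1 - ‖z‖ ^ 2 ≤ 1 := by nlinarith [norm_nonneg z]
    set D := 1 - ‖z‖ ^ 2 with hDdef
    rw [ofReal_mul_enorm_rpow (by positivity) (hq.le.trans hqq') _ rfl,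
      ofReal_mul_enorm_rpow (by positivity) hq.le _ rfl, ← ENNReal.ofReal_mul (by positivity)]
    refine ENNReal.ofReal_le_ofReal ?_
    have h0 : 0 ≤ q' - q := by linarith
    calc D ^ c' * ‖f z‖ ^ q' = D ^ c' * (‖f z‖ ^ (q' - q) * ‖f z‖ ^ q) := by
          rw [← Real.rpow_add_of_nonneg (norm_nonneg _) h0 hq.le]; congr 2; ring
      _ ≤ D ^ c' * ((C * D ^ (-g)) ^ (q' - q) * ‖f z‖ ^ q) := by
          gcongr
          exact hg z hz
      _ = C ^ (q' - q) * (D ^ (c' - (q' - q) * g) * ‖f z‖ ^ q) := by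
          rw [Real.mul_rpow hC (by positivity), ← Real.rpow_mul hD.le, sub_eq_add_neg c',
            Real.rpow_add hD, show -((q' - q) * g) = -g * (q' - q) by ring]
          ring
      _ ≤ C ^ (q' - q) * (D ^ c * ‖f z‖ ^ q) := by
          gcongr C ^ (q' - q) * (?_ * ‖f z‖ ^ q)
          exact Real.rpow_le_rpow_of_exponent_ge hD hD1 (by linarith)
  refine (setLIntegral_mono' measurableSet_ball hpt).trans_lt ?_
  rw [lintegral_const_mul' _ _ ENNReal.ofReal_ne_top]
  exact ENNReal.mul_lt_top ENNReal.ofReal_lt_top hm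

theorem continuous_sphere_slice {f : Cn n → ℂ} (hf : DifferentiableOn ℂ f (unitBall n)) {r : ℝ}
    (hr : r ∈ Ioo (0 : ℝ) 1) :
    Continuous fun ζ : sphere (0 : Cn n) 1 => f ((r : ℂ) • (ζ : Cn n)) :=
  hf.continuousOn.comp_continuous (by fun_prop) fun ζ => by
    rw [mem_ball_zero_iff, norm_smul_sphere, Complex.norm_real, Real.norm_of_nonneg hr.1.le]
    exact hr.2

variable [NeZero n]

theorem bergmanMass_polar {f : Cn n → ℂ} (hf : DifferentiableOn ℂ f (unitBall n)) (q c : ℝ) :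
    bergmanMass n q c f = (volume : Measure (Cn n)).toSphere univ *
      ∫⁻ r in Ioo (0 : ℝ) 1, ENNReal.ofReal (r ^ (2 * n - 1)) *
        (ENNReal.ofReal ((1 - r ^ 2) ^ c) * hardyMass n q f r) := by
  have hm := measurable_indicator_bergman hf q c
  rw [bergmanMass]
  rw [unitBall_eq_preimage] at hm ⊢
  rw [setLIntegral_polar measurableSet_Ico hm]
  have : Ioi (0 : ℝ) ∩ Ico 0 1 = Ioo 0 1 := by
    ext x; simp only [mem_inter_iff, mem_Ioi, mem_Ico, mem_Ioo]
    exact ⟨fun h => ⟨h.1, h.2.2⟩, fun h => ⟨h.1, h.1.le, h.2⟩⟩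
  rw [this]
  congr 1
  refine setLIntegral_congr_fun measurableSet_Ioo fun r hr => ?_
  refine congrArg _ ?_
  rw [hardyMass, ← lintegral_const_mul' _ _ ENNReal.ofReal_ne_top]
  refine lintegral_congr fun ζ => ?_
  rw [norm_smul_sphere, Complex.norm_real, Real.norm_of_nonneg hr.1.le]

theorem bergmanMass_le_of_hardyMass {f : Cn n → ℂ} (hf : DifferentiableOn ℂ f (unitBall n))
    {q c : ℝ} (F : ℝ → ℝ≥0∞) (hF : ∀ r ∈ Ioo (0 : ℝ) 1, hardyMass n q f r ≤ F r) :
    bergmanMass n q c f ≤ (volume : Measure (Cn n)).toSphere univ *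
      ∫⁻ r in Ioo (0 : ℝ) 1, ENNReal.ofReal ((1 - r ^ 2) ^ c) * F r := by
  rw [bergmanMass_polar hf]
  refine mul_le_mul' le_rfl (setLIntegral_mono' measurableSet_Ioo fun r hr => ?_)
  calc _ ≤ 1 * (ENNReal.ofReal ((1 - r ^ 2) ^ c) * F r) := by
        gcongr
        · rw [ENNReal.ofReal_le_one]; exact pow_le_one₀ hr.1.le hr.2.le
        · exact hF r hr
    _ = _ := one_mul _

theorem bergmanMass_lt_top_of_hardyMass {f : Cn n → ℂ} (hf : DifferentiableOn ℂ f (unitBall n))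
    {q c : ℝ} (hc : -1 < c) {M : ℝ≥0∞} (hM : M < ∞)
    (hm : ∀ r ∈ Ioo (0 : ℝ) 1, hardyMass n q f r ≤ M) : bergmanMass n q c f < ∞ := by
  refine (bergmanMass_le_of_hardyMass hf (fun _ => M) hm).trans_lt
    (ENNReal.mul_lt_top (measure_lt_top _ _) ?_)
  rw [lintegral_mul_const' _ _ hM.ne]
  exact ENNReal.mul_lt_top (lintegral_one_sub_sq_rpow_lt_top hc) hM

theorem lintegral_weight_lt_top {c : ℝ} (hc : -1 < c) :
    ∫⁻ z in unitBall n, ENNReal.ofReal ((1 - ‖z‖ ^ 2) ^ c) < ∞ := by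
  have := bergmanMass_lt_top_of_hardyMass (n := n) (f := fun _ => 1) (q := 1) (M := 1)
    (differentiableOn_const _) hc ENNReal.one_lt_top (fun r _ => by simp [hardyMass])
  simpa [bergmanMass] using this

/-- A pointwise bound for the integrand gives finiteness, with room for a constant factor. -/
theorem bergmanMass_lt_top_of_pointwise {f : Cn n → ℂ} {q c e K : ℝ} {G : Cn n → ℝ≥0∞}
    (he : -1 < e) (hG : ∫⁻ z in unitBall n, G z < ∞)
    (h : ∀ z ∈ unitBall n, ENNReal.ofReal ((1 - ‖z‖ ^ 2) ^ c) * ‖f z‖ₑ ^ q ≤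
      ENNReal.ofReal K * (ENNReal.ofReal ((1 - ‖z‖ ^ 2) ^ e) + G z)) :
    bergmanMass n q c f < ∞ := by
  refine (setLIntegral_mono' measurableSet_ball h).trans_lt ?_
  rw [lintegral_const_mul' _ _ ENNReal.ofReal_ne_top,
    lintegral_add_left' (aemeasurable_weight e)]
  exact ENNReal.mul_lt_top ENNReal.ofReal_lt_top
    (ENNReal.add_lt_top.2 ⟨lintegral_weight_lt_top he, hG⟩)

/-- The surplus `|f| ^ (q' - q)` is bounded by the growth `g = (c + n + 1) / q`. Since `g * q = c +
n + 1`, the condition `c + (q' - q) * g ≤ c'` is the hypothesis. -/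
theorem bergmanMass_mono_exponent {f : Cn n → ℂ} (hf : DifferentiableOn ℂ f (unitBall n))
    {q q' c c' : ℝ} (hq : 0 < q) (hqq' : q ≤ q') (hm : bergmanMass n q c f < ∞)
    (h : (c + (n + 1)) / q ≤ (c' + (n + 1)) / q') : bergmanMass n q' c' f < ∞ := by
  obtain ⟨C, hC, hg⟩ := growth_of_bergmanMass hf hq hm
  refine bergmanMass_lt_top_of_growth hq hqq' hC hg hm ?_
  have hq' : 0 < q' := hq.trans_le hqq'
  rw [le_div_iff₀ hq'] at h
  have : (c + (n + 1)) / q * q = c + (n + 1) := by field_simp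
  nlinarith

theorem bergmanMass_lt_top_of_growth_of_lt {f : Cn n → ℂ} {q' c' C g : ℝ} (hq' : 0 < q')
    (hC : 0 ≤ C) (hg : ∀ z ∈ unitBall n, ‖f z‖ ≤ C * (1 - ‖z‖ ^ 2) ^ (-g))
    (h : g < (c' + 1) / q') : bergmanMass n q' c' f < ∞ := by
  rw [lt_div_iff₀ hq'] at h
  refine bergmanMass_lt_top_of_pointwise (e := c' - g * q') (K := C ^ q') (G := fun _ => 0)
    (by linarith) (by simp) fun z hz => ?_
  have hD := one_sub_norm_sq_pos hz
  rw [add_zero, ofReal_mul_enorm_rpow (by positivity) hq'.le _ rfl,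
    ← ENNReal.ofReal_mul (by positivity)]
  refine ENNReal.ofReal_le_ofReal ?_
  calc _ ≤ (1 - ‖z‖ ^ 2) ^ c' * (C * (1 - ‖z‖ ^ 2) ^ (-g)) ^ q' := by
        gcongr
        exact hg z hz
    _ = _ := by
        rw [Real.mul_rpow hC (by positivity), ← Real.rpow_mul hD.le, sub_eq_add_neg c',
          Real.rpow_add hD, show -(g * q') = -g * q' by ring]
        ring

/-- Lowering the exponent, by splitting according to the size of `f`. -/
theorem bergmanMass_lt_top_of_exponent_lt {f : Cn n → ℂ} {q q' c c' : ℝ} (hq' : 0 < q')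
    (hqq' : q' < q) (hm : bergmanMass n q c f < ∞) (h : (c + 1) / q < (c' + 1) / q') :
    bergmanMass n q' c' f < ∞ := by
  have hq : 0 < q := hq'.trans hqq'
  have hd : 0 < q - q' := by linarith
  rw [div_lt_div_iff₀ hq hq'] at h
  -- At `|f| = D ^ t` the integrands `D ^ c' |f| ^ q'` and `D ^ c |f| ^ q` agree. Above it the
  -- second dominates; below it `D ^ (c' + t * q')` does.
  set t := (c' - c) / (q - q') with ht
  have ht' : t * (q - q') = c' - c := by rw [ht]; field_simp
  refine bergmanMass_lt_top_of_pointwise (e := c' + t * q') (K := 1)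
    (G := fun z => ENNReal.ofReal ((1 - ‖z‖ ^ 2) ^ c) * ‖f z‖ₑ ^ q) ?_ hm fun z hz => ?_
  -- The product equals `(c' + 1) * q - (c + 1) * q'`, positive by hypothesis.
  · have : 0 < (c' + t * q' + 1) * (q - q') := by nlinarith
    have := pos_of_mul_pos_left this hd.le
    linarith
  · have hD := one_sub_norm_sq_pos hz
    set D := 1 - ‖z‖ ^ 2 with hDdef
    rw [ENNReal.ofReal_one, one_mul, ofReal_mul_enorm_rpow (by positivity) hq'.le _ rfl,
      ofReal_mul_enorm_rpow (by positivity) hq.le _ rfl,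
      ← ENNReal.ofReal_add (by positivity) (by positivity)]
    refine ENNReal.ofReal_le_ofReal ?_
    rcases le_or_gt ‖f z‖ (D ^ t) with hle | hgt
    · refine le_add_of_le_of_nonneg ?_ (by positivity)
      rw [Real.rpow_add hD, Real.rpow_mul hD.le]
      gcongr
    · refine le_add_of_nonneg_of_le (by positivity) ?_
      calc D ^ c' * ‖f z‖ ^ q' = D ^ c * ((D ^ t) ^ (q - q') * ‖f z‖ ^ q') := by
            rw [← Real.rpow_mul hD.le, ht', ← mul_assoc, ← Real.rpow_add hD]; congr 2; ring
        _ ≤ D ^ c * (‖f z‖ ^ (q - q') * ‖f z‖ ^ q') := by gcongr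
        _ = D ^ c * ‖f z‖ ^ q := by
            rw [← Real.rpow_add_of_nonneg (norm_nonneg _) hd.le hq'.le]; congr 2; ring

end

/-! ### The Hardy–Littlewood embedding. -/

noncomputable section

open Metric Set

/-- Radial integration of the Huber functions with thresholds `B τ ^ (-b)`. -/
theorem lintegral_huber_le {N b B v : ℝ} (hb1 : N < 2 * b) (hb2 : b < N) (hB : 0 ≤ B)
    (hv : 0 ≤ v) :
    ∫⁻ τ in Ioo (0 : ℝ) 1, ENNReal.ofReal (τ ^ (2 * b - N - 1) * huber (B * τ ^ (-b)) v) ≤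
      ENNReal.ofReal ((1 / (2 * b - N) + 2 * B / (N - b)) * v ^ (N / b)) := by
  have hb : 0 < b := by linarith
  rcases hv.eq_or_lt with rfl | hv
  · refine le_of_eq_of_le (b := 0) ?_ zero_le
    rw [lintegral_eq_zero_iff' ?_]
    · refine (ae_restrict_iff' measurableSet_Ioo).2 (Filter.Eventually.of_forall fun τ hτ => ?_)
      have : (0 : ℝ) ≤ B * τ ^ (-b) := mul_nonneg hB (Real.rpow_nonneg hτ.1.le _)
      simp [huber_of_le this]
    · refine ContinuousOn.aemeasurable ?_ measurableSet_Ioo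
      refine ENNReal.continuous_ofReal.comp_continuousOn ?_
      simp_rw [huber_eq_tangent]
      have h1 : ∀ e : ℝ, ContinuousOn (fun τ : ℝ => τ ^ e) (Ioo 0 1) := fun e =>
        continuousOn_id.rpow_const fun x hx => Or.inl hx.1.ne'
      have h2 : ContinuousOn (fun τ : ℝ => min 0 (B * τ ^ (-b))) (Ioo 0 1) :=
        continuousOn_const.inf (continuousOn_const.mul (h1 _))
      exact (h1 _).mul (((continuousOn_const.mul h2).mul continuousOn_const).sub (h2.pow 2))
  -- Here `t ^ (-b) = v`. The bounds by `v ^ 2` and by `2 * L * v` hold on all of `(0, 1)`; the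
  -- first is integrable at `0` because `N < 2 * b`, the second at `∞` because `b < N`.
  set t := v ^ (-b⁻¹) with ht
  have ht0 : 0 < t := Real.rpow_pos_of_pos hv _
  have hte : ∀ e : ℝ, t ^ e = v ^ (-(e / b)) := fun e => by
    rw [ht, ← Real.rpow_mul hv.le]; congr 1; field_simp
  calc ∫⁻ τ in Ioo (0 : ℝ) 1, ENNReal.ofReal (τ ^ (2 * b - N - 1) * huber (B * τ ^ (-b)) v)
      ≤ ∫⁻ τ in Ioo (0 : ℝ) t ∪ Ici t,
          ENNReal.ofReal (τ ^ (2 * b - N - 1) * huber (B * τ ^ (-b)) v) := by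
        refine lintegral_mono_set fun x hx => ?_
        rcases lt_or_ge x t with h | h
        · exact Or.inl ⟨hx.1, h⟩
        · exact Or.inr h
    _ ≤ (∫⁻ τ in Ioo (0 : ℝ) t, ENNReal.ofReal (τ ^ (2 * b - N - 1) * huber (B * τ ^ (-b)) v)) +
        ∫⁻ τ in Ici t, ENNReal.ofReal (τ ^ (2 * b - N - 1) * huber (B * τ ^ (-b)) v) :=
        lintegral_union_le _ _ _
    _ ≤ (∫⁻ τ in Ioo (0 : ℝ) t, ENNReal.ofReal (v ^ 2) * ENNReal.ofReal (τ ^ (2 * b - N - 1))) +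
        ∫⁻ τ in Ici t, ENNReal.ofReal (2 * B * v) * ENNReal.ofReal (τ ^ (b - N - 1)) := by
        refine add_le_add (setLIntegral_mono' measurableSet_Ioo fun τ hτ => ?_)
          (setLIntegral_mono' measurableSet_Ici fun τ hτ => ?_)
        · rw [← ENNReal.ofReal_mul (by positivity), mul_comm]
          refine ENNReal.ofReal_le_ofReal ?_
          have := Real.rpow_nonneg hτ.1.le (2 * b - N - 1)
          gcongr
          exact huber_le_sq _ _
        · have hτ0 : 0 < τ := ht0.trans_le hτ
          rw [← ENNReal.ofReal_mul (by positivity)]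
          refine ENNReal.ofReal_le_ofReal ?_
          calc τ ^ (2 * b - N - 1) * huber (B * τ ^ (-b)) v
              ≤ τ ^ (2 * b - N - 1) * (2 * (B * τ ^ (-b)) * v) := by
                gcongr
                exact huber_le_linear hv.le
            _ = 2 * B * v * τ ^ (b - N - 1) := by
                rw [show b - N - 1 = (2 * b - N - 1) + (-b) by ring, Real.rpow_add hτ0]
                ring
    _ = ENNReal.ofReal (v ^ 2 * (t ^ (2 * b - N) / (2 * b - N))) +
        ENNReal.ofReal (2 * B * v * (t ^ (b - N) / (N - b))) := by
        rw [lintegral_const_mul' _ _ ENNReal.ofReal_ne_top,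
          lintegral_const_mul' _ _ ENNReal.ofReal_ne_top,
          lintegral_Ioo_rpow (by linarith) ht0.le, Measure.restrict_congr_set (Ioi_ae_eq_Ici (a := t)).symm,
          lintegral_Ioi_rpow (by linarith) ht0, ← ENNReal.ofReal_mul (by positivity),
          ← ENNReal.ofReal_mul (by positivity)]
        congr 3
        · ring_nf
        · rw [show b - N - 1 + 1 = b - N by ring, ← neg_div_neg_eq, neg_neg, neg_sub]
    _ = _ := by
        have h1 : 0 < 2 * b - N := by linarith
        have h2 : 0 < N - b := by linarith
        rw [← ENNReal.ofReal_add (by positivity) (by positivity), hte, hte]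
        have e1 : v ^ 2 * v ^ (-((2 * b - N) / b)) = v ^ (N / b) := by
          rw [← Real.rpow_natCast v 2, ← Real.rpow_add hv]; congr 1; push_cast; field_simp; ring
        have e2 : v * v ^ (-((b - N) / b)) = v ^ (N / b) := by
          nth_rewrite 1 [← Real.rpow_one v]
          rw [← Real.rpow_add hv]; congr 1; field_simp; ring
        congr 1
        rw [add_mul, ← e1]
        nth_rewrite 2 [e1]
        rw [← e2]
        ring

/-- Monotone convergence, which lets the embedding be proved with the sphere of radius `ρ < 1` in
place of boundary values. -/
theorem setLIntegral_Ioo_le_of_forall {F : ℝ → ℝ≥0∞} {C : ℝ≥0∞}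
    (h : ∀ ρ ∈ Ioo (0 : ℝ) 1, ∫⁻ r in Ioo 0 ρ, F r ≤ C) : ∫⁻ r in Ioo 0 1, F r ≤ C := by
  set s : ℕ → Set ℝ := fun k => Ioo 0 (1 - 1 / ((k : ℝ) + 2)) with hs
  have hmono : Monotone s := fun i j hij => by
    refine Ioo_subset_Ioo_right ?_
    have : (i : ℝ) ≤ j := by exact_mod_cast hij
    gcongr
  have hun : Ioo (0 : ℝ) 1 ⊆ ⋃ k, s k := fun x hx => by
    obtain ⟨k, hk⟩ := exists_nat_one_div_lt (sub_pos.2 hx.2)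
    refine mem_iUnion.2 ⟨k, hx.1, ?_⟩
    have : 1 / ((k : ℝ) + 2) ≤ 1 / ((k : ℝ) + 1) := by gcongr; linarith
    linarith
  refine (lintegral_mono_set hun).trans ?_
  rw [setLIntegral_iUnion_of_directed _ (hmono.directed_le)]
  refine iSup_le fun k => h _ ⟨?_, ?_⟩
  · rw [sub_pos, div_lt_one (by positivity)]
    have : (0 : ℝ) ≤ k := by positivity
    linarith
  · have : 0 < 1 / ((k : ℝ) + 2) := by positivity
    linarith

variable {n : ℕ} [NeZero n]

/-- The Hardy–Littlewood embedding of `H^p` with a comparable exponent. -/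
theorem bergmanMass_lt_top_of_hardy_of_lt_two_mul {f : Cn n → ℂ}
    (hf : DifferentiableOn ℂ f (unitBall n)) {p q : ℝ} (hp : 0 < p) (hpq : p < q) (hq2 : q < 2 * p)
    {M : ℝ≥0∞} (hM : M < ∞) (hm : ∀ r ∈ Ioo (0 : ℝ) 1, hardyMass n p f r ≤ M) :
    bergmanMass n q (n * q / p - n - 1) f < ∞ := by
  obtain ⟨A, hA, hgrow⟩ : ∃ A : ℝ, 0 ≤ A ∧
      ∀ z ∈ unitBall n, ‖f z‖ ≤ A * (1 - ‖z‖ ^ 2) ^ (-((n : ℝ) / p)) :=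
    ⟨_, by positivity, growth_of_hardyMass hf hp hM hm⟩
  have hq : 0 < q := hp.trans hpq
  have hn : (0 : ℝ) < n := by exact_mod_cast Nat.pos_of_ne_zero (NeZero.ne n)
  -- The square of `|f| ^ a` is `|f| ^ q`. With `b = n * a / p`, the bounds `p < q < 2 * p` become
  -- `b < n < 2 * b`.
  set a := q / 2 with ha
  have ha0 : 0 < a := by positivity
  set b := n * a / p with hb
  have hb0 : 0 < b := by positivity
  have hb1 : n < 2 * b := by
    rw [hb, ha, ← mul_div_assoc, lt_div_iff₀ hp]; nlinarith
  have hb2 : b < n := by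
    rw [hb, ha, div_lt_iff₀ hp]; nlinarith
  set c := n * q / p - n - 1 with hc
  have hcb : c = 2 * b - n - 1 := by rw [hc, hb, ha]; ring
  set B := A ^ a with hB
  have hB0 : 0 ≤ B := by positivity
  set L : ℝ → ℝ := fun r => B * (1 - r) ^ (-b) with hL
  have hslice : ∀ r ∈ Ioo (0 : ℝ) 1, ∀ ζ : sphere (0 : Cn n) 1,
      ‖f ((r : ℂ) • (ζ : Cn n))‖ ^ a ≤ L r := fun r hr ζ => by
    have h1 : 0 < 1 - r := sub_pos.2 hr.2
    have h2 : 1 - r ≤ 1 - r ^ 2 := by nlinarith [hr.1, hr.2]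
    have hz : ‖(r : ℂ) • (ζ : Cn n)‖ = r := by
      rw [norm_smul_sphere, Complex.norm_real, Real.norm_of_nonneg hr.1.le]
    have h3 := hgrow ((r : ℂ) • (ζ : Cn n)) (by rw [mem_ball_zero_iff, hz]; exact hr.2)
    rw [hz] at h3
    have h4 : 0 < 1 - r ^ 2 := by linarith
    calc ‖f ((r : ℂ) • (ζ : Cn n))‖ ^ a ≤ (A * (1 - r ^ 2) ^ (-((n : ℝ) / p))) ^ a := by gcongr
      _ = B * (1 - r ^ 2) ^ (-b) := by
          rw [Real.mul_rpow hA (by positivity), ← Real.rpow_mul h4.le, hb]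
          congr 2; ring
      _ ≤ L r := mul_le_mul_of_nonneg_left
          (Real.rpow_le_rpow_of_nonpos h1 h2 (by linarith)) hB0
  set K : ℝ := 1 / (2 * b - n) + 2 * B / (n - b) with hK
  have hcont : ∀ ρ ∈ Ioo (0 : ℝ) 1, Continuous fun ζ : sphere (0 : Cn n) 1 =>
      ‖f ((ρ : ℂ) • (ζ : Cn n))‖ ^ a := fun ρ hρ =>
    (continuous_sphere_slice hf hρ).norm.rpow_const fun _ => Or.inr ha0.le
  -- On the sphere of radius `r` the growth bound gives `|f| ^ a ≤ L r`, so `huber (L r)` is there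
  -- the square. Monotonicity moves the mean to radius `ρ`, where `huber` grows only linearly past
  -- `L r`.
  have hmean : ∀ ρ ∈ Ioo (0 : ℝ) 1, ∀ r ∈ Ioo (0 : ℝ) ρ, hardyMass n q f r ≤
      ∫⁻ ζ : sphere (0 : Cn n) 1, ENNReal.ofReal
        (huber (L r) (‖f ((ρ : ℂ) • (ζ : Cn n))‖ ^ a)) ∂sphereMeasure n := fun ρ hρ r hr => by
    have hr1 : r ∈ Ioo (0 : ℝ) 1 := ⟨hr.1, hr.2.trans hρ.2⟩
    have hLr : 0 ≤ L r := mul_nonneg hB0 (Real.rpow_nonneg (sub_pos.2 hr1.2).le _)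
    have hint : ∀ t ∈ Ioo (0 : ℝ) 1, Integrable (fun ζ : sphere (0 : Cn n) 1 =>
        huber (L r) (‖f ((t : ℂ) • (ζ : Cn n))‖ ^ a)) (sphereMeasure n) := fun t ht =>
      ((continuous_huber _).comp (hcont t ht)).integrable_of_hasCompactSupport
        (HasCompactSupport.of_compactSpace _)
    rw [← ofReal_integral_eq_lintegral_ofReal (hint ρ hρ)
      (Filter.Eventually.of_forall fun ζ => huber_nonneg hLr)]
    refine le_trans ?_ (ENNReal.ofReal_le_ofReal
      (sphere_huber_mono hf ha0 hLr hr.1.le hr.2.le hρ.2))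
    rw [ofReal_integral_eq_lintegral_ofReal (hint r hr1)
      (Filter.Eventually.of_forall fun ζ => huber_nonneg hLr)]
    refine lintegral_mono fun ζ => ?_
    dsimp only
    rw [huber_of_le (hslice r hr1 ζ), ← Real.rpow_natCast, ← Real.rpow_mul (norm_nonneg _),
      show a * ((2 : ℕ) : ℝ) = q by rw [ha]; push_cast; ring,
      ← ENNReal.ofReal_rpow_of_nonneg (norm_nonneg _) hq.le, ofReal_norm]
  have hinner : ∀ v : ℝ, 0 ≤ v → ∫⁻ r in Ioo (0 : ℝ) 1,
      ENNReal.ofReal ((1 - r ^ 2) ^ c) * ENNReal.ofReal (huber (L r) v) ≤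
      ENNReal.ofReal (2 ^ |c| * K) * ENNReal.ofReal (v ^ (n / b)) := fun v hv => by
    have h1 : 0 < 2 * b - n := by linarith
    have h2 : 0 < n - b := by linarith
    calc ∫⁻ r in Ioo (0 : ℝ) 1, ENNReal.ofReal ((1 - r ^ 2) ^ c) * ENNReal.ofReal (huber (L r) v)
        ≤ ∫⁻ r in Ioo (0 : ℝ) 1, ENNReal.ofReal (2 ^ |c|) *
          ENNReal.ofReal ((1 - r) ^ (2 * b - n - 1) * huber (B * (1 - r) ^ (-b)) v) := by
          refine setLIntegral_mono' measurableSet_Ioo fun r hr => ?_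
          have h3 : 0 < 1 - r := sub_pos.2 hr.2
          rw [ENNReal.ofReal_mul (by positivity), ← mul_assoc,
            ← ENNReal.ofReal_mul (p := (2 : ℝ) ^ |c|) (by positivity),
            ← hcb]
          gcongr
          exact one_sub_sq_rpow_le hr c
      _ = ENNReal.ofReal (2 ^ |c|) * ∫⁻ τ in Ioo (0 : ℝ) 1,
          ENNReal.ofReal (τ ^ (2 * b - n - 1) * huber (B * τ ^ (-b)) v) := by
          rw [lintegral_const_mul' _ _ ENNReal.ofReal_ne_top, lintegral_Ioo_one_sub (fun τ =>
            ENNReal.ofReal (τ ^ (2 * b - n - 1) * huber (B * τ ^ (-b)) v))]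
      _ ≤ ENNReal.ofReal (2 ^ |c|) * ENNReal.ofReal (K * v ^ (n / b)) := by
          gcongr
          exact lintegral_huber_le hb1 hb2 hB0 hv
      _ = _ := by
          rw [ENNReal.ofReal_mul (by positivity), ENNReal.ofReal_mul (by positivity), mul_assoc]
  have hbound : ∀ ρ ∈ Ioo (0 : ℝ) 1, ∫⁻ r in Ioo (0 : ℝ) ρ, ENNReal.ofReal (r ^ (2 * n - 1)) *
      (ENNReal.ofReal ((1 - r ^ 2) ^ c) * hardyMass n q f r) ≤
      ENNReal.ofReal (2 ^ |c| * K) * M := fun ρ hρ => by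
    have hmeas : AEMeasurable (Function.uncurry fun (r : ℝ) (ζ : sphere (0 : Cn n) 1) =>
        ENNReal.ofReal ((1 - r ^ 2) ^ c) *
          ENNReal.ofReal (huber (L r) (‖f ((ρ : ℂ) • (ζ : Cn n))‖ ^ a)))
        ((volume.restrict (Ioo 0 ρ)).prod (sphereMeasure n)) := by
      have hv : Measurable fun ζ : sphere (0 : Cn n) 1 => ‖f ((ρ : ℂ) • (ζ : Cn n))‖ ^ a :=
        (hcont ρ hρ).measurable
      have hLm : Measurable L := by rw [hL]; fun_prop
      refine Measurable.aemeasurable ?_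
      simp only [huber_eq_tangent, Function.uncurry_def]
      have h1 : Measurable fun x : ℝ × sphere (0 : Cn n) 1 => L x.1 := hLm.comp measurable_fst
      have h2 : Measurable fun x : ℝ × sphere (0 : Cn n) 1 =>
        ‖f ((ρ : ℂ) • (x.2 : Cn n))‖ ^ a := hv.comp measurable_snd
      have h3 := h2.min h1
      exact (by fun_prop : Measurable fun x : ℝ × sphere (0 : Cn n) 1 =>
        ENNReal.ofReal ((1 - x.1 ^ 2) ^ c)).mul
          ((((h3.const_mul 2).mul h2).sub (h3.pow_const 2)).ennreal_ofReal)
    calc _ ≤ ∫⁻ r in Ioo (0 : ℝ) ρ, ∫⁻ ζ : sphere (0 : Cn n) 1,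
          ENNReal.ofReal ((1 - r ^ 2) ^ c) *
          ENNReal.ofReal (huber (L r) (‖f ((ρ : ℂ) • (ζ : Cn n))‖ ^ a)) ∂sphereMeasure n := by
          refine setLIntegral_mono' measurableSet_Ioo fun r hr => ?_
          rw [lintegral_const_mul' _ _ ENNReal.ofReal_ne_top]
          refine mul_le_of_le_one_of_le ?_ ?_
          · rw [ENNReal.ofReal_le_one]
            exact pow_le_one₀ hr.1.le (hr.2.trans hρ.2).le
          · exact mul_le_mul' le_rfl (hmean ρ hρ r hr)
      _ = ∫⁻ ζ : sphere (0 : Cn n) 1, ∫⁻ r in Ioo (0 : ℝ) ρ,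
          ENNReal.ofReal ((1 - r ^ 2) ^ c) *
          ENNReal.ofReal (huber (L r) (‖f ((ρ : ℂ) • (ζ : Cn n))‖ ^ a)) ∂volume
            ∂sphereMeasure n := lintegral_lintegral_swap hmeas
      _ ≤ ∫⁻ ζ : sphere (0 : Cn n) 1, ENNReal.ofReal (2 ^ |c| * K) *
          ‖f ((ρ : ℂ) • (ζ : Cn n))‖ₑ ^ p ∂sphereMeasure n := by
          -- For fixed `ζ` the value `v = |f (ρ ζ)| ^ a` no longer depends on `r`, and the radial
          -- integral is `O(v ^ (n / b))` with `a * (n / b) = p`.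
          refine lintegral_mono fun ζ => ?_
          refine (lintegral_mono_set (Ioo_subset_Ioo_right hρ.2.le)).trans ?_
          refine (hinner _ (by positivity)).trans_eq ?_
          rw [← Real.rpow_mul (norm_nonneg _), show a * (n / b) = p by rw [hb]; field_simp,
            ← ENNReal.ofReal_rpow_of_nonneg (norm_nonneg _) hp.le, ofReal_norm]
      _ ≤ ENNReal.ofReal (2 ^ |c| * K) * M := by
          rw [lintegral_const_mul' _ _ ENNReal.ofReal_ne_top]
          exact mul_le_mul' le_rfl (hm ρ hρ)
  rw [bergmanMass_polar hf]
  exact ENNReal.mul_lt_top (measure_lt_top _ _) ((setLIntegral_Ioo_le_of_forall hbound).trans_lt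
    (ENNReal.mul_lt_top ENNReal.ofReal_lt_top hM))

/-- The Hardy–Littlewood embedding of `H^p` into weighted Bergman spaces. -/
theorem bergmanMass_lt_top_of_hardy {f : Cn n → ℂ} (hf : DifferentiableOn ℂ f (unitBall n))
    {p q c : ℝ} (hp : 0 < p) (hpq : p < q) {M : ℝ≥0∞} (hM : M < ∞)
    (hm : ∀ r ∈ Ioo (0 : ℝ) 1, hardyMass n p f r ≤ M) (h : n / p ≤ (c + (n + 1)) / q) :
    bergmanMass n q c f < ∞ := by
  -- An intermediate exponent in `(p, 2 * p)`; `bergmanMass_mono_exponent` goes on to `q` with the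
  -- growth order `n / p` as starting value.
  set q₁ := min q (3 / 2 * p) with hq₁
  have h1 : p < q₁ := lt_min hpq (by linarith)
  have h2 : q₁ < 2 * p := (min_le_right _ _).trans_lt (by linarith)
  have hq0 : 0 < q₁ := hp.trans h1
  refine bergmanMass_mono_exponent hf hq0 (min_le_left _ _)
    (bergmanMass_lt_top_of_hardy_of_lt_two_mul hf hp h1 h2 hM hm) (le_of_eq_of_le ?_ h)
  field_simp
  ring

end

/-! ### The test functions `(1 - z₁) ^ (-s)`. -/

noncomputable section

open Metric Set

variable {n : ℕ}

theorem norm_apply_le_one (ζ : sphere (0 : Cn n) 1) (i : Fin n) : ‖(ζ : Cn n) i‖ ≤ 1 := by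
  have := PiLp.norm_apply_le (ζ : Cn n) i
  rwa [mem_sphere_zero_iff_norm.1 ζ.2] at this

/-- The test function `(1 - z_{i₀}) ^ (-s)`. -/
def testFun (i₀ : Fin n) (s : ℝ) (z : Cn n) : ℂ := (1 - z i₀) ^ ((-s : ℝ) : ℂ)

theorem one_sub_norm_le {z : Cn n} (i₀ : Fin n) : 1 - ‖z‖ ≤ ‖1 - z i₀‖ := by
  have h1 : ‖(1 : ℂ)‖ ≤ ‖1 - z i₀‖ + ‖z i₀‖ := by
    simpa using norm_add_le (1 - z i₀) (z i₀)
  rw [norm_one] at h1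
  linarith [PiLp.norm_apply_le z i₀]

theorem norm_testFun (i₀ : Fin n) (s : ℝ) {z : Cn n} (hz : z ∈ unitBall n) :
    ‖testFun i₀ s z‖ = ‖1 - z i₀‖ ^ (-s) := by
  have h1 : 1 - z i₀ ≠ 0 := norm_pos_iff.1
    ((sub_pos.2 (mem_ball_zero_iff.1 hz)).trans_le (one_sub_norm_le i₀))
  rw [testFun, Complex.norm_cpow_of_ne_zero h1, Complex.ofReal_re, Complex.ofReal_im]
  simp

theorem differentiableOn_testFun (i₀ : Fin n) (s : ℝ) :
    DifferentiableOn ℂ (testFun i₀ s) (unitBall n) := by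
  have h1 : DifferentiableOn ℂ (fun z : Cn n => 1 - z i₀) (unitBall n) := by fun_prop
  refine h1.cpow (differentiableOn_const _) fun z hz => ?_
  refine Or.inl ?_
  have h2 := Complex.re_le_norm (z i₀)
  have h3 := PiLp.norm_apply_le z i₀
  have h4 := mem_ball_zero_iff.1 hz
  simp only [Complex.sub_re, Complex.one_re]
  linarith

theorem norm_testFun_le (i₀ : Fin n) {s : ℝ} (hs : 0 ≤ s) {z : Cn n} (hz : z ∈ unitBall n) :
    ‖testFun i₀ s z‖ ≤ 2 ^ s * (1 - ‖z‖ ^ 2) ^ (-s) := by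
  have h1 := mem_ball_zero_iff.1 hz
  have h2 := one_sub_norm_sq_pos hz
  have h3 : (1 - ‖z‖ ^ 2) / 2 ≤ ‖1 - z i₀‖ := by
    have := one_sub_norm_le (z := z) i₀
    nlinarith [norm_nonneg z]
  rw [norm_testFun _ _ hz]
  calc ‖1 - z i₀‖ ^ (-s) ≤ ((1 - ‖z‖ ^ 2) / 2) ^ (-s) :=
        Real.rpow_le_rpow_of_nonpos (by positivity) h3 (by linarith)
    _ = _ := by
        rw [Real.div_rpow h2.le (by norm_num), Real.rpow_neg (by norm_num : (0 : ℝ) ≤ 2)]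
        field_simp

theorem le_of_forall_rpow_neg_le {d C : ℝ} (h : ∀ τ ∈ Ioo (0 : ℝ) 1, τ ^ (-d) ≤ C) : d ≤ 0 := by
  by_contra! hd
  have hC : 0 ≤ C := le_trans (by positivity) (h (1 / 2) ⟨by norm_num, by norm_num⟩)
  have h1 : (0 : ℝ) < C + 2 := by linarith
  -- At this `τ` the hypothesis reads `C + 2 ≤ C`.
  have := h ((C + 2) ^ (-d⁻¹)) ⟨by positivity,
    Real.rpow_lt_one_of_one_lt_of_neg (by linarith) (neg_lt_zero.2 (inv_pos.2 hd))⟩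
  rw [← Real.rpow_mul h1.le, neg_mul_neg, inv_mul_cancel₀ hd.ne', Real.rpow_one] at this
  linarith

/-- On the axis point with coordinate `1 - τ` the test function equals `τ ^ (-s)`, while `1 - ‖z‖ ^
2` is comparable to `τ`. -/
theorem le_of_testFun_growth (i₀ : Fin n) {s g C : ℝ} (hC : 0 ≤ C)
    (h : ∀ z ∈ unitBall n, ‖testFun i₀ s z‖ ≤ C * (1 - ‖z‖ ^ 2) ^ (-g)) : s ≤ g := by
  rw [← sub_nonpos]
  refine le_of_forall_rpow_neg_le (C := C * 2 ^ |-g|) fun τ hτ => ?_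
  have hr : 1 - τ ∈ Ioo (0 : ℝ) 1 := ⟨sub_pos.2 hτ.2, by linarith [hτ.1]⟩
  set z : Cn n := EuclideanSpace.single i₀ ((1 - τ : ℝ) : ℂ) with hz
  have hzn : ‖z‖ = 1 - τ := by
    rw [hz, PiLp.norm_single, Complex.norm_real, Real.norm_of_nonneg hr.1.le]
  have hzb : z ∈ unitBall n := by rw [mem_ball_zero_iff, hzn]; exact hr.2
  have h1 := h z hzb
  have h2 : 1 - z i₀ = (τ : ℂ) := by simp [hz]
  rw [norm_testFun _ _ hzb, h2, Complex.norm_real, Real.norm_of_nonneg hτ.1.le, hzn] at h1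
  have h3 := one_sub_sq_rpow_le hr (-g)
  rw [sub_sub_cancel] at h3
  have h4 : τ ^ (-s) ≤ C * (2 ^ |-g| * τ ^ (-g)) := h1.trans (by gcongr)
  rw [show -(s - g) = -s + g by ring, Real.rpow_add hτ.1]
  calc τ ^ (-s) * τ ^ g ≤ C * (2 ^ |-g| * τ ^ (-g)) * τ ^ g := by
        gcongr
        exact Real.rpow_nonneg hτ.1.le _
    _ = C * 2 ^ |-g| * (τ ^ (-g) * τ ^ g) := by ring
    _ = C * 2 ^ |-g| := by rw [← Real.rpow_add hτ.1]; simp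

variable [NeZero n]

/-- The nonisotropic cap of size `δ` has surface measure `O(δ ^ n)`. -/
theorem exists_sphereMeasure_cap_le (i₀ : Fin n) : ∃ C : ℝ, 0 ≤ C ∧ ∀ δ : ℝ, 0 < δ →
    sphereMeasure n {ζ | ‖1 - (ζ : Cn n) i₀‖ < δ} ≤ ENNReal.ofReal (C * δ ^ n) := by
  set s := (volume : Measure (Cn n)).toSphere univ with hs
  have hs0 : s ≠ 0 := toSphere_univ_ne_zero
  have hst : s ≠ ∞ := measure_ne_top _ _
  set V := volume (ball (0 : Cn n) 3) with hV
  have hVt : V ≠ ∞ := measure_ball_lt_top.ne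
  set k : ℝ≥0∞ := s * ENNReal.ofReal ((1 / 2) ^ (2 * n - 1)) with hk
  have hk0 : k ≠ 0 := mul_ne_zero hs0 (by
    rw [ne_eq, ENNReal.ofReal_eq_zero, not_le]; positivity)
  have hkt : k ≠ ∞ := ENNReal.mul_ne_top hst ENNReal.ofReal_ne_top
  refine ⟨(V / k).toReal + 2 ^ n, by positivity, fun δ hδ => ?_⟩
  rcases le_or_gt δ (1 / 2) with hδ2 | hδ2
  · have hWo : IsOpen {z : Cn n | ‖z‖ < 1 ∧ ‖1 - z i₀‖ < 2 * δ} :=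
      (isOpen_lt (f := fun z : Cn n => ‖z‖) (by fun_prop) continuous_const).inter
        (isOpen_lt (f := fun z : Cn n => ‖1 - z i₀‖) (by fun_prop) continuous_const)
    set W := {z : Cn n | ‖z‖ < 1 ∧ ‖1 - z i₀‖ < 2 * δ} with hW
    set A := {ζ : sphere (0 : Cn n) 1 | ‖1 - (ζ : Cn n) i₀‖ < δ} with hA
    have hAo : IsOpen A := isOpen_lt (f := fun ζ : sphere (0 : Cn n) 1 => ‖1 - (ζ : Cn n) i₀‖)
      (by fun_prop) continuous_const
    -- Thicken the cap radially by `δ`: the points `r ζ` with `1 - δ < r < 1` satisfy `‖1 - r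
    -- ζ_{i₀}‖ < 2 * δ`, a region of volume `O(δ ^ (n + 1))`. Since `δ ≤ 1 / 2`, the Jacobian is at
    -- least `(1 / 2) ^ (2 * n - 1)`.
    have hmain : sphereMeasure n A * k * ENNReal.ofReal δ ≤
        ENNReal.ofReal (δ ^ n) * V * ENNReal.ofReal δ := by
      calc sphereMeasure n A * k * ENNReal.ofReal δ
          = s * ∫⁻ _ in Ioo (1 - δ) 1, ENNReal.ofReal ((1 / 2) ^ (2 * n - 1)) *
            sphereMeasure n A := by
            rw [setLIntegral_const, Real.volume_Ioo, sub_sub_cancel, hk]; ring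
        _ ≤ s * ∫⁻ r in Ioi (0 : ℝ), ENNReal.ofReal (r ^ (2 * n - 1)) *
            ∫⁻ ζ : sphere (0 : Cn n) 1, W.indicator 1 ((r : ℂ) • (ζ : Cn n)) ∂sphereMeasure n := by
            refine mul_le_mul' le_rfl (le_trans (setLIntegral_mono' measurableSet_Ioo
              fun r hr => ?_) (lintegral_mono_set (fun r hr => ?_)))
            · have hr1 := hr.1
              have hr2 := hr.2
              gcongr
              · linarith
              rw [← lintegral_indicator_one hAo.measurableSet]
              refine lintegral_mono fun ζ' => ?_
              by_cases hζ' : ζ' ∈ A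
              swap
              · rw [indicator_of_notMem hζ']; exact zero_le
              rw [indicator_of_mem hζ', indicator_of_mem]
              · rfl
              refine ⟨?_, ?_⟩
              · rw [norm_smul_sphere, Complex.norm_real, Real.norm_of_nonneg (by linarith)]
                exact hr2
              · have h1 : (1 : ℂ) - ((r : ℂ) • (ζ' : Cn n)) i₀ =
                    (1 - (ζ' : Cn n) i₀) + ((1 - r : ℝ) : ℂ) * (ζ' : Cn n) i₀ := by
                  simp; ring
                have h2 := norm_add_le (1 - (ζ' : Cn n) i₀) (((1 - r : ℝ) : ℂ) * (ζ' : Cn n) i₀)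
                have h4 : ‖1 - (ζ' : Cn n) i₀‖ < δ := hζ'
                have h3 := norm_apply_le_one ζ' i₀
                rw [norm_mul, Complex.norm_real, Real.norm_of_nonneg (by linarith : 0 ≤ 1 - r)] at h2
                rw [h1]
                nlinarith
            · exact lt_of_le_of_lt (by linarith) hr.1
        _ = volume W := by
            rw [← lintegral_polar (measurable_one.indicator hWo.measurableSet),
              lintegral_indicator_one hWo.measurableSet]
        _ ≤ ENNReal.ofReal (δ ^ (n + 1)) * V := volume_cap_le i₀ hδ
        _ = _ := by rw [pow_succ, ENNReal.ofReal_mul (by positivity)]; ring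
    have hδ0 : ENNReal.ofReal δ ≠ 0 := by simpa using hδ
    rw [ENNReal.mul_le_mul_iff_left hδ0 ENNReal.ofReal_ne_top] at hmain
    have h2 : sphereMeasure n A ≤ ENNReal.ofReal (δ ^ n) * V / k := by
      rwa [ENNReal.le_div_iff_mul_le (Or.inl hk0) (Or.inl hkt)]
    refine h2.trans ?_
    rw [mul_div_assoc, ← ENNReal.ofReal_toReal (ENNReal.div_ne_top hVt hk0),
      ← ENNReal.ofReal_mul (by positivity)]
    refine ENNReal.ofReal_le_ofReal ?_
    have : 0 ≤ (2 : ℝ) ^ n * δ ^ n := by positivity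
    rw [ENNReal.toReal_ofReal (by positivity)]
    nlinarith
  · refine prob_le_one.trans ?_
    rw [← ENNReal.ofReal_one]
    refine ENNReal.ofReal_le_ofReal ?_
    have h1 : 1 ≤ (2 * δ) ^ n := one_le_pow₀ (by linarith)
    rw [mul_pow] at h1
    have : 0 ≤ (V / k).toReal * δ ^ n := by positivity
    nlinarith

/-- Layer cake: the set where the integrand exceeds `x` lies in a cap of size `2 * x ^ (-1 / t)`, of
measure `O(x ^ (-n / t))`, integrable at infinity as `n / t > 1`. The factor `2` comes from `1 - r ≤
‖1 - r ζ_{i₀}‖`. -/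
theorem exists_lintegral_one_sub_rpow_le (i₀ : Fin n) {t : ℝ} (ht0 : 0 < t) (htn : t < n) :
    ∃ M : ℝ≥0∞, M < ∞ ∧ ∀ r ∈ Ioo (0 : ℝ) 1, ∫⁻ ζ : sphere (0 : Cn n) 1,
      ENNReal.ofReal (‖1 - (r : ℂ) * (ζ : Cn n) i₀‖ ^ (-t)) ∂sphereMeasure n ≤ M := by
  obtain ⟨C, hC, hcap⟩ := exists_sphereMeasure_cap_le i₀
  have hnt : 1 < n / t := by rwa [one_lt_div ht0]
  refine ⟨1 + ENNReal.ofReal (C * 2 ^ n) * ENNReal.ofReal (-1 ^ (-(n / t) + 1) / (-(n / t) + 1)),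
    ?_, fun r hr => ?_⟩
  · exact ENNReal.add_lt_top.2 ⟨ENNReal.one_lt_top,
      ENNReal.mul_lt_top ENNReal.ofReal_lt_top ENNReal.ofReal_lt_top⟩
  have hlow : ∀ ζ : sphere (0 : Cn n) 1, 1 - r ≤ ‖1 - (r : ℂ) * (ζ : Cn n) i₀‖ := fun ζ => by
    have h1 : ‖(1 : ℂ)‖ ≤ ‖1 - (r : ℂ) * (ζ : Cn n) i₀‖ + ‖(r : ℂ) * (ζ : Cn n) i₀‖ := by
      simpa using norm_add_le (1 - (r : ℂ) * (ζ : Cn n) i₀) ((r : ℂ) * (ζ : Cn n) i₀)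
    rw [norm_one, norm_mul, Complex.norm_real, Real.norm_of_nonneg hr.1.le] at h1
    have := norm_apply_le_one ζ i₀
    nlinarith [hr.1]
  have hpos : ∀ ζ : sphere (0 : Cn n) 1, 0 < ‖1 - (r : ℂ) * (ζ : Cn n) i₀‖ := fun ζ =>
    (sub_pos.2 hr.2).trans_le (hlow ζ)
  have hmeas : Measurable fun ζ : sphere (0 : Cn n) 1 => ‖1 - (r : ℂ) * (ζ : Cn n) i₀‖ ^ (-t) :=
    (Continuous.measurable (by fun_prop)).pow_const _
  rw [lintegral_eq_lintegral_meas_lt _ (Filter.Eventually.of_forall fun ζ => by positivity)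
    hmeas.aemeasurable]
  have hsub : Ioi (0 : ℝ) ⊆ Ioc 0 1 ∪ Ioi 1 := fun x hx => by
    rcases le_or_gt x 1 with h | h
    · exact Or.inl ⟨hx, h⟩
    · exact Or.inr h
  refine (lintegral_mono_set hsub).trans ((lintegral_union_le _ _ _).trans (add_le_add ?_ ?_))
  · calc _ ≤ ∫⁻ _ in Ioc (0 : ℝ) 1, (1 : ℝ≥0∞) := lintegral_mono fun _ => prob_le_one
      _ = 1 := by simp
  · rw [← lintegral_Ioi_rpow (by linarith) one_pos, ← lintegral_const_mul' _ _ ENNReal.ofReal_ne_top]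
    refine setLIntegral_mono' measurableSet_Ioi fun x (hx : 1 < x) => ?_
    have hx0 : 0 < x := one_pos.trans hx
    have hsubset : {ζ : sphere (0 : Cn n) 1 | x < ‖1 - (r : ℂ) * (ζ : Cn n) i₀‖ ^ (-t)} ⊆
        {ζ | ‖1 - (ζ : Cn n) i₀‖ < 2 * x ^ (-t⁻¹)} := fun ζ hζ => by
      have h1 : ‖1 - (r : ℂ) * (ζ : Cn n) i₀‖ < x ^ (-t⁻¹) := by
        have h2 := Real.rpow_lt_rpow_of_neg hx0 hζ (neg_lt_zero.2 (inv_pos.2 ht0))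
        rwa [← Real.rpow_mul (hpos ζ).le, neg_mul_neg, mul_inv_cancel₀ ht0.ne', Real.rpow_one] at h2
      have h3 : (1 : ℂ) - (ζ : Cn n) i₀ =
          (1 - (r : ℂ) * (ζ : Cn n) i₀) - ((1 - r : ℝ) : ℂ) * (ζ : Cn n) i₀ := by push_cast; ring
      have h4 := norm_sub_le (1 - (r : ℂ) * (ζ : Cn n) i₀) (((1 - r : ℝ) : ℂ) * (ζ : Cn n) i₀)
      have h5 := norm_apply_le_one ζ i₀
      have h6 := hlow ζ
      rw [norm_mul, Complex.norm_real, Real.norm_of_nonneg (sub_pos.2 hr.2).le, ← h3] at h4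
      have h7 := sub_pos.2 hr.2
      change ‖1 - (ζ : Cn n) i₀‖ < _
      nlinarith
    refine (measure_mono hsubset).trans ((hcap _ (by positivity)).trans_eq ?_)
    rw [← ENNReal.ofReal_mul (by positivity), mul_pow, ← Real.rpow_natCast (x ^ (-t⁻¹)),
      ← Real.rpow_mul hx0.le, mul_assoc]
    congr 4
    ring

theorem exists_hardyMass_testFun_le (i₀ : Fin n) {s q : ℝ} (hs : 0 < s) (hq : 0 < q)
    (hsq : s * q < n) : ∃ M : ℝ≥0∞, M < ∞ ∧
      ∀ r ∈ Ioo (0 : ℝ) 1, hardyMass n q (testFun i₀ s) r ≤ M := by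
  obtain ⟨M, hM, h⟩ := exists_lintegral_one_sub_rpow_le i₀ (mul_pos hs hq) hsq
  refine ⟨M, hM, fun r hr => (lintegral_congr fun ζ => ?_).trans_le (h r hr)⟩
  have hz : (r : ℂ) • (ζ : Cn n) ∈ unitBall n := by
    rw [mem_ball_zero_iff, norm_smul_sphere, Complex.norm_real, Real.norm_of_nonneg hr.1.le]
    exact hr.2
  rw [← ofReal_norm, ENNReal.ofReal_rpow_of_nonneg (norm_nonneg _) hq.le, norm_testFun _ _ hz,
    ← Real.rpow_mul (norm_nonneg _), neg_mul]
  rfl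

end

/-! ### Random signs, Khinchine's inequality and flat homogeneous polynomials. -/

noncomputable section

open Metric Set

section RandomSigns

variable {W : Type*} [Fintype W] [DecidableEq W]

theorem sum_units_int (g : ℤˣ → ℝ) : ∑ s : ℤˣ, g s = g 1 + g (-1) := by
  rw [UnitsInt.univ, Finset.sum_pair (by decide)]

/-- Independence turns the sum into a product of `2 cosh (x w)`, and `cosh x ≤ exp (x ^ 2 / 2)`. -/
theorem sum_signs_exp_le (x : W → ℝ) :
    ∑ ε : W → ℤˣ, Real.exp (∑ w, ((ε w : ℤ) : ℝ) * x w) ≤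
      Fintype.card (W → ℤˣ) * Real.exp ((∑ w, x w ^ 2) / 2) := by
  have h1 : ∑ ε : W → ℤˣ, Real.exp (∑ w, ((ε w : ℤ) : ℝ) * x w) =
      ∏ w, ∑ s : ℤˣ, Real.exp (((s : ℤ) : ℝ) * x w) := by
    rw [Finset.prod_univ_sum, Fintype.piFinset_univ]
    exact Finset.sum_congr rfl fun ε _ => Real.exp_sum _ _
  rw [h1, Finset.sum_div, Real.exp_sum, Fintype.card_fun, Fintype.card_units_int, Nat.cast_pow,
    ← Finset.card_univ (α := W), ← Finset.prod_const, ← Finset.prod_mul_distrib]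
  refine Finset.prod_le_prod (fun w _ => Finset.sum_nonneg fun s _ => (Real.exp_pos _).le)
    fun w _ => ?_
  rw [sum_units_int]
  have h2 := Real.cosh_le_exp_half_sq (x w)
  rw [Real.cosh_eq] at h2
  simp only [Units.val_one, Int.cast_one, one_mul, Units.val_neg, Int.cast_neg, neg_mul,
    Nat.cast_ofNat]
  linarith

theorem sum_signs_abs_pow_le (x : W → ℝ) (hx : ∑ w, x w ^ 2 ≤ 1) (k : ℕ) :
    ∑ ε : W → ℤˣ, |∑ w, ((ε w : ℤ) : ℝ) * x w| ^ k ≤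
      Fintype.card (W → ℤˣ) * (k.factorial * (2 * Real.exp (1 / 2))) := by
  have hpt : ∀ y : ℝ, |y| ^ k ≤ k.factorial * (Real.exp y + Real.exp (-y)) := fun y => by
    have h1 := Real.pow_div_factorial_le_exp |y| (abs_nonneg y) k
    rw [div_le_iff₀ (by positivity)] at h1
    have h2 : Real.exp |y| ≤ Real.exp y + Real.exp (-y) := by
      rcases abs_cases y with h | h <;> rw [h.1] <;> linarith [Real.exp_pos y, Real.exp_pos (-y)]
    have : (0 : ℝ) ≤ k.factorial := by positivity
    nlinarith
  have hneg : ∀ ε : W → ℤˣ, -∑ w, ((ε w : ℤ) : ℝ) * x w = ∑ w, ((ε w : ℤ) : ℝ) * (-x w) :=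
    fun ε => by rw [← Finset.sum_neg_distrib]; exact Finset.sum_congr rfl fun w _ => by ring
  have hbound : ∀ y : W → ℝ, ∑ w, y w ^ 2 ≤ 1 →
      ∑ ε : W → ℤˣ, Real.exp (∑ w, ((ε w : ℤ) : ℝ) * y w) ≤
      Fintype.card (W → ℤˣ) * Real.exp (1 / 2) := fun y hy =>
    (sum_signs_exp_le y).trans (by gcongr)
  have h1 := hbound x hx
  have h2 := hbound (fun w => -x w) (by simpa using hx)
  calc ∑ ε : W → ℤˣ, |∑ w, ((ε w : ℤ) : ℝ) * x w| ^ k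
      ≤ ∑ ε : W → ℤˣ, k.factorial * (Real.exp (∑ w, ((ε w : ℤ) : ℝ) * x w) +
          Real.exp (∑ w, ((ε w : ℤ) : ℝ) * (-x w))) :=
        Finset.sum_le_sum fun ε _ => by rw [← hneg]; exact hpt _
    _ = k.factorial * ((∑ ε : W → ℤˣ, Real.exp (∑ w, ((ε w : ℤ) : ℝ) * x w)) +
          ∑ ε : W → ℤˣ, Real.exp (∑ w, ((ε w : ℤ) : ℝ) * (-x w))) := by
        rw [← Finset.mul_sum, Finset.sum_add_distrib]
    _ ≤ k.factorial * (Fintype.card (W → ℤˣ) * Real.exp (1 / 2) +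
          Fintype.card (W → ℤˣ) * Real.exp (1 / 2)) := by gcongr
    _ = _ := by ring

/-- The constant in Khinchine's inequality. -/
def khinchineConst (k : ℕ) : ℝ := 2 ^ k * (4 * k.factorial * Real.exp (1 / 2))

theorem khinchineConst_pos (k : ℕ) : 0 < khinchineConst k := by
  unfold khinchineConst; positivity

/-- Khinchine's inequality for random signs. -/
theorem sum_signs_norm_pow_le (b : W → ℂ) (hb : ∑ w, ‖b w‖ ^ 2 ≤ 1) (k : ℕ) :
    ∑ ε : W → ℤˣ, ‖∑ w, ((ε w : ℤ) : ℂ) * b w‖ ^ k ≤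
      Fintype.card (W → ℤˣ) * khinchineConst k := by
  have hre : ∀ ε : W → ℤˣ, (∑ w, ((ε w : ℤ) : ℂ) * b w).re = ∑ w, ((ε w : ℤ) : ℝ) * (b w).re :=
    fun ε => by
      rw [Complex.re_sum]
      exact Finset.sum_congr rfl fun w _ => by simp
  have him : ∀ ε : W → ℤˣ, (∑ w, ((ε w : ℤ) : ℂ) * b w).im = ∑ w, ((ε w : ℤ) : ℝ) * (b w).im :=
    fun ε => by
      rw [Complex.im_sum]
      exact Finset.sum_congr rfl fun w _ => by simp
  have hsq : ∀ w, ‖b w‖ ^ 2 = (b w).re ^ 2 + (b w).im ^ 2 := fun w => by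
    rw [← Complex.normSq_eq_norm_sq, Complex.normSq_apply]; ring
  have h1 : ∑ w, (b w).re ^ 2 ≤ 1 := le_trans
    (Finset.sum_le_sum fun w _ => by rw [hsq]; nlinarith [sq_nonneg (b w).im]) hb
  have h2 : ∑ w, (b w).im ^ 2 ≤ 1 := le_trans
    (Finset.sum_le_sum fun w _ => by rw [hsq]; nlinarith [sq_nonneg (b w).re]) hb
  have hpt : ∀ z : ℂ, ‖z‖ ^ k ≤ 2 ^ k * (|z.re| ^ k + |z.im| ^ k) := fun z => by
    have h3 : ‖z‖ ≤ 2 * max |z.re| |z.im| :=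
      (Complex.norm_le_abs_re_add_abs_im z).trans (by
        linarith [le_max_left |z.re| |z.im|, le_max_right |z.re| |z.im|])
    calc ‖z‖ ^ k ≤ (2 * max |z.re| |z.im|) ^ k := by gcongr
      _ = 2 ^ k * (max |z.re| |z.im|) ^ k := mul_pow _ _ _
      _ ≤ _ := by
        gcongr
        rcases max_cases |z.re| |z.im| with h | h <;> rw [h.1]
        · exact le_add_of_nonneg_right (by positivity)
        · exact le_add_of_nonneg_left (by positivity)
  calc ∑ ε : W → ℤˣ, ‖∑ w, ((ε w : ℤ) : ℂ) * b w‖ ^ k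
      ≤ ∑ ε : W → ℤˣ, 2 ^ k * (|∑ w, ((ε w : ℤ) : ℝ) * (b w).re| ^ k +
          |∑ w, ((ε w : ℤ) : ℝ) * (b w).im| ^ k) :=
        Finset.sum_le_sum fun ε _ => by rw [← hre, ← him]; exact hpt _
    _ = 2 ^ k * ((∑ ε : W → ℤˣ, |∑ w, ((ε w : ℤ) : ℝ) * (b w).re| ^ k) +
          ∑ ε : W → ℤˣ, |∑ w, ((ε w : ℤ) : ℝ) * (b w).im| ^ k) := by
        rw [← Finset.mul_sum, Finset.sum_add_distrib]
    _ ≤ 2 ^ k * (Fintype.card (W → ℤˣ) * (k.factorial * (2 * Real.exp (1 / 2))) +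
          Fintype.card (W → ℤˣ) * (k.factorial * (2 * Real.exp (1 / 2)))) := by
        gcongr
        · exact sum_signs_abs_pow_le _ h1 k
        · exact sum_signs_abs_pow_le _ h2 k
    _ = _ := by rw [khinchineConst]; ring

/-- Flipping the single sign `ε v` negates every term when `v ≠ w`. -/
theorem sum_signs_mul_eq (v w : W) : ∑ ε : W → ℤˣ, ((ε v : ℤ) : ℂ) * ((ε w : ℤ) : ℂ) =
    if v = w then (Fintype.card (W → ℤˣ) : ℂ) else 0 := by
  split_ifs with h
  · subst h
    have : ∀ ε : W → ℤˣ, ((ε v : ℤ) : ℂ) * ((ε v : ℤ) : ℂ) = 1 := fun ε => by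
      rw [← Int.cast_mul, ← Units.val_mul, Int.units_mul_self]; simp
    simp [this]
  · have hflip := Equiv.sum_comp (Equiv.mulLeft (Pi.mulSingle v (-1) : W → ℤˣ))
      (fun ε : W → ℤˣ => ((ε v : ℤ) : ℂ) * ((ε w : ℤ) : ℂ))
    have hterm : ∀ ε : W → ℤˣ,
        (((Equiv.mulLeft (Pi.mulSingle v (-1) : W → ℤˣ) ε) v : ℤ) : ℂ) *
        (((Equiv.mulLeft (Pi.mulSingle v (-1) : W → ℤˣ) ε) w : ℤ) : ℂ) =
        -(((ε v : ℤ) : ℂ) * ((ε w : ℤ) : ℂ)) := fun ε => by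
      simp [Pi.mulSingle_eq_of_ne (Ne.symm h)]
    simp only [hterm, Finset.sum_neg_distrib] at hflip
    exact self_eq_neg.1 hflip.symm

theorem sum_signs_norm_sq (b : W → ℂ) :
    ∑ ε : W → ℤˣ, ‖∑ w, ((ε w : ℤ) : ℂ) * b w‖ ^ 2 =
      Fintype.card (W → ℤˣ) * ∑ w, ‖b w‖ ^ 2 := by
  have hc : ((∑ ε : W → ℤˣ, ‖∑ w, ((ε w : ℤ) : ℂ) * b w‖ ^ 2 : ℝ) : ℂ) =
      ((Fintype.card (W → ℤˣ) * ∑ w, ‖b w‖ ^ 2 : ℝ) : ℂ) := by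
    push_cast
    calc ∑ ε : W → ℤˣ, (‖∑ w, ((ε w : ℤ) : ℂ) * b w‖ : ℂ) ^ 2
        = ∑ ε : W → ℤˣ, ∑ v, ∑ w, (((ε v : ℤ) : ℂ) * ((ε w : ℤ) : ℂ)) *
            (b v * (starRingEnd ℂ) (b w)) := by
          refine Finset.sum_congr rfl fun ε _ => ?_
          rw [← Complex.mul_conj', map_sum, Finset.sum_mul_sum]
          refine Finset.sum_congr rfl fun v _ => Finset.sum_congr rfl fun w _ => ?_
          rw [map_mul, map_intCast]
          ring
      _ = ∑ v, ∑ w, (∑ ε : W → ℤˣ, ((ε v : ℤ) : ℂ) * ((ε w : ℤ) : ℂ)) *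
            (b v * (starRingEnd ℂ) (b w)) := by
          rw [Finset.sum_comm]
          refine Finset.sum_congr rfl fun v _ => ?_
          rw [Finset.sum_comm]
          exact Finset.sum_congr rfl fun w _ => by rw [Finset.sum_mul]
      _ = _ := by
          simp only [sum_signs_mul_eq, ite_mul, zero_mul, Finset.sum_ite_eq, Finset.mem_univ,
            if_true]
          rw [Finset.mul_sum]
          exact Finset.sum_congr rfl fun v _ => by rw [Complex.mul_conj']
  exact_mod_cast hc

end RandomSigns

variable {n : ℕ}

/-- The homogeneous polynomial `∑ ε_w z_{w 1} ⋯ z_{w N}`, the sum ranging over words. -/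
def signPoly {N : ℕ} (ε : (Fin N → Fin n) → ℤˣ) (z : Cn n) : ℂ :=
  ∑ w : Fin N → Fin n, ((ε w : ℤ) : ℂ) * ∏ t, z (w t)

theorem differentiable_signPoly {N : ℕ} (ε : (Fin N → Fin n) → ℤˣ) :
    Differentiable ℂ (signPoly ε) := by
  unfold signPoly
  fun_prop

theorem signPoly_smul {N : ℕ} (ε : (Fin N → Fin n) → ℤˣ) (c : ℂ) (z : Cn n) :
    signPoly ε (c • z) = c ^ N * signPoly ε z := by
  unfold signPoly
  rw [Finset.mul_sum]
  refine Finset.sum_congr rfl fun w _ => ?_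
  simp only [PiLp.smul_apply, smul_eq_mul, Finset.prod_mul_distrib, Finset.prod_const,
    Finset.card_univ, Fintype.card_fin]
  ring

/-- This is `(∑ ‖ζ i‖ ^ 2) ^ N` expanded. Summing over words rather than monomials supplies the
multinomial weights, so the sign averages are the same at every point of the sphere. -/
theorem sum_norm_sq_words (N : ℕ) (ζ : sphere (0 : Cn n) 1) :
    ∑ w : Fin N → Fin n, ‖∏ t, (ζ : Cn n) (w t)‖ ^ 2 = 1 := by
  have h1 : ∑ i, ‖(ζ : Cn n) i‖ ^ 2 = 1 := by
    rw [← EuclideanSpace.norm_sq_eq, mem_sphere_zero_iff_norm.1 ζ.2, one_pow]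
  have h2 := Finset.prod_univ_sum (fun _ : Fin N => (Finset.univ : Finset (Fin n)))
    (fun _ i => ‖(ζ : Cn n) i‖ ^ 2)
  rw [Fintype.piFinset_univ, h1, Finset.prod_const_one] at h2
  refine Eq.trans (Finset.sum_congr rfl fun w _ => ?_) h2.symm
  rw [norm_prod, Finset.prod_pow]

variable [NeZero n]

theorem integrable_of_continuous_sphere {g : sphere (0 : Cn n) 1 → ℝ} (hg : Continuous g) :
    Integrable g (sphereMeasure n) :=
  hg.integrable_of_hasCompactSupport (HasCompactSupport.of_compactSpace _)

/-- Signs for which the polynomial is large in `L²` and bounded in `L^k`. -/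
theorem exists_signPoly (k : ℕ) (hk : 4 ≤ k) : ∃ C : ℝ, 0 ≤ C ∧ ∀ N : ℕ,
    ∃ ε : (Fin N → Fin n) → ℤˣ,
      1 / 2 ≤ ∫ ζ : sphere (0 : Cn n) 1, ‖signPoly ε (ζ : Cn n)‖ ^ 2 ∂sphereMeasure n ∧
      ∫ ζ : sphere (0 : Cn n) 1, ‖signPoly ε (ζ : Cn n)‖ ^ k ∂sphereMeasure n ≤ C := by
  set κ := khinchineConst k with hκ
  have hκ0 : 0 < κ := khinchineConst_pos k
  -- With this `c` the average over signs of `‖P‖₂ ^ 2 - c ‖P‖_k ^ k` is at least `1 - c * κ = 1 /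
  -- 2`, so some choice of signs achieves it.
  set c := 1 / (2 * κ) with hc
  have hc0 : 0 < c := by positivity
  set δ := c / 2 with hδ
  have hδ0 : 0 < δ := by positivity
  set K := 1 / (4 * δ) + δ with hK
  refine ⟨K / δ, by positivity, fun N => ?_⟩
  have hcont : ∀ ε : (Fin N → Fin n) → ℤˣ, Continuous fun ζ : sphere (0 : Cn n) 1 =>
      signPoly ε (ζ : Cn n) := fun ε => (differentiable_signPoly ε).continuous.comp (by fun_prop)
  have hi : ∀ (ε : (Fin N → Fin n) → ℤˣ) (j : ℕ), Integrable (fun ζ : sphere (0 : Cn n) 1 =>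
      ‖signPoly ε (ζ : Cn n)‖ ^ j) (sphereMeasure n) := fun ε j =>
    integrable_of_continuous_sphere ((hcont ε).norm.pow j)
  have hsum : ∑ ε : (Fin N → Fin n) → ℤˣ, (1 / 2 : ℝ) ≤ ∑ ε : (Fin N → Fin n) → ℤˣ,
      ((∫ ζ : sphere (0 : Cn n) 1, ‖signPoly ε (ζ : Cn n)‖ ^ 2 ∂sphereMeasure n) -
        c * ∫ ζ : sphere (0 : Cn n) 1, ‖signPoly ε (ζ : Cn n)‖ ^ k ∂sphereMeasure n) := by
    rw [Finset.sum_sub_distrib, ← Finset.mul_sum, ← integral_finsetSum _ fun ε _ => hi ε 2,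
      ← integral_finsetSum _ fun ε _ => hi ε k]
    have h2 : ∀ ζ : sphere (0 : Cn n) 1, ∑ ε : (Fin N → Fin n) → ℤˣ,
        ‖signPoly ε (ζ : Cn n)‖ ^ 2 = Fintype.card ((Fin N → Fin n) → ℤˣ) := fun ζ => by
      have := sum_signs_norm_sq (fun w : Fin N → Fin n => ∏ t, (ζ : Cn n) (w t))
      rw [sum_norm_sq_words, mul_one] at this
      exact this
    have h3 : ∫ ζ : sphere (0 : Cn n) 1, ∑ ε : (Fin N → Fin n) → ℤˣ,
        ‖signPoly ε (ζ : Cn n)‖ ^ k ∂sphereMeasure n ≤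
        Fintype.card ((Fin N → Fin n) → ℤˣ) * κ := by
      calc _ ≤ ∫ _ : sphere (0 : Cn n) 1,
            (Fintype.card ((Fin N → Fin n) → ℤˣ) * κ : ℝ) ∂sphereMeasure n := by
            refine integral_mono (integrable_finsetSum _ fun ε _ => hi ε k)
              (integrable_const _) fun ζ => ?_
            exact sum_signs_norm_pow_le _ (sum_norm_sq_words N ζ).le k
        _ = _ := by simp
    simp_rw [h2]
    have h4 : c * (Fintype.card ((Fin N → Fin n) → ℤˣ) * κ) =
        Fintype.card ((Fin N → Fin n) → ℤˣ) / 2 := by rw [hc]; field_simp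
    have h5 := mul_le_mul_of_nonneg_left h3 hc0.le
    rw [h4] at h5
    simp only [Finset.sum_const, nsmul_eq_mul, Finset.card_univ, integral_const, probReal_univ,
      smul_eq_mul, one_mul]
    linarith
  obtain ⟨ε, -, hε⟩ := Finset.exists_le_of_sum_le Finset.univ_nonempty hsum
  set F := ∫ ζ : sphere (0 : Cn n) 1, ‖signPoly ε (ζ : Cn n)‖ ^ 2 ∂sphereMeasure n with hF
  set G := ∫ ζ : sphere (0 : Cn n) 1, ‖signPoly ε (ζ : Cn n)‖ ^ k ∂sphereMeasure n with hG
  have hG0 : 0 ≤ G := integral_nonneg fun ζ => by positivity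
  refine ⟨ε, by nlinarith, ?_⟩
  -- Integrated, this gives `1 / 2 + 2 * δ * G ≤ F ≤ K + δ * G`, which bounds `G` by `K / δ`.
  have hpt : ∀ x : ℝ, 0 ≤ x → x ^ 2 ≤ K + δ * x ^ k := fun x hx => by
    have h1 : x ^ 4 ≤ 1 + x ^ k := by
      rcases le_total x 1 with h | h
      · have := pow_le_one₀ hx h (n := 4)
        have : 0 ≤ x ^ k := by positivity
        linarith
      · have := pow_le_pow_right₀ h hk
        linarith
    have h2 : x ^ 2 ≤ 1 / (4 * δ) + δ * x ^ 4 := by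
      have h3 : 0 ≤ (1 / (4 * δ)) * (1 - 2 * δ * x ^ 2) ^ 2 := by positivity
      have h4 : (1 / (4 * δ)) * (1 - 2 * δ * x ^ 2) ^ 2 =
        1 / (4 * δ) + δ * x ^ 4 - x ^ 2 := by field_simp; ring
      linarith
    rw [hK]
    nlinarith
  have hFG : F ≤ K + δ * G := by
    calc F ≤ ∫ ζ : sphere (0 : Cn n) 1, (K + δ * ‖signPoly ε (ζ : Cn n)‖ ^ k) ∂sphereMeasure n :=
          integral_mono (hi ε 2) ((integrable_const _).add ((hi ε k).const_mul _))
            fun ζ => hpt _ (norm_nonneg _)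
      _ = _ := by
          rw [integral_add (integrable_const _) ((hi ε k).const_mul _), integral_const_mul]
          simp [hG]
  rw [le_div_iff₀ hδ0]
  have : c = 2 * δ := by rw [hδ]; ring
  rw [this] at hε
  nlinarith

/-- Homogeneous polynomials of every degree with `L²` norm bounded below on the sphere and with
supremum growing slower than any given power of the degree. -/
theorem exists_homogeneous_flat {η : ℝ} (hη : 0 < η) : ∃ C : ℝ, 0 < C ∧ ∀ N : ℕ, 1 ≤ N →
    ∃ P : Cn n → ℂ, Differentiable ℂ P ∧ (∀ (c : ℂ) (z : Cn n), P (c • z) = c ^ N * P z) ∧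
      (∀ ζ : sphere (0 : Cn n) 1, ‖P ζ‖ ≤ C * (N : ℝ) ^ η) ∧
      1 / 2 ≤ ∫ ζ : sphere (0 : Cn n) 1, ‖P (ζ : Cn n)‖ ^ 2 ∂sphereMeasure n := by
  -- The growth exponent `n / k` of `H^k` is then at most `η`.
  obtain ⟨k, hk⟩ := exists_nat_ge (max 4 (n / η))
  have hk4 : 4 ≤ k := by exact_mod_cast (le_max_left _ _).trans hk
  have hkn : (n : ℝ) / k ≤ η := by
    have h1 : (n : ℝ) / η ≤ k := (le_max_right _ _).trans hk
    have : (0 : ℝ) < k := by positivity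
    rw [div_le_iff₀ hη] at h1
    rw [div_le_iff₀ this]; linarith
  have hk0 : (0 : ℝ) < k := by positivity
  obtain ⟨M, hM, h⟩ := exists_signPoly (n := n) k hk4
  set A : ℝ := ((volume : Measure (Cn n)).toSphere univ * ENNReal.ofReal (3 / 2) *
    ENNReal.ofReal M / volume (ball (0 : Cn n) (1 / 8))).toReal ^ ((k : ℝ))⁻¹ with hA
  have hA0 : 0 ≤ A := by positivity
  refine ⟨2 * A * 2 ^ η + 1, by positivity, fun N hN => ?_⟩
  obtain ⟨ε, h2, hkM⟩ := h N
  refine ⟨signPoly ε, differentiable_signPoly ε, signPoly_smul ε, fun ζ => ?_, h2⟩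
  have hcont : Continuous fun ζ : sphere (0 : Cn n) 1 => signPoly ε (ζ : Cn n) :=
    (differentiable_signPoly ε).continuous.comp (by fun_prop)
  have hmass : ∀ r ∈ Ioo (0 : ℝ) 1, hardyMass n k (signPoly ε) r ≤ ENNReal.ofReal M :=
    fun r hr => by
    refine le_trans ?_ (ENNReal.ofReal_le_ofReal hkM)
    rw [ofReal_integral_eq_lintegral_ofReal 
      (f := fun ζ : sphere (0 : Cn n) 1 => ‖signPoly ε (ζ : Cn n)‖ ^ k)
      (integrable_of_continuous_sphere (hcont.norm.pow k)) (Filter.Eventually.of_forall fun ζ => by positivity)]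
    refine lintegral_mono fun ζ => ?_
    rw [signPoly_smul, ENNReal.rpow_natCast, ← ofReal_norm, ← ENNReal.ofReal_pow (norm_nonneg _)]
    refine ENNReal.ofReal_le_ofReal ?_
    gcongr
    rw [norm_mul, norm_pow, Complex.norm_real, Real.norm_of_nonneg hr.1.le]
    exact mul_le_of_le_one_left (norm_nonneg _) (pow_le_one₀ hr.1.le hr.2.le)
  have hN0 : (1 : ℝ) ≤ N := by exact_mod_cast hN
  -- The growth bound is used at radius `1 - τ`: it costs `τ ^ (-n / k) = O(N ^ η)`, and homogeneity
  -- with Bernoulli's inequality returns to the unit sphere at the cost of a factor `2`.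
  set τ : ℝ := 1 / (2 * N) with hτ
  have hτ0 : 0 < τ := by positivity
  have hτN : N * τ = 1 / 2 := by rw [hτ]; field_simp
  have hτ2 : τ ≤ 1 / 2 := by nlinarith
  have hr : 1 - τ ∈ Ioo (0 : ℝ) 1 := ⟨by linarith, by linarith⟩
  have hbern : 1 / 2 ≤ (1 - τ) ^ N := by
    have := one_add_mul_le_pow (a := -τ) (by linarith) N
    rw [← sub_eq_add_neg] at this
    linarith
  have hz : ‖((1 - τ : ℝ) : ℂ) • (ζ : Cn n)‖ = 1 - τ := by
    rw [norm_smul_sphere, Complex.norm_real, Real.norm_of_nonneg hr.1.le]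
  have hg := growth_of_hardyMass (differentiable_signPoly ε).differentiableOn hk0
    ENNReal.ofReal_lt_top hmass (((1 - τ : ℝ) : ℂ) • (ζ : Cn n))
    (by rw [mem_ball_zero_iff, hz]; exact hr.2)
  rw [← hA, hz, signPoly_smul, norm_mul, norm_pow, Complex.norm_real,
    Real.norm_of_nonneg hr.1.le] at hg
  have hpow : (1 - (1 - τ) ^ 2) ^ (-((n : ℝ) / k)) ≤ 2 ^ η * (N : ℝ) ^ η := by
    calc (1 - (1 - τ) ^ 2) ^ (-((n : ℝ) / k)) ≤ τ ^ (-((n : ℝ) / k)) :=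
          Real.rpow_le_rpow_of_nonpos hτ0 (by nlinarith) (by
            have : (0 : ℝ) ≤ n / k := by positivity
            linarith)
      _ = (2 * N : ℝ) ^ ((n : ℝ) / k) := by
          rw [hτ, one_div, Real.inv_rpow (by positivity), Real.rpow_neg (by positivity), inv_inv]
      _ ≤ (2 * N : ℝ) ^ η := Real.rpow_le_rpow_of_exponent_le (by linarith) hkn
      _ = _ := Real.mul_rpow (by norm_num) (by positivity)
  have h3 : 1 / 2 * ‖signPoly ε (ζ : Cn n)‖ ≤ A * (2 ^ η * (N : ℝ) ^ η) :=
    calc _ ≤ (1 - τ) ^ N * ‖signPoly ε (ζ : Cn n)‖ := by gcongr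
      _ ≤ _ := hg.trans (by gcongr)
  have : 0 ≤ (N : ℝ) ^ η := by positivity
  nlinarith

end

/-! ### Lacunary series. -/

noncomputable section

open Metric Set

/-- With `x = N * (1 - s)` one has `s ^ N ≤ exp (-x)`, and `x ^ γ * exp (-x)` is bounded. -/
theorem exists_rpow_mul_pow_le {γ : ℝ} (hγ : 0 < γ) : ∃ K : ℝ, 0 < K ∧ ∀ (N : ℕ), ∀ s ∈ Ico (0 : ℝ) 1,
    (N : ℝ) ^ γ * s ^ N ≤ K * (1 - s) ^ (-γ) := by
  obtain ⟨m, hm⟩ := exists_nat_ge γ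
  refine ⟨m.factorial, by positivity, fun N s hs => ?_⟩
  have hτ : 0 < 1 - s := sub_pos.2 hs.2
  set x : ℝ := N * (1 - s) with hx
  have hx0 : 0 ≤ x := by positivity
  have h1 : s ^ N ≤ Real.exp (-x) := by
    calc s ^ N ≤ (Real.exp (-(1 - s))) ^ N := by
          gcongr
          · exact hs.1
          · linarith [Real.one_sub_le_exp_neg (1 - s)]
      _ = Real.exp (-x) := by rw [← Real.exp_nat_mul, hx]; congr 1; ring
  have h2 : x ^ γ * Real.exp (-x) ≤ m.factorial := by
    rw [Real.exp_neg, ← div_eq_mul_inv, div_le_iff₀ (Real.exp_pos _)]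
    rcases le_total x 1 with h | h
    · have h3 : x ^ γ ≤ 1 := Real.rpow_le_one hx0 h hγ.le
      have h4 : (1 : ℝ) ≤ m.factorial := by exact_mod_cast m.factorial_pos
      have h5 := Real.one_le_exp hx0
      nlinarith
    · have h3 : x ^ γ ≤ x ^ m := by
        rw [← Real.rpow_natCast]; exact Real.rpow_le_rpow_of_exponent_le h hm
      have h4 := Real.pow_div_factorial_le_exp x hx0 m
      rw [div_le_iff₀ (by positivity)] at h4
      linarith
  have h6 : (N : ℝ) ^ γ = x ^ γ * (1 - s) ^ (-γ) := by
    rw [hx, Real.mul_rpow (by positivity) hτ.le, mul_assoc, ← Real.rpow_add hτ]; simp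
  calc (N : ℝ) ^ γ * s ^ N ≤ (N : ℝ) ^ γ * Real.exp (-x) := by gcongr
    _ = (x ^ γ * Real.exp (-x)) * (1 - s) ^ (-γ) := by rw [h6]; ring
    _ ≤ _ := by gcongr

variable {n : ℕ}

theorem norm_fderiv_le_of_forall_norm_le {P : Cn n → ℂ} (hP : Differentiable ℂ P) {ρ ρ' M : ℝ}
    (hρ : ρ < ρ') (hM : 0 ≤ M) (h : ∀ z, ‖z‖ ≤ ρ' → ‖P z‖ ≤ M) {z : Cn n} (hz : ‖z‖ ≤ ρ) :
    ‖fderiv ℂ P z‖ ≤ M / (ρ' - ρ) := by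
  have hd : 0 < ρ' - ρ := by linarith
  refine ContinuousLinearMap.opNorm_le_bound _ (by positivity) fun v => ?_
  by_cases hv : v = 0
  · simp [hv]
  have hv0 : 0 < ‖v‖ := norm_pos_iff.2 hv
  have hg : Differentiable ℂ fun w : ℂ => P (z + w • v) := hP.comp (by fun_prop)
  have h1 := Complex.norm_deriv_le_of_forall_mem_sphere_norm_le (c := 0) (R := (ρ' - ρ) / ‖v‖)
    (f := fun w : ℂ => P (z + w • v)) (C := M) (by positivity) hg.diffContOnCl fun w hw => by
      refine h _ ((norm_add_le _ _).trans ?_)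
      rw [norm_smul, mem_sphere_zero_iff_norm.1 hw, div_mul_cancel₀ _ hv0.ne']
      linarith
  have h2 : deriv (fun w : ℂ => P (z + w • v)) 0 = fderiv ℂ P z v := by
    have h3 : HasDerivAt (fun w : ℂ => z + w • v) v 0 := by
      simpa using ((hasDerivAt_id (0 : ℂ)).smul_const v).const_add z
    have h4 : HasFDerivAt P (fderiv ℂ P z) (z + (0 : ℂ) • v) := by
      simpa using (hP z).hasFDerivAt
    exact (h4.comp_hasDerivAt (0 : ℂ) h3).deriv
  rw [h2] at h1
  refine h1.trans_eq ?_
  field_simp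

/-- A series of entire functions that is dominated on smaller balls is holomorphic. -/
theorem differentiableOn_tsum_unitBall {F : ℕ → Cn n → ℂ} (hF : ∀ j, Differentiable ℂ (F j))
    {u : ℝ → ℕ → ℝ} (hu : ∀ ρ ∈ Ioo (0 : ℝ) 1, Summable (u ρ))
    (hle : ∀ ρ ∈ Ioo (0 : ℝ) 1, ∀ j z, ‖z‖ ≤ ρ → ‖F j z‖ ≤ u ρ j) :
    DifferentiableOn ℂ (fun z => ∑' j, F j z) (unitBall n) := by
  intro z hz
  have hz1 := mem_ball_zero_iff.1 hz
  have hz0 := norm_nonneg z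
  set ρ := (1 + ‖z‖) / 2 with hρ
  set ρ' := (1 + ρ) / 2 with hρ'
  have hρ1 : ρ < 1 := by rw [hρ]; linarith
  have hρρ' : ρ < ρ' := by rw [hρ']; linarith
  have hmem : ρ' ∈ Ioo (0 : ℝ) 1 := ⟨by rw [hρ', hρ]; linarith, by rw [hρ']; linarith⟩
  have hzρ : ‖z‖ < ρ := by rw [hρ]; linarith
  have hM : ∀ j, 0 ≤ u ρ' j := fun j =>
    (norm_nonneg _).trans (hle ρ' hmem j 0 (by simpa using hmem.1.le))
  refine (HasFDerivAt.differentiableAt (hasFDerivAt_tsum_of_isPreconnected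
    (u := fun j => u ρ' j / (ρ' - ρ)) ((hu ρ' hmem).div_const _) (isOpen_ball (x := 0) (ε := ρ))
    (convex_ball _ _).isPreconnected (fun j x _ => (hF j x).hasFDerivAt) (fun j x hx => ?_)
    (mem_ball_zero_iff.2 hzρ) ?_ (mem_ball_zero_iff.2 hzρ))).differentiableWithinAt
  · exact norm_fderiv_le_of_forall_norm_le (hF j) hρρ' (hM j) (fun y hy => hle ρ' hmem j y hy)
      (mem_ball_zero_iff.1 hx).le
  · exact Summable.of_norm_bounded (hu ρ' hmem) fun j => hle ρ' hmem j z (hzρ.trans hρρ').le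

/-- Rotation by the angle `π / (N - M)` multiplies the integrand by `-1` and preserves the measure.
-/
theorem integral_mul_conj_eq_zero {P Q : Cn n → ℂ} {N M : ℕ} (hNM : N ≠ M)
    (hP : ∀ (c : ℂ) (z : Cn n), P (c • z) = c ^ N * P z)
    (hQ : ∀ (c : ℂ) (z : Cn n), Q (c • z) = c ^ M * Q z) :
    ∫ ζ : sphere (0 : Cn n) 1, P ζ * (starRingEnd ℂ) (Q ζ) ∂sphereMeasure n = 0 := by
  set θ : ℝ := Real.pi / ((N : ℝ) - M) with hθ
  have hd : (N : ℝ) - M ≠ 0 := sub_ne_zero.2 (by exact_mod_cast hNM)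
  set u : sphere (0 : ℂ) 1 := ⟨Complex.exp (θ * Complex.I), by simp⟩ with hu
  have h1 := (measurePreserving_smul_sphere n u).integral_comp
    (Homeomorph.smul u).measurableEmbedding
    (fun ζ : sphere (0 : Cn n) 1 => P ζ * (starRingEnd ℂ) (Q ζ))
  have hfac : (u : ℂ) ^ N * (starRingEnd ℂ) ((u : ℂ) ^ M) = -1 := by
    rw [hu]
    simp only [map_pow, ← Complex.exp_conj, map_mul, Complex.conj_ofReal, Complex.conj_I]
    rw [← Complex.exp_nat_mul, ← Complex.exp_nat_mul, ← Complex.exp_add, ← Complex.exp_pi_mul_I]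
    congr 1
    have : ((N : ℂ) - M) * θ = Real.pi := by
      rw [hθ]; push_cast
      field_simp [show ((N : ℂ) - M) ≠ 0 by exact_mod_cast hd]
    linear_combination Complex.I * this
  have h2 : ∀ ζ : sphere (0 : Cn n) 1, P ((u • ζ : sphere (0 : Cn n) 1) : Cn n) *
      (starRingEnd ℂ) (Q ((u • ζ : sphere (0 : Cn n) 1) : Cn n)) =
      -(P ζ * (starRingEnd ℂ) (Q ζ)) := fun ζ => by
    change P ((u : ℂ) • (ζ : Cn n)) * (starRingEnd ℂ) (Q ((u : ℂ) • (ζ : Cn n))) = _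
    rw [hP, hQ, map_mul]
    linear_combination (P ζ * (starRingEnd ℂ) (Q ζ)) * hfac
  simp_rw [h2, integral_neg] at h1
  exact self_eq_neg.1 h1.symm

variable [NeZero n]

/-- The degrees of the lacunary series. -/
theorem summable_two_pow_rpow_neg {η : ℝ} (hη : 0 < η) :
    Summable fun j : ℕ => (((2 ^ j : ℕ) : ℝ)) ^ (-η) := by
  have h : ∀ j : ℕ, (((2 ^ j : ℕ) : ℝ)) ^ (-η) = ((2 : ℝ) ^ (-η)) ^ j := fun j => by
    push_cast
    rw [← Real.rpow_natCast 2 j, ← Real.rpow_mul (by norm_num), ← Real.rpow_natCast,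
      ← Real.rpow_mul (by norm_num), mul_comm]
  simp_rw [h]
  exact summable_geometric_of_lt_one (by positivity)
    (Real.rpow_lt_one_of_one_lt_of_neg (by norm_num) (by linarith))

/-- A lacunary series of growth order `γ` whose spherical `L¹` means are almost as large. -/
theorem exists_lacunary {γ η : ℝ} (hγ : 0 < γ) (hη : 0 < η) :
    ∃ f : Cn n → ℂ, DifferentiableOn ℂ f (unitBall n) ∧
      (∃ C : ℝ, 0 ≤ C ∧ ∀ z ∈ unitBall n, ‖f z‖ ≤ C * (1 - ‖z‖ ^ 2) ^ (-γ)) ∧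
      ∃ k : ℝ, 0 < k ∧ ∀ (j : ℕ), ∀ r ∈ Ioo (0 : ℝ) 1,
        ENNReal.ofReal (k * ((2 ^ j : ℕ) : ℝ) ^ (γ - 3 * η) * r ^ (2 ^ j)) ≤ hardyMass n 1 f r := by
  obtain ⟨C, hC, hflat⟩ := exists_homogeneous_flat (n := n) hη
  choose P hPd hPh hPs hP2 using fun j : ℕ => hflat (2 ^ j) Nat.one_le_two_pow
  obtain ⟨K, hK, hKle⟩ := exists_rpow_mul_pow_le hγ
  set X : ℕ → ℝ := fun j => ((2 ^ j : ℕ) : ℝ) with hX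
  have hX0 : ∀ j, 0 < X j := fun j => by simp [hX]
  -- The polynomials cost `X j ^ η` in supremum, so each term has growth `γ` with a summable factor
  -- `X j ^ (-η)` to spare.
  set a : ℕ → ℝ := fun j => X j ^ (γ - 2 * η) with ha
  have ha0 : ∀ j, 0 < a j := fun j => Real.rpow_pos_of_pos (hX0 j) _
  set F : ℕ → Cn n → ℂ := fun j z => (a j : ℂ) * P j z with hF
  have hFd : ∀ j, Differentiable ℂ (F j) := fun j => (hPd j).const_mul _
  have hPn : ∀ j z, ‖P j z‖ ≤ C * X j ^ η * ‖z‖ ^ (2 ^ j) := fun j z => by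
    by_cases hz : z = 0
    · have h0 := hPh j 0 0
      rw [zero_smul, zero_pow (by positivity), zero_mul] at h0
      rw [hz, h0, norm_zero]
      positivity
    · have hz0 : (‖z‖ : ℂ) ≠ 0 := by simpa using hz
      set ζ : sphere (0 : Cn n) 1 := ⟨(‖z‖ : ℂ)⁻¹ • z, by simp [norm_smul, hz]⟩ with hζ
      have h1 : z = (‖z‖ : ℂ) • (ζ : Cn n) := by
        rw [hζ, smul_smul, mul_inv_cancel₀ hz0, one_smul]
      have h2 : ‖P j z‖ = ‖z‖ ^ (2 ^ j) * ‖P j ζ‖ := by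
        conv_lhs => rw [h1]
        rw [hPh, norm_mul, norm_pow, Complex.norm_real, norm_norm]
      rw [h2, mul_comm]
      exact mul_le_mul_of_nonneg_right (hPs j ζ) (by positivity)
  have hFn : ∀ ρ ∈ Ico (0 : ℝ) 1, ∀ j z, ‖z‖ ≤ ρ →
      ‖F j z‖ ≤ C * K * (1 - ρ) ^ (-γ) * X j ^ (-η) := fun ρ hρ j z hz => by
    have h1 := hKle (2 ^ j) ρ hρ
    calc ‖F j z‖ = a j * ‖P j z‖ := by
          rw [hF, norm_mul, Complex.norm_real, Real.norm_of_nonneg (ha0 j).le]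
      _ ≤ a j * (C * X j ^ η * ρ ^ (2 ^ j)) := by
          have := (ha0 j).le
          gcongr
          exact (hPn j z).trans (by gcongr)
      _ = C * X j ^ (-η) * (X j ^ γ * ρ ^ (2 ^ j)) := by
          have : a j * X j ^ η = X j ^ (-η) * X j ^ γ := by
            rw [ha, ← Real.rpow_add (hX0 j), ← Real.rpow_add (hX0 j)]; congr 1; ring
          linear_combination C * ρ ^ (2 ^ j) * this
      _ ≤ C * X j ^ (-η) * (K * (1 - ρ) ^ (-γ)) := by
          have := Real.rpow_nonneg (hX0 j).le (-η)
          gcongr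
      _ = _ := by ring
  have hsum : Summable fun j => X j ^ (-η) := summable_two_pow_rpow_neg hη
  have hfd : DifferentiableOn ℂ (fun z => ∑' j, F j z) (unitBall n) :=
    differentiableOn_tsum_unitBall hFd (fun ρ _ => hsum.mul_left _)
      (fun ρ hρ j z hz => hFn ρ ⟨hρ.1.le, hρ.2⟩ j z hz)
  refine ⟨fun z => ∑' j, F j z, hfd, ⟨C * K * 2 ^ γ * ∑' j, X j ^ (-η), ?_, fun z hz => ?_⟩,
    1 / (2 * C), by positivity, fun j r hr => ?_⟩
  · have : 0 ≤ ∑' j, X j ^ (-η) := tsum_nonneg fun j => Real.rpow_nonneg (hX0 j).le _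
    positivity
  · have hz1 := mem_ball_zero_iff.1 hz
    have hD := one_sub_norm_sq_pos hz
    have h1 : ‖∑' j, F j z‖ ≤ ∑' j, C * K * (1 - ‖z‖) ^ (-γ) * X j ^ (-η) :=
      tsum_of_norm_bounded (hsum.mul_left _).hasSum
        fun j => hFn ‖z‖ ⟨norm_nonneg z, hz1⟩ j z le_rfl
    rw [tsum_mul_left] at h1
    refine h1.trans ?_
    have h2 : (1 - ‖z‖) ^ (-γ) ≤ 2 ^ γ * (1 - ‖z‖ ^ 2) ^ (-γ) := by
      calc (1 - ‖z‖) ^ (-γ) ≤ ((1 - ‖z‖ ^ 2) / 2) ^ (-γ) :=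
            Real.rpow_le_rpow_of_nonpos (by positivity) (by nlinarith [norm_nonneg z])
              (by linarith)
        _ = _ := by
            rw [Real.div_rpow hD.le (by norm_num), Real.rpow_neg (by norm_num : (0 : ℝ) ≤ 2)]
            field_simp
    have h3 : 0 ≤ ∑' j, X j ^ (-η) := tsum_nonneg fun j => Real.rpow_nonneg (hX0 j).le _
    calc C * K * (1 - ‖z‖) ^ (-γ) * ∑' j, X j ^ (-η)
        ≤ C * K * (2 ^ γ * (1 - ‖z‖ ^ 2) ^ (-γ)) * ∑' j, X j ^ (-η) := by gcongr
      _ = _ := by ring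
  · have hPc : ∀ l, Continuous fun ζ : sphere (0 : Cn n) 1 => P l ζ := fun l =>
      (hPd l).continuous.comp continuous_subtype_val
    have hrn : ∀ ζ : sphere (0 : Cn n) 1, ‖(r : ℂ) • (ζ : Cn n)‖ = r := fun ζ => by
      rw [norm_smul_sphere, Complex.norm_real, Real.norm_of_nonneg hr.1.le]
    -- Duality: pairing `f (r ζ)` with `P j` isolates the `j`th term by orthogonality, giving at
    -- least `a j * r ^ (2 ^ j) / 2`; the pairing is at most `C * X j ^ η` times the `L¹` mean, so
    -- the mean is of order `X j ^ (γ - 3 * η) * r ^ (2 ^ j)` or larger.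
    set G : ℕ → sphere (0 : Cn n) 1 → ℂ := fun l ζ =>
      F l ((r : ℂ) • (ζ : Cn n)) * (starRingEnd ℂ) (P j ζ) with hG
    have hGc : ∀ l, Continuous (G l) := fun l =>
      ((hFd l).continuous.comp (by fun_prop)).mul (Complex.continuous_conj.comp (hPc j))
    have hGi : ∀ l, Integrable (G l) (sphereMeasure n) := fun l =>
      (hGc l).integrable_of_hasCompactSupport (HasCompactSupport.of_compactSpace _)
    have hGn : ∀ l ζ, ‖G l ζ‖ ≤
        C * K * (1 - r) ^ (-γ) * X l ^ (-η) * (C * X j ^ η) := fun l ζ => by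
      rw [hG, norm_mul, RCLike.norm_conj]
      have h1 := hFn r ⟨hr.1.le, hr.2⟩ l _ (hrn ζ).le
      exact mul_le_mul h1 (hPs j ζ) (norm_nonneg _) ((norm_nonneg _).trans h1)
    have hs := hasSum_integral_of_summable_integral_norm hGi (by
      refine Summable.of_nonneg_of_le (fun l => integral_nonneg fun ζ => norm_nonneg _)
        (fun l => ?_) ((hsum.mul_left (C * K * (1 - r) ^ (-γ))).mul_right (C * X j ^ η))
      calc _ ≤ ∫ _ : sphere (0 : Cn n) 1,
            C * K * (1 - r) ^ (-γ) * X l ^ (-η) * (C * X j ^ η) ∂sphereMeasure n :=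
            integral_mono (hGi l).norm (integrable_const _) (hGn l)
        _ = _ := by rw [integral_const, probReal_univ, one_smul])
    have hGint : ∀ l, ∫ ζ, G l ζ ∂sphereMeasure n =
        ((a l * r ^ (2 ^ l) : ℝ) : ℂ) *
          ∫ ζ : sphere (0 : Cn n) 1, P l ζ * (starRingEnd ℂ) (P j ζ) ∂sphereMeasure n :=
      fun l => by
      rw [← integral_const_mul]
      refine integral_congr_ae (Filter.Eventually.of_forall fun ζ => ?_)
      simp only [hG, hF, hPh]
      push_cast
      ring
    have hself : ∫ ζ : sphere (0 : Cn n) 1, P j ζ * (starRingEnd ℂ) (P j ζ) ∂sphereMeasure n =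
        ((∫ ζ : sphere (0 : Cn n) 1, ‖P j ζ‖ ^ 2 ∂sphereMeasure n : ℝ) : ℂ) := by
      rw [← integral_complex_ofReal]
      refine integral_congr_ae (Filter.Eventually.of_forall fun ζ => ?_)
      simp only [Complex.mul_conj']
      push_cast
      rfl
    have hs' : HasSum (fun l => ∫ ζ, G l ζ ∂sphereMeasure n) (∫ ζ, G j ζ ∂sphereMeasure n) :=
      hasSum_single j fun l hl => by
        rw [hGint, integral_mul_conj_eq_zero (fun h => hl (Nat.pow_right_injective le_rfl h))
          (hPh l) (hPh j), mul_zero]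
    have hkey := hs.unique hs'
    set f : Cn n → ℂ := fun z => ∑' l, F l z with hf
    have hts : ∀ ζ : sphere (0 : Cn n) 1, ∑' l, G l ζ =
        f ((r : ℂ) • (ζ : Cn n)) * (starRingEnd ℂ) (P j ζ) := fun ζ => by
      rw [hf, hG]; exact tsum_mul_right
    simp_rw [hts] at hkey
    rw [hGint, hself] at hkey
    have hfc : Continuous fun ζ : sphere (0 : Cn n) 1 => f ((r : ℂ) • (ζ : Cn n)) :=
      continuous_sphere_slice hfd hr
    have hfi := integrable_of_continuous_sphere hfc.norm
    have hup : ‖∫ ζ : sphere (0 : Cn n) 1, f ((r : ℂ) • (ζ : Cn n)) *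
        (starRingEnd ℂ) (P j ζ) ∂sphereMeasure n‖ ≤
        (C * X j ^ η) * ∫ ζ : sphere (0 : Cn n) 1, ‖f ((r : ℂ) • (ζ : Cn n))‖ ∂sphereMeasure n := by
      rw [← integral_const_mul]
      refine norm_integral_le_of_norm_le (hfi.const_mul _) (Filter.Eventually.of_forall fun ζ => ?_)
      rw [norm_mul, RCLike.norm_conj, mul_comm]
      exact mul_le_mul_of_nonneg_right (hPs j ζ) (norm_nonneg _)
    have har : 0 ≤ a j * r ^ (2 ^ j) := mul_nonneg (ha0 j).le (pow_nonneg hr.1.le _)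
    rw [hkey, norm_mul, Complex.norm_real, Complex.norm_real, Real.norm_of_nonneg har] at hup
    have hlow : a j * r ^ (2 ^ j) * (1 / 2) ≤ (C * X j ^ η) *
        ∫ ζ : sphere (0 : Cn n) 1, ‖f ((r : ℂ) • (ζ : Cn n))‖ ∂sphereMeasure n :=
      (mul_le_mul_of_nonneg_left ((hP2 j).trans (Real.le_norm_self _)) har).trans hup
    have hmass : hardyMass n 1 f r = ENNReal.ofReal
        (∫ ζ : sphere (0 : Cn n) 1, ‖f ((r : ℂ) • (ζ : Cn n))‖ ∂sphereMeasure n) := by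
      rw [ofReal_integral_eq_lintegral_ofReal hfi
        (Filter.Eventually.of_forall fun ζ => norm_nonneg _), hardyMass]
      exact lintegral_congr fun ζ => by rw [ENNReal.rpow_one, ofReal_norm]
    rw [hmass]
    refine ENNReal.ofReal_le_ofReal ?_
    have hXη : 0 < X j ^ η := Real.rpow_pos_of_pos (hX0 j) _
    have haX : a j = X j ^ (γ - 3 * η) * X j ^ η := by
      rw [ha, ← Real.rpow_add (hX0 j)]
      ring_nf
    rw [haX] at hlow
    rw [div_mul_eq_mul_div, div_mul_eq_mul_div, div_le_iff₀ (by positivity)]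
    have hr2 : (X j ^ (γ - 3 * η) * r ^ (2 ^ j)) * X j ^ η ≤
        ((∫ ζ : sphere (0 : Cn n) 1, ‖f ((r : ℂ) • (ζ : Cn n))‖ ∂sphereMeasure n) * (2 * C)) *
          X j ^ η := by linarith
    rw [one_mul]
    exact le_of_mul_le_mul_right hr2 hXη

/-- A function of growth order `γ` that is not in the weighted `L¹` space with `c + 1 < γ`. -/
theorem exists_growth_bergmanMass_eq_top {γ c : ℝ} (hγ : 0 < γ) (hc : c + 1 < γ) :
    ∃ f : Cn n → ℂ, DifferentiableOn ℂ f (unitBall n) ∧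
      (∃ C : ℝ, 0 ≤ C ∧ ∀ z ∈ unitBall n, ‖f z‖ ≤ C * (1 - ‖z‖ ^ 2) ^ (-γ)) ∧
      bergmanMass n 1 c f = ∞ := by
  -- The annulus of width about `1 / X` contributes `X ^ (-1) * X ^ (-c) * X ^ (γ - 3 * η) = X ^ η`,
  -- unbounded in `j`.
  set η := (γ - c - 1) / 4 with hη
  have hη0 : 0 < η := by rw [hη]; linarith
  obtain ⟨f, hf, hgrow, k, hk, hlow⟩ := exists_lacunary (n := n) hγ hη0
  refine ⟨f, hf, hgrow, ?_⟩
  by_contra htop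
  set s := (volume : Measure (Cn n)).toSphere univ with hs
  have hst : s ≠ ∞ := measure_ne_top _ _
  have hs0 : 0 < s.toReal := ENNReal.toReal_pos toSphere_univ_ne_zero hst
  set κ : ℝ := s.toReal * ((1 / 2) ^ (2 * n - 1) * (2 ^ (-|c|) * 2 ^ (-c)) * (k / 2)) / 4 with hκ
  have hκ0 : 0 < κ := by positivity
  have hmain : ∀ j : ℕ, κ * ((2 : ℝ) ^ η) ^ j ≤ (bergmanMass n 1 c f).toReal := fun j => by
    set X : ℝ := ((2 ^ j : ℕ) : ℝ) with hX
    have hX1 : 1 ≤ X := by rw [hX]; exact_mod_cast Nat.one_le_two_pow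
    have hX0 : 0 < X := by linarith
    -- For `1 - 2 * τ < r < 1 - τ` Bernoulli's inequality gives `r ^ X ≥ 1 / 2`, and `1 - r ^ 2`
    -- lies between `τ` and `4 * τ`.
    set τ : ℝ := 1 / (4 * X) with hτ
    have hτ0 : 0 < τ := by positivity
    have hτX : X * τ = 1 / 4 := by rw [hτ]; field_simp
    have hτ1 : τ ≤ 1 / 4 := by nlinarith
    rw [← ENNReal.ofReal_le_iff_le_toReal htop, bergmanMass_polar hf]
    have hsub : Ioo (1 - 2 * τ) (1 - τ) ⊆ Ioo (0 : ℝ) 1 :=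
      Ioo_subset_Ioo (by linarith) (by linarith)
    set m : ℝ := (1 / 2) ^ (2 * n - 1) * ((2 ^ (-|c|) * (2 * τ) ^ c) *
      (k * X ^ (γ - 3 * η) * (1 / 2))) with hm
    have hm0 : 0 ≤ m := by positivity
    calc ENNReal.ofReal (κ * ((2 : ℝ) ^ η) ^ j) = s * ∫⁻ _ in Ioo (1 - 2 * τ) (1 - τ),
          ENNReal.ofReal m := by
          rw [setLIntegral_const, Real.volume_Ioo, ← ENNReal.ofReal_mul hm0,
            ← ENNReal.ofReal_toReal hst, ← ENNReal.ofReal_mul hs0.le]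
          congr 1
          have h1 : (2 * τ) ^ c = 2 ^ (-c) * X ^ (-c) := by
            rw [← Real.mul_rpow (by norm_num) hX0.le, Real.rpow_neg (by positivity),
              ← Real.inv_rpow (by positivity)]
            congr 1
            rw [hτ]; field_simp; norm_num
          have h2 : ((2 : ℝ) ^ η) ^ j = X ^ η := by
            rw [hX]; push_cast
            rw [← Real.rpow_natCast 2 j, ← Real.rpow_mul (by norm_num), ← Real.rpow_natCast,
              ← Real.rpow_mul (by norm_num), mul_comm]
          have h3 : X ^ η = X ^ (-c) * X ^ (γ - 3 * η) * X ^ (-1 : ℝ) := by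
            rw [← Real.rpow_add hX0, ← Real.rpow_add hX0]
            congr 1
            rw [hη]; ring
          rw [h2, h3, hm, h1, hκ, Real.rpow_neg_one,
            show 1 - τ - (1 - 2 * τ) = τ by ring, hτ]
          field_simp
      _ ≤ s * ∫⁻ r in Ioo (0 : ℝ) 1, ENNReal.ofReal (r ^ (2 * n - 1)) *
        (ENNReal.ofReal ((1 - r ^ 2) ^ c) * hardyMass n 1 f r) := by
          refine mul_le_mul' le_rfl (le_trans (setLIntegral_mono' measurableSet_Ioo fun r hr => ?_)
            (lintegral_mono_set hsub))
          have h1 := hr.1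
          have h2 := hr.2
          have hr' := hsub hr
          rw [hm, ENNReal.ofReal_mul (by positivity), ENNReal.ofReal_mul (by positivity)]
          refine mul_le_mul' (ENNReal.ofReal_le_ofReal ?_)
            (mul_le_mul' (ENNReal.ofReal_le_ofReal ?_) (le_trans (ENNReal.ofReal_le_ofReal ?_)
              (hlow j r hr')))
          · exact pow_le_pow_left₀ (by norm_num) (by linarith) _
          · exact two_rpow_neg_abs_mul_rpow_le (by positivity) (by nlinarith [hr'.1])
              (by nlinarith [hr'.1]) c
          · have hb := one_add_mul_le_pow (a := -(2 * τ)) (by linarith) (2 ^ j)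
            rw [← hX] at hb
            have hb2 : (1 + -(2 * τ)) ^ (2 ^ j) ≤ r ^ (2 ^ j) :=
              pow_le_pow_left₀ (by linarith) (by linarith) _
            gcongr
            linarith
  obtain ⟨j, hj⟩ := pow_unbounded_of_one_lt ((bergmanMass n 1 c f).toReal / κ)
    (Real.one_lt_rpow (by norm_num : (1 : ℝ) < 2) hη0)
  rw [div_lt_iff₀ hκ0] at hj
  linarith [hmain j]

end

/-! ### The inclusions between the spaces and their necessary conditions. -/

noncomputable section

open Metric Set

theorem exists_eq_ofReal {p : ℝ≥0∞} (hp : 0 < p) (hp' : p ≠ ∞) :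
    ∃ q : ℝ, 0 < q ∧ p = ENNReal.ofReal q :=
  ⟨p.toReal, ENNReal.toReal_pos hp.ne' hp', (ENNReal.ofReal_toReal hp').symm⟩

variable {n : ℕ}

theorem mem_bergmanSpace_top_of_growth {f : Cn n → ℂ} (hf : DifferentiableOn ℂ f (unitBall n))
    {C g α : ℝ} (hC : 0 ≤ C) (hg : ∀ z ∈ unitBall n, ‖f z‖ ≤ C * (1 - ‖z‖ ^ 2) ^ (-g))
    (h : g ≤ α) : f ∈ bergmanSpace n ∞ α := by
  refine mem_bergmanSpace_top.2 ⟨hf, C, fun z hz => ?_⟩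
  have h0 := one_sub_norm_sq_pos hz
  have h1 : 1 - ‖z‖ ^ 2 ≤ 1 := by linarith [sq_nonneg ‖z‖]
  calc (1 - ‖z‖ ^ 2) ^ α * ‖f z‖ ≤ (1 - ‖z‖ ^ 2) ^ α * (C * (1 - ‖z‖ ^ 2) ^ (-g)) :=
        mul_le_mul_of_nonneg_left (hg z hz) (Real.rpow_nonneg h0.le _)
    _ = C * (1 - ‖z‖ ^ 2) ^ (α - g) := by
        rw [show α - g = α + -g by ring, Real.rpow_add h0]; ring
    _ ≤ C * 1 := mul_le_mul_of_nonneg_left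
        (Real.rpow_le_one h0.le h1 (by linarith)) hC
    _ = C := mul_one C

theorem growth_of_mem_top {f : Cn n → ℂ} {α : ℝ} (hf : f ∈ bergmanSpace n ∞ α) :
    ∃ C, 0 ≤ C ∧ ∀ z ∈ unitBall n, ‖f z‖ ≤ C * (1 - ‖z‖ ^ 2) ^ (-α) := by
  obtain ⟨-, C, hC⟩ := mem_bergmanSpace_top.1 hf
  refine ⟨|C|, abs_nonneg C, fun z hz => ?_⟩
  have h0 := one_sub_norm_sq_pos hz
  rw [Real.rpow_neg h0.le, ← div_eq_mul_inv, le_div_iff₀ (Real.rpow_pos_of_pos h0 _), mul_comm]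
  exact (hC z hz).trans (le_abs_self C)

variable [NeZero n]

theorem growth_of_mem {p : ℝ≥0∞} (hp : 0 < p) {α : ℝ} {f : Cn n → ℂ}
    (hf : f ∈ bergmanSpace n p α) :
    ∃ C, 0 ≤ C ∧ ∀ z ∈ unitBall n,
      ‖f z‖ ≤ C * (1 - ‖z‖ ^ 2) ^ (-(α + ((n : ℝ) + 1) * recip p)) := by
  by_cases htop : p = ∞
  · subst htop
    simpa [recip_top] using growth_of_mem_top hf
  obtain ⟨q, hq, rfl⟩ := exists_eq_ofReal hp htop
  rw [recip_ofReal hq]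
  by_cases hα : α = -q⁻¹
  · obtain ⟨hd, M, hM, hm⟩ := (mem_hardySpace hq hα).1 hf
    have he : α + ((n : ℝ) + 1) * q⁻¹ = n / q := by rw [hα]; field_simp; ring
    rw [he]
    exact ⟨_, by positivity, growth_of_hardyMass hd hq hM hm⟩
  · obtain ⟨hd, hm⟩ := (mem_bergmanSpace hq hα).1 hf
    have he : α + ((n : ℝ) + 1) * q⁻¹ = (α * q + (n + 1)) / q := by field_simp
    rw [he]
    exact growth_of_bergmanMass hd hq hm

/-- With strict room in the weight the Hardy case need not be distinguished any more. -/
theorem bergmanMass_lt_top_of_mem {q α c : ℝ} (hq : 0 < q) {f : Cn n → ℂ}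
    (hf : f ∈ bergmanSpace n (ENNReal.ofReal q) α) (h : α + q⁻¹ < (c + 1) / q) :
    bergmanMass n q c f < ∞ := by
  have hc : α * q < c := by
    rw [lt_div_iff₀ hq, add_mul, inv_mul_cancel₀ hq.ne'] at h
    linarith
  by_cases hα : α = -q⁻¹
  · obtain ⟨hd, M, hM, hm⟩ := (mem_hardySpace hq hα).1 hf
    refine bergmanMass_lt_top_of_hardyMass hd ?_ hM hm
    rwa [hα, neg_mul, inv_mul_cancel₀ hq.ne'] at hc
  · obtain ⟨hd, hm⟩ := (mem_bergmanSpace hq hα).1 hf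
    exact bergmanMass_mono_exponent hd hq le_rfl hm (by gcongr)

theorem bergmanSpace_subset_of_le {p p' : ℝ≥0∞} (hp : 0 < p) (hpp' : p ≤ p') {α α' : ℝ}
    (hα : -recip p ≤ α) (hα' : -recip p' ≤ α')
    (h : α + ((n : ℝ) + 1) * recip p ≤ α' + ((n : ℝ) + 1) * recip p') :
    bergmanSpace n p α ⊆ bergmanSpace n p' α' := by
  intro f hf
  have hn : (0 : ℝ) ≤ n := n.cast_nonneg
  by_cases htop' : p' = ∞
  · subst htop'
    obtain ⟨C, hC, hg⟩ := growth_of_mem hp hf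
    rw [recip_top, mul_zero, add_zero] at h
    exact mem_bergmanSpace_top_of_growth hf.1 hC hg h
  obtain ⟨q', hq', rfl⟩ := exists_eq_ofReal (hp.trans_le hpp') htop'
  obtain ⟨q, hq, rfl⟩ := exists_eq_ofReal hp (ne_top_of_le_ne_top htop' hpp')
  rw [ENNReal.ofReal_le_ofReal_iff hq'.le] at hpp'
  rw [recip_ofReal hq] at hα h
  rw [recip_ofReal hq'] at hα' h
  have hinv : q'⁻¹ ≤ q⁻¹ := inv_anti₀ hq hpp'
  by_cases hαe : α = -q⁻¹
  · by_cases hαe' : α' = -q'⁻¹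
    · have hle : (n : ℝ) * q⁻¹ ≤ n * q'⁻¹ := by rw [hαe, hαe'] at h; linarith
      have hn' : (0 : ℝ) < n := Nat.cast_pos.2 (NeZero.pos n)
      have heq : q = q' := inv_injective (le_antisymm (le_of_mul_le_mul_left hle hn') hinv)
      subst heq
      rwa [hαe', ← hαe]
    · obtain ⟨hd, M, hM, hm⟩ := (mem_hardySpace hq hαe).1 hf
      refine (mem_bergmanSpace hq' hαe').2 ⟨hd, ?_⟩
      rcases hpp'.lt_or_eq with hlt | rfl
      · refine bergmanMass_lt_top_of_hardy hd hq hlt hM hm ?_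
        have e1 : (n : ℝ) / q = α + ((n : ℝ) + 1) * q⁻¹ := by rw [hαe]; field_simp; ring
        have e2 : (α' * q' + ((n : ℝ) + 1)) / q' = α' + ((n : ℝ) + 1) * q'⁻¹ := by field_simp
        rwa [e1, e2]
      · refine bergmanMass_lt_top_of_hardyMass hd ?_ hM hm
        have := mul_lt_mul_of_pos_right (lt_of_le_of_ne hα' (Ne.symm hαe')) hq
        rwa [neg_mul, inv_mul_cancel₀ hq.ne'] at this
  · have hlt : -q⁻¹ < α := lt_of_le_of_ne hα (Ne.symm hαe)
    -- The target cannot be a Hardy space: its right side would be `n / q' ≤ n / q`, which is less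
    -- than the left side.
    have hαe' : α' ≠ -q'⁻¹ := by
      intro he
      rw [he] at h
      have := mul_le_mul_of_nonneg_left hinv hn
      linarith
    obtain ⟨hd, hm⟩ := (mem_bergmanSpace hq hαe).1 hf
    refine (mem_bergmanSpace hq' hαe').2 ⟨hd, bergmanMass_mono_exponent hd hq hpp' hm ?_⟩
    have e1 : (α * q + ((n : ℝ) + 1)) / q = α + ((n : ℝ) + 1) * q⁻¹ := by field_simp
    have e2 : (α' * q' + ((n : ℝ) + 1)) / q' = α' + ((n : ℝ) + 1) * q'⁻¹ := by field_simp
    rwa [e1, e2]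

theorem le_of_bergmanSpace_subset {p p' : ℝ≥0∞} (hp : 0 < p) (hpp' : p ≤ p') {α α' : ℝ}
    (hα : -recip p ≤ α) (hα' : -recip p' ≤ α')
    (h : bergmanSpace n p α ⊆ bergmanSpace n p' α') :
    α + ((n : ℝ) + 1) * recip p ≤ α' + ((n : ℝ) + 1) * recip p' := by
  have hn : (0 : ℝ) < n := Nat.cast_pos.2 (NeZero.pos n)
  have hr' : 0 ≤ recip p' := ENNReal.toReal_nonneg
  have hnonneg : 0 ≤ α' + ((n : ℝ) + 1) * recip p' := by nlinarith
  let i₀ : Fin n := 0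
  by_contra! hlt
  by_cases htop : p = ∞
  · subst htop
    rw [recip_top, mul_zero, add_zero] at hlt
    have hα0 : 0 ≤ α := hnonneg.trans hlt.le
    have hmem : testFun i₀ α ∈ bergmanSpace n ∞ α :=
      mem_bergmanSpace_top_of_growth (differentiableOn_testFun i₀ α) (by positivity)
        (fun z hz => norm_testFun_le i₀ hα0 hz) le_rfl
    obtain ⟨C, hC, hg⟩ := growth_of_mem (hp.trans_le hpp') (h hmem)
    exact hlt.not_ge (le_of_testFun_growth i₀ hC hg)
  obtain ⟨q, hq, rfl⟩ := exists_eq_ofReal hp htop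
  obtain ⟨s, hs1, hs2⟩ := exists_between hlt
  have hs0 : 0 < s := hnonneg.trans_lt hs1
  have hα1 := hα
  rw [recip_ofReal hq] at hs2 hα1
  set A : ℝ := α + ((n : ℝ) + 1) * q⁻¹ with hA
  have hA0 : 0 < A := hs0.trans hs2
  have hQ : 0 < n / A := by positivity
  -- The Hardy space of exponent `n / A` has the same growth order `A` as the source, and `n / A ≤
  -- q` because `α ≥ -1 / q`. It contains the test function as `s * (n / A) < n`.
  have hsub : bergmanSpace n (ENNReal.ofReal (n / A)) (-(n / A)⁻¹) ⊆
      bergmanSpace n (ENNReal.ofReal q) α := by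
    refine bergmanSpace_subset_of_le (ENNReal.ofReal_pos.2 hQ) (ENNReal.ofReal_le_ofReal ?_)
      (by rw [recip_ofReal hQ]) hα (le_of_eq ?_)
    · rw [div_le_iff₀ hA0]
      have : q * A = (α + q⁻¹) * q + n := by rw [hA]; field_simp; ring
      rw [this]
      have := mul_nonneg (show 0 ≤ α + q⁻¹ by linarith) hq.le
      linarith
    · rw [recip_ofReal hQ, recip_ofReal hq, ← hA]
      field_simp
      ring
  obtain ⟨M, hM, hm⟩ := exists_hardyMass_testFun_le i₀ hs0 hQ
    (by rw [mul_div_assoc', div_lt_iff₀ hA0, mul_comm]; exact mul_lt_mul_of_pos_left hs2 hn)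
  have hmem := h (hsub ((mem_hardySpace hQ rfl).2 ⟨differentiableOn_testFun i₀ s, M, hM, hm⟩))
  obtain ⟨C, hC, hg⟩ := growth_of_mem (hp.trans_le hpp') hmem
  exact hs1.not_ge (le_of_testFun_growth i₀ hC hg)

theorem mem_bergmanSpace_of_growth {p : ℝ≥0∞} (hp : 0 < p) {f : Cn n → ℂ}
    (hf : DifferentiableOn ℂ f (unitBall n)) {C g α : ℝ} (hC : 0 ≤ C) (hg0 : 0 ≤ g)
    (hg : ∀ z ∈ unitBall n, ‖f z‖ ≤ C * (1 - ‖z‖ ^ 2) ^ (-g)) (h : g < α + recip p) :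
    f ∈ bergmanSpace n p α := by
  by_cases htop : p = ∞
  · subst htop
    rw [recip_top, add_zero] at h
    exact mem_bergmanSpace_top_of_growth hf hC hg h.le
  obtain ⟨q, hq, rfl⟩ := exists_eq_ofReal hp htop
  rw [recip_ofReal hq] at h
  refine (mem_bergmanSpace hq (by rintro rfl; linarith)).2
    ⟨hf, bergmanMass_lt_top_of_growth_of_lt hq hC hg ?_⟩
  have e : (α * q + 1) / q = α + q⁻¹ := by field_simp
  rwa [e]

theorem bergmanSpace_subset_of_lt {p p' : ℝ≥0∞} (hp' : 0 < p') (hpp' : p' ≤ p) {α α' : ℝ}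
    (hα : -recip p ≤ α) (h : α + recip p < α' + recip p') :
    bergmanSpace n p α ⊆ bergmanSpace n p' α' := by
  intro f hf
  by_cases htop : p = ∞
  · subst htop
    obtain ⟨C, hC, hg⟩ := growth_of_mem_top hf
    rw [recip_top, neg_zero] at hα
    rw [recip_top, add_zero] at h
    exact mem_bergmanSpace_of_growth hp' hf.1 hC hα hg h
  obtain ⟨q', hq', rfl⟩ := exists_eq_ofReal hp' (ne_top_of_le_ne_top htop hpp')
  obtain ⟨q, hq, rfl⟩ := exists_eq_ofReal (hp'.trans_le hpp') htop
  rw [ENNReal.ofReal_le_ofReal_iff hq.le] at hpp'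
  rw [recip_ofReal hq] at hα h
  rw [recip_ofReal hq'] at h
  refine (mem_bergmanSpace hq' (by rintro rfl; linarith)).2 ⟨hf.1, ?_⟩
  have e' : (α' * q' + 1) / q' = α' + q'⁻¹ := by field_simp
  rcases hpp'.lt_or_eq with hlt | rfl
  -- The intermediate `m` is realized by the weight exponent `m * q - 1`; passing through it treats
  -- Hardy and Bergman sources alike.
  · obtain ⟨m, hm1, hm2⟩ := exists_between h
    have e : (m * q - 1 + 1) / q = m := by field_simp; ring
    exact bergmanMass_lt_top_of_exponent_lt hq' hlt
      (bergmanMass_lt_top_of_mem hq hf (by rwa [e])) (by rwa [e, e'])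
  · exact bergmanMass_lt_top_of_mem hq hf (by rwa [e'])

theorem le_of_bergmanSpace_subset_of_ge {p p' : ℝ≥0∞} (hp' : 0 < p') (hpp' : p' ≤ p) {α α' : ℝ}
    (hα : -recip p ≤ α) (hα' : -recip p' ≤ α')
    (h : bergmanSpace n p α ⊆ bergmanSpace n p' α') : α + recip p ≤ α' + recip p' := by
  have hp : 0 < p := hp'.trans_le hpp'
  by_cases htop' : p' = ∞
  · obtain rfl : p = ∞ := top_le_iff.1 (htop' ▸ hpp')
    simpa [htop', recip_top] using le_of_bergmanSpace_subset hp htop'.ge hα hα' h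
  obtain ⟨q, hq, rfl⟩ := exists_eq_ofReal hp' htop'
  by_contra! hlt
  obtain ⟨γ, hγ1, hγ2⟩ := exists_between hlt
  obtain ⟨m, hm1, hm2⟩ := exists_between hγ1
  rw [recip_ofReal hq] at hα' hm1
  have hγ : 0 < γ := by linarith
  have e : (m * q - 1 + 1) / q = m := by field_simp; ring
  -- the part of the target space of growth order `γ` lies in a weighted `L¹` space
  obtain ⟨c, hc, hmass⟩ : ∃ c : ℝ, c + 1 < γ ∧ ∀ f ∈ bergmanSpace n (ENNReal.ofReal q) α',
      (∃ C, 0 ≤ C ∧ ∀ z ∈ unitBall n, ‖f z‖ ≤ C * (1 - ‖z‖ ^ 2) ^ (-γ)) →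
        bergmanMass n 1 c f < ∞ := by
    -- For `q ≤ 1` the exponent is raised to `1` using the growth of `f`, and `c + 1 = m * q + (1 -
    -- q) * γ` is an average of `m` and `γ`. For `q > 1` it is lowered to `1` with slightly larger
    -- weight.
    rcases le_or_gt q 1 with hq1 | hq1
    · refine ⟨m * q - 1 + (1 - q) * γ, ?_, fun f hf ⟨C, hC, hg⟩ => ?_⟩
      · have := mul_lt_mul_of_pos_right hm2 hq
        linarith
      · exact bergmanMass_lt_top_of_growth hq hq1 hC hg
          (bergmanMass_lt_top_of_mem hq hf (by rwa [e])) le_rfl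
    · obtain ⟨m', hm₁, hm₂⟩ := exists_between hm2
      refine ⟨m' - 1, by linarith, fun f hf _ => ?_⟩
      exact bergmanMass_lt_top_of_exponent_lt one_pos hq1
        (bergmanMass_lt_top_of_mem hq hf (by rwa [e])) (by rw [e]; linarith)
  obtain ⟨f, hf, ⟨C, hC, hg⟩, htop⟩ := exists_growth_bergmanMass_eq_top (n := n) hγ hc
  exact (hmass f (h (mem_bergmanSpace_of_growth hp hf hC hγ.le hg hγ2)) ⟨C, hC, hg⟩).ne htop

end

theorem lemma2p1 (n : ℕ) (hn : 1 ≤ n) (p p' : ℝ≥0∞) (hp : 0 < p) (hp' : 0 < p')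
    (α α' : ℝ) (hα : -recip p ≤ α) (hα' : -recip p' ≤ α') :
    (p ≤ p' →
      (bergmanSpace n p α ⊆ bergmanSpace n p' α' ↔
        α + ((n : ℝ) + 1) * recip p ≤ α' + ((n : ℝ) + 1) * recip p')) ∧
    (p' ≤ p →
      (α + recip p < α' + recip p' → bergmanSpace n p α ⊆ bergmanSpace n p' α') ∧
      (bergmanSpace n p α ⊆ bergmanSpace n p' α' → α + recip p ≤ α' + recip p')) := by
  have : NeZero n := ⟨by omega⟩
  exact ⟨fun h => ⟨le_of_bergmanSpace_subset hp h hα hα', bergmanSpace_subset_of_le hp h hα hα'⟩,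
    fun h => ⟨bergmanSpace_subset_of_lt hp' h hα, le_of_bergmanSpace_subset_of_ge hp' h hα hα'⟩⟩
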